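/- Consider $N\ge 1$ modes with position and momentum operators $\hat q_j$, $\hat p_j$, $[\hat q_j,\hat p_k]=i\delta_{jk}$ and $[\hat q_j,\hat q_k]=[\hat p_j,\hat p_k]=0$, and let $\hat x=(\hat q_1,\dots,\hat q_N,\hat p_1,\dots,\hat p_N)^\top$. Let $Z=X+iY$, with $X,Y$ real symmetric $N\times N$ matrices and $Y>0$, be the Gaussian graph matrix of a zero-mean $N$-mode pure Gaussian state, i.e. the state with wave function proportional to $\exp(\tfrac i2 x^\top Zx)$, equivalently with covariance matrix $$V=\tfrac12\begin{bmatrix}Y^{-1}&Y^{-1}X\\ XY^{-1}&XY^{-1}X+Y\end{bmatrix}.$$ Say that the state can be generated if there are real numbers $g_{jk}$ ($1\le j\le k\le N$), an index $\ell\in\{1,\dots,N\}$ and $c_1,c_2\in\mathbb C$ such that, with $\hat H=\sum_{j\le k}g_{jk}(\hat q_j\hat q_k+\hat p_j\hat p_k)$ and $\hat L=c_1\hat q_\ell+c_2\hat p_\ell$, the Lindblad master equation $$\tfrac{d}{dt}\hat\rho=-i[\hat H,\hat\rho]+\hat L\hat\rho\hat L^*-\tfrac12\hat L^*\hat L\hat\rho-\tfrac12\hat\rho\hat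 L^*\hat L$$ has the state as its unique steady state and is strictly stable, in the sense that the mean vector and the covariance matrix of every solution converge to $0$ and $V$ as $t\to\infty$. Here density operators are those with a Schwartz-class integral kernel, and the time derivative of a solution is taken in the topology of the Schwartz space of kernels. For $\bar z\in\mathbb C\setminus\{0\}$ put $$B_\pm(\bar z)=\begin{bmatrix}\frac{\bar z^2-1}{2\bar z}&\pm\frac{\bar z^2+1}{2\bar z}\\ \pm\frac{\bar z^2+1}{2\bar z}&\frac{\bar z^2-1}{2\bar z}\end{bmatrix}.$$ (i) If $N$ is odd, the state can be generated if and only if $$Z=\mathcal P^\top\begin{bmatrix}\bar z&0\\0&\mathcal Q^\top\bar Z\mathcal Q\end{bmatrix}\mathcal P,\qquad \bar Z=\mathrm{diag}[\tilde Z_1,\dots,\tilde Z_{(N-1)/2}],$$ for some $N\times N$ permutation matrix $\mathcal P$, some real orthogonal $(N-1)\times(N-1)$ matrix $\mathcal Q$, some $\bar z\in\mathbb C$ with $\mathrm{Im}\,\bar z>0$, and some $\tilde Z_j\in\{B_+(\bar z),B_-(\bar z)\}$, $1\le j\le (N-1)/2$. (ii) If $N$ is even, the state can be generated if and only if $$Z=\mathcal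 P^\top\begin{bmatrix}\bar z&0\\0&\mathcal Q^\top\bar Z\mathcal Q\end{bmatrix}\mathcal P,\qquad \bar Z=\mathrm{diag}[\tilde Z_1,\tilde Z_2,\dots,\tilde Z_{N/2}],$$ for some $N\times N$ permutation matrix $\mathcal P$, some real orthogonal $(N-1)\times(N-1)$ matrix $\mathcal Q$, some $\bar z\in\mathbb C$ with $\mathrm{Im}\,\bar z>0$, the $1\times1$ block $\tilde Z_1=-1/\bar z$, and some $\tilde Z_j\in\{B_+(\bar z),B_-(\bar z)\}$, $2\le j\le N/2$. -/

import Mathlib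

open MeasureTheory Filter Topology
open scoped SchwartzMap ComplexConjugate LineDeriv

noncomputable section

namespace LinQuantum

/-! ### Position and momentum operators, density operators, traces -/

/-- The configuration space `ℝ^N` of `N` modes. -/
abbrev Config (N : ℕ) : Type := EuclideanSpace ℝ (Fin N)

/-- The Schwartz space `𝓢(ℝ^N)`, the common invariant core of the position and momentum operators
in `L²(ℝ^N)`. -/
abbrev Wave (N : ℕ) : Type := 𝓢(Config N, ℂ)

/-- Operators on the core `𝓢(ℝ^N)`; the product is composition. -/
abbrev Op (N : ℕ) : Type := Module.End ℂ (Wave N)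

/-- Integral kernels of Schwartz class, `K(x, y)` with `x, y ∈ ℝ^N`. -/
abbrev Kernel (N : ℕ) : Type := 𝓢(Config N × Config N, ℂ)

/-- The position operator of the `j`th mode, `(q_j φ)(x) = x_j φ(x)`. -/
def posOp {N : ℕ} (j : Fin N) : Op N :=
  (SchwartzMap.smulLeftCLM ℂ (fun x : Config N => ((x j : ℝ) : ℂ))).toLinearMap

/-- The momentum operator of the `j`th mode, `p_j φ = -i ∂φ/∂x_j` (with `ℏ = 1`). -/
def momOp {N : ℕ} (j : Fin N) : Op N :=
  (-Complex.I) • (LineDeriv.lineDerivOpCLM ℂ (Wave N) (EuclideanSpace.single j (1 : ℝ))).toLinearMap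

theorem posOp_apply {N : ℕ} (j : Fin N) (φ : Wave N) (x : Config N) :
    posOp j φ x = ((x j : ℝ) : ℂ) * φ x := by
  have h : Function.HasTemperateGrowth (fun x : Config N => ((x j : ℝ) : ℂ)) :=
    (Complex.ofRealCLM.comp
      (EuclideanSpace.proj j : Config N →L[ℝ] ℝ)).hasTemperateGrowth
  simpa [posOp] using SchwartzMap.smulLeftCLM_apply_apply h φ x

theorem momOp_apply {N : ℕ} (j : Fin N) (φ : Wave N) (x : Config N) :
    momOp j φ x = -Complex.I * lineDeriv ℝ φ x (EuclideanSpace.single j (1 : ℝ)) := by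
  simp [momOp, SchwartzMap.lineDerivOp_apply]

/-- The vector of operators `(q_1, …, q_N, p_1, …, p_N)`. -/
def quadOp {N : ℕ} : Fin N ⊕ Fin N → Op N := Sum.elim posOp momOp

/-- `A` is the integral operator with the Schwartz kernel `K`. -/
def HasKernel {N : ℕ} (A : Op N) (K : Kernel N) : Prop :=
  ∀ (φ : Wave N) (x : Config N), A φ x = ∫ y, K (x, y) * φ y

theorem HasKernel.unique {N : ℕ} {A : Op N} {K K' : Kernel N}
    (h : HasKernel A K) (h' : HasKernel A K') : K = K' := by
  have key : ∀ x : Config N, (fun y => K (x, y)) = fun y => K' (x, y) := by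
    intro x
    have c : Continuous fun y => K (x, y) := K.continuous.comp (by fun_prop)
    have c' : Continuous fun y => K' (x, y) := K'.continuous.comp (by fun_prop)
    refine (c.ae_eq_iff_eq volume c').1 ?_
    refine ae_eq_of_integral_contDiff_smul_eq c.locallyIntegrable c'.locallyIntegrable ?_
    intro g hg hgs
    have hs : HasCompactSupport (fun y => ((g y : ℝ) : ℂ)) :=
      hgs.comp_left (g := fun r : ℝ => (r : ℂ)) (by simp)
    have hd : ContDiff ℝ (⊤ : ℕ∞) (fun y => ((g y : ℝ) : ℂ)) := Complex.ofRealCLM.contDiff.comp hg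
    have e := (h (hs.toSchwartzMap hd) x).symm.trans (h' (hs.toSchwartzMap hd) x)
    simpa [mul_comm, Complex.real_smul] using e
  ext ⟨x, y⟩
  exact congrFun (key x) y

open scoped Classical in
/-- The trace of an operator with a Schwartz kernel: the integral of the kernel over the diagonal.
(Operators without a Schwartz kernel get the value `0`, which is never used.) -/
def opTrace {N : ℕ} (A : Op N) : ℂ :=
  if h : ∃ K, HasKernel A K then ∫ x, h.choose (x, x) else 0

theorem HasKernel.opTrace_eq {N : ℕ} {A : Op N} {K : Kernel N} (h : HasKernel A K) :
    opTrace A = ∫ x, K (x, x) := by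
  have hex : ∃ K, HasKernel A K := ⟨K, h⟩
  rw [opTrace, dif_pos hex, hex.choose_spec.unique h]

/-- Density operators with a Schwartz kernel, equivalently those with finite moments of all orders:
positive operators of trace one. On these the Lindblad master equation with quadratic Hamiltonian
and linear Lindblad operators makes literal sense. All Gaussian states are of this kind. -/
def IsDensityOperator {N : ℕ} (ρ : Op N) : Prop :=
  (∃ K, HasKernel ρ K) ∧
  (∀ φ : Wave N, 0 ≤ (∫ x, conj (φ x) * ρ φ x).re ∧ (∫ x, conj (φ x) * ρ φ x).im = 0) ∧
  opTrace ρ = 1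

/-- The mean vector `⟨x⟩ = tr(x ρ)`. -/
def mean {N : ℕ} (ρ : Op N) (a : Fin N ⊕ Fin N) : ℂ := opTrace (quadOp a * ρ)

/-- The covariance matrix, `½ ⟨Δx Δxᵀ + (Δx Δxᵀ)ᵀ⟩` with `Δx = x - ⟨x⟩`. -/
def cov {N : ℕ} (ρ : Op N) (a b : Fin N ⊕ Fin N) : ℂ :=
  let Δ : Fin N ⊕ Fin N → Op N := fun c => quadOp c - mean ρ c • (1 : Op N)
  (1 / 2 : ℂ) * opTrace ((Δ a * Δ b + Δ b * Δ a) * ρ)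

/-! ### The Lindblad master equation -/

/-- The Lindblad operator `∑ₐ cₐ xₐ` with complex coefficients `c`. As the `xₐ` are symmetric, its
adjoint is `linOp (star c)`. -/
def linOp {N : ℕ} (c : Fin N ⊕ Fin N → ℂ) : Op N := ∑ a, c a • quadOp a

/-- The right-hand side of the master equation,
`-i[H, ρ] + ∑ₖ (cₖ ρ cₖ* - ½ cₖ* cₖ ρ - ½ ρ cₖ* cₖ)`, for the coupling vector `L = C x`. -/
def lindbladian {N K : ℕ} (H : Op N) (C : Matrix (Fin K) (Fin N ⊕ Fin N) ℂ) (ρ : Op N) : Op N :=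
  (-Complex.I) • (H * ρ - ρ * H) +
    ∑ k, (linOp (C k) * ρ * linOp (star (C k))
      - (1 / 2 : ℂ) • (linOp (star (C k)) * linOp (C k) * ρ)
      - (1 / 2 : ℂ) • (ρ * (linOp (star (C k)) * linOp (C k))))

/-- `ρ` is a steady state of the master equation. -/
def IsSteadyState {N K : ℕ} (H : Op N) (C : Matrix (Fin K) (Fin N ⊕ Fin N) ℂ) (ρ : Op N) : Prop :=
  IsDensityOperator ρ ∧ lindbladian H C ρ = 0

/-- `ρ(t)`, `t ≥ 0`, is a solution of the master equation `dρ/dt = lindbladian ρ` in density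
operators; the derivative is that of the kernels in the topology of the Schwartz space. -/
def IsSolution {N K : ℕ} (H : Op N) (C : Matrix (Fin K) (Fin N ⊕ Fin N) ℂ) (ρ : ℝ → Op N) : Prop :=
  ∃ κ κ' : ℝ → Kernel N, ∀ t : ℝ, 0 ≤ t →
    IsDensityOperator (ρ t) ∧ HasKernel (ρ t) (κ t) ∧
    HasKernel (lindbladian H C (ρ t)) (κ' t) ∧
    HasDerivWithinAt κ (κ' t) (Set.Ici 0) t

/-! ### Pure Gaussian states and their generation -/

/-- Gaussian graph matrices: `Z = X + iY` with `X`, `Y` real symmetric and `Y > 0`. -/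
def IsGraphMatrix {N : ℕ} (Z : Matrix (Fin N) (Fin N) ℂ) : Prop :=
  Z.IsSymm ∧ (Z.map Complex.im).PosDef

/-- The unnormalized wave function `exp((i/2) xᵀ Z x)` of the zero-mean pure Gaussian state with
graph matrix `Z`. -/
def gaussWave {N : ℕ} (Z : Matrix (Fin N) (Fin N) ℂ) (x : Config N) : ℂ :=
  Complex.exp ((Complex.I / 2) * ∑ j, ∑ k, ((x j : ℝ) : ℂ) * Z j k * ((x k : ℝ) : ℂ))

/-- `ρ` is the zero-mean pure Gaussian state with graph matrix `Z`, i.e. the projection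
`|ψ⟩⟨ψ| / ⟨ψ|ψ⟩` with `ψ = gaussWave Z`. -/
def IsPureGaussianState {N : ℕ} (Z : Matrix (Fin N) (Fin N) ℂ) (ρ : Op N) : Prop :=
  ∀ (φ : Wave N) (x : Config N),
    ρ φ x = ((∫ y, conj (gaussWave Z y) * φ y) / ((∫ y, ‖gaussWave Z y‖ ^ 2 : ℝ) : ℂ)) *
      gaussWave Z x

/-- The covariance matrix of the pure Gaussian state with graph matrix `Z = X + iY`,
`½ [Y⁻¹, Y⁻¹X; XY⁻¹, XY⁻¹X + Y]`. -/
def graphCov {N : ℕ} (Z : Matrix (Fin N) (Fin N) ℂ) : Matrix (Fin N ⊕ Fin N) (Fin N ⊕ Fin N) ℝ :=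
  let X : Matrix (Fin N) (Fin N) ℝ := Z.map Complex.re
  let Y : Matrix (Fin N) (Fin N) ℝ := Z.map Complex.im
  (1 / 2 : ℝ) • Matrix.fromBlocks Y⁻¹ (Y⁻¹ * X) (X * Y⁻¹) (X * Y⁻¹ * X + Y)

/-- The linear quantum system `(H, L = C x)` generates the pure Gaussian state with graph matrix
`Z`: the state is the unique steady state of the master equation, and the system is strictly stable,
so that mean and covariance of every solution converge to those of the state. -/
def Generates {N K : ℕ} (H : Op N) (C : Matrix (Fin K) (Fin N ⊕ Fin N) ℂ)
    (Z : Matrix (Fin N) (Fin N) ℂ) : Prop :=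
  (∃ ρ : Op N, IsPureGaussianState Z ρ ∧ IsSteadyState H C ρ ∧
    ∀ ρ' : Op N, IsSteadyState H C ρ' → ρ' = ρ) ∧
  ∀ ρ : ℝ → Op N, IsSolution H C ρ →
    (∀ a, Tendsto (fun t => mean (ρ t) a) atTop (𝓝 0)) ∧
    ∀ a b, Tendsto (fun t => cov (ρ t) a b) atTop (𝓝 ((graphCov Z a b : ℝ) : ℂ))

/-- The Hamiltonian is `∑_{j ≤ k} g_{jk} (q_j q_k + p_j p_k)` with real `g_{jk}`. -/
def IsPassiveHamiltonian {N : ℕ} (H : Op N) : Prop :=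
  ∃ g : Fin N → Fin N → ℝ,
    H = ∑ j, ∑ k ∈ Finset.Ici j,
      ((g j k : ℝ) : ℂ) • (posOp j * posOp k + momOp j * momOp k)

/-- A single Lindblad operator, of the form `c₁ q_ℓ + c₂ p_ℓ`. -/
def IsLocalCoupling {N : ℕ} (C : Matrix (Fin 1) (Fin N ⊕ Fin N) ℂ) : Prop :=
  ∃ (c₁ c₂ : ℂ) (l : Fin N), C = fun _ => Sum.elim (Pi.single l c₁) (Pi.single l c₂)

/-- The pure Gaussian state with graph matrix `Z` can be generated by a linear quantum system with
passive Hamiltonian and a single local reservoir. -/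
def CanBeGenerated {N : ℕ} (Z : Matrix (Fin N) (Fin N) ℂ) : Prop :=
  ∃ (H : Op N) (C : Matrix (Fin 1) (Fin N ⊕ Fin N) ℂ),
    IsPassiveHamiltonian H ∧ IsLocalCoupling C ∧ Generates H C Z

/-! ### The normal form -/

/-- The block matrix `[z, 0; 0, M]` with a `1 × 1` block `z`. -/
def bordered {n : ℕ} (z : ℂ) (M : Matrix (Fin n) (Fin n) ℂ) :
    Matrix (Fin (n + 1)) (Fin (n + 1)) ℂ :=
  Matrix.of (Fin.cons (Fin.cons z 0) (fun i => Fin.cons 0 (M i)))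

/-- `diag[B₁, …, B_m]` for `2 × 2` blocks, in this order along the diagonal. -/
def diagBlocks {m : ℕ} (B : Fin m → Matrix (Fin 2) (Fin 2) ℂ) :
    Matrix (Fin (m * 2)) (Fin (m * 2)) ℂ :=
  let e : Fin 2 × Fin m ≃ Fin (m * 2) := (Equiv.prodComm _ _).trans finProdFinEquiv
  Matrix.reindex e e (Matrix.blockDiagonal B)

/-- The `2 × 2` matrix with diagonal entries `(z² - 1)/(2z)` and off-diagonal entries
`(z² + 1)/(2z)`. -/
def blockPlus (z : ℂ) : Matrix (Fin 2) (Fin 2) ℂ :=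
  !![(z ^ 2 - 1) / (2 * z), (z ^ 2 + 1) / (2 * z);
     (z ^ 2 + 1) / (2 * z), (z ^ 2 - 1) / (2 * z)]

/-- The `2 × 2` matrix with diagonal entries `(z² - 1)/(2z)` and off-diagonal entries
`-(z² + 1)/(2z)`. -/
def blockMinus (z : ℂ) : Matrix (Fin 2) (Fin 2) ℂ :=
  !![(z ^ 2 - 1) / (2 * z), -((z ^ 2 + 1) / (2 * z));
     -((z ^ 2 + 1) / (2 * z)), (z ^ 2 - 1) / (2 * z)]

/-- `Pᵀ [z, 0; 0, Qᵀ M Q] P` with the permutation matrix `P` of `σ` and a real matrix `Q`. -/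
def assembled {n : ℕ} (σ : Equiv.Perm (Fin (n + 1))) (Q : Matrix (Fin n) (Fin n) ℝ) (z : ℂ)
    (M : Matrix (Fin n) (Fin n) ℂ) : Matrix (Fin (n + 1)) (Fin (n + 1)) ℂ :=
  let P : Matrix (Fin (n + 1)) (Fin (n + 1)) ℂ := σ.permMatrix ℂ
  let Qc : Matrix (Fin n) (Fin n) ℂ := Q.map Complex.ofReal
  P.transpose * bordered z (Qc.transpose * M * Qc) * P

end LinQuantum

end

/-!
Write `ψ = exp (i/2 xᵀ Z x)`. The operators `a(v) = ∑ⱼ vⱼ (pⱼ - (Z q)ⱼ)` (`ann Z v`) annihilate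
`ψ`, they determine it up to a factor (`eq_smul_gauss`), and every linear operator in the `q`s and
`p`s is a combination of the `a(v)` and their adjoints. A passive Hamiltonian is
`½ ∑ Rⱼₖ (qⱼ qₖ + pⱼ pₖ)` with a real symmetric matrix `R` (`isPassiveHamiltonian_iff`).

*Necessary conditions* (`Generates.necessary`). If `|ψ⟩⟨ψ|` is stationary, then `ψ` is an
eigenvector of the Lindblad operator `L` and of `H`. As `L` is linear, this means `L ψ = 0`, which
gives `Z e_l = z e_l` for the mode `l` the reservoir acts on, and `[H, a(v)] ψ = 0` gives
`R + Z R Z = 0`. Moreover no real eigenvector `w` of `R` is orthogonal to `e_l`: otherwise the mode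
`w` decouples from the reservoir, and conjugation by a ladder operator of this mode turns the steady
state into a second one.

*Normal form* (`CanBeGenerated.hasAlternatingForm`). The last condition makes `e_l` a cyclic vector
of `R`. From `Z R Z = -R` the eigenvalue of `Z` on `R^k e_l` alternates between `z` and `-1/z`, and
since `Z` is symmetric the Gram–Schmidt process keeps these vectors eigenvectors. So `Z` is
diagonal, with alternating eigenvalues, in a real orthonormal basis that starts with `e_l`. As the
blocks `B_±(z)` are diagonal, with eigenvalues `z` and `-1/z`, in the basis `(1, ±1)/√2`, the
matrices in the theorem are those with such an eigenbasis (`canBeGenerated_iff_exists_assembled`).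

*Sufficiency* (`HasAlternatingForm.canBeGenerated`, `Drives.canBeGenerated`). For such a `Z` let `R`
be the adjacency matrix of a path in the eigenbasis and `L = a(e_l)`. In the Heisenberg picture the
operators `a(v)` evolve by a linear system whose matrix is Hurwitz: `Im Z` is a Lyapunov function
for it, and an undamped eigenvector would have to vanish along the whole path. Hence the first
moments and the normally ordered second moments of every solution tend to zero, which is the
convergence of mean and covariance. Applied to a constant solution `ρ`, this gives
`a(v) ρ a(v)* = 0`, hence `a(v) ρ = 0`, and `ρ = |ψ⟩⟨ψ| / ⟨ψ|ψ⟩`.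
-/

open MeasureTheory Filter Topology
open scoped SchwartzMap ComplexConjugate LineDeriv Matrix

noncomputable section

namespace LinQuantum

variable {N : ℕ}

/-! ### The inner product on the core and the canonical commutation relations -/

theorem integrable_conj_mul (u v : Wave N) : Integrable (fun x => conj (u x) * v x) := by
  have h1 : MemLp (fun x => conj (u x)) 2 (volume : Measure (Config N)) := by
    simpa [Pi.star_def] using (u.memLp 2).star
  exact h1.integrable_mul (v.memLp 2)

/-- The inner product `∫ ū v` of `L²(ℝ^N)` on the core, conjugate-linear in the first argument. -/
def ip : Wave N →ₗ⋆[ℂ] Wave N →ₗ[ℂ] ℂ :=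
  LinearMap.mk₂'ₛₗ (starRingEnd ℂ) (RingHom.id ℂ) (fun u v => ∫ x, conj (u x) * v x)
    (fun u u' v => by
      rw [← integral_add (integrable_conj_mul u v) (integrable_conj_mul u' v)]
      simp [add_mul])
    (fun c u v => by
      rw [smul_eq_mul, ← integral_const_mul]
      simp [mul_assoc])
    (fun u v v' => by
      rw [← integral_add (integrable_conj_mul u v) (integrable_conj_mul u v')]
      simp [mul_add])
    (fun c u v => by
      rw [smul_eq_mul, ← integral_const_mul]
      congr 1; ext x; simp; ring)

theorem ip_apply (u v : Wave N) : ip u v = ∫ x, conj (u x) * v x := rfl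

theorem conj_ip (u v : Wave N) : conj (ip u v) = ip v u := by
  rw [ip_apply, ip_apply, ← integral_conj]
  congr 1; ext x; simp [mul_comm]

theorem ip_self (u : Wave N) : ip u u = ((∫ x, ‖u x‖ ^ 2 : ℝ) : ℂ) := by
  rw [ip_apply, ← integral_complex_ofReal]
  congr 1; ext x
  rw [Complex.conj_mul']; push_cast; rfl

theorem integrable_norm_sq (u : Wave N) : Integrable (fun x => ‖u x‖ ^ 2) :=
  (u.memLp 2).integrable_norm_pow (by norm_num)

theorem eq_zero_of_ip_self {u : Wave N} (h : ip u u = 0) : u = 0 := by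
  rw [ip_self, Complex.ofReal_eq_zero,
    integral_eq_zero_iff_of_nonneg (fun x => by positivity) (integrable_norm_sq u)] at h
  have hc : Continuous fun x => ‖u x‖ ^ 2 := by fun_prop
  have := (hc.ae_eq_iff_eq volume continuous_const).1 h
  ext x
  have hx : ‖u x‖ ^ 2 = 0 := congrFun this x
  simpa using hx

theorem ip_posOp (j : Fin N) (u v : Wave N) : ip u (posOp j v) = ip (posOp j u) v := by
  rw [ip_apply, ip_apply]
  congr 1; ext x
  simp only [posOp_apply, map_mul, Complex.conj_ofReal]; ring

/-- The pointwise complex conjugate of a Schwartz function. -/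
def conjWave (u : Wave N) : Wave N :=
  SchwartzMap.postcompCLM (𝕜 := ℝ) (Complex.conjCLE : ℂ →L[ℝ] ℂ) u

theorem conjWave_apply (u : Wave N) (x : Config N) : conjWave u x = conj (u x) := by
  simp [conjWave]

theorem lineDeriv_conjWave (u : Wave N) (x m : Config N) :
    lineDeriv ℝ (conjWave u) x m = conj (lineDeriv ℝ u x m) := by
  have h := (Complex.conjCLE : ℂ →L[ℝ] ℂ).hasFDerivAt.comp x (u.hasFDerivAt x)
  have h2 : (conjWave u : Config N → ℂ) = (Complex.conjCLE : ℂ →L[ℝ] ℂ) ∘ u := by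
    ext y; simp [conjWave_apply]
  rw [h2, (h.hasLineDerivAt m).lineDeriv, ((u.hasFDerivAt x).hasLineDerivAt m).lineDeriv]
  simp

theorem ip_momOp (j : Fin N) (u v : Wave N) : ip u (momOp j v) = ip (momOp j u) v := by
  have h := SchwartzMap.integral_mul_lineDerivOp_right_eq_neg_left (μ := volume)
    (conjWave u) v (EuclideanSpace.single j (1 : ℝ))
  simp only [SchwartzMap.lineDerivOp_apply, lineDeriv_conjWave, conjWave_apply] at h
  rw [ip_apply, ip_apply]
  simp only [momOp_apply, map_mul, map_neg, Complex.conj_I, neg_neg]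
  calc ∫ x, conj (u x) * (-Complex.I * lineDeriv ℝ v x (EuclideanSpace.single j (1 : ℝ)))
      = -Complex.I * ∫ x, conj (u x) * lineDeriv ℝ v x (EuclideanSpace.single j (1 : ℝ)) := by
        rw [← integral_const_mul]; congr 1; ext x; ring
    _ = Complex.I * ∫ x, conj (lineDeriv ℝ u x (EuclideanSpace.single j (1 : ℝ))) * v x := by
        rw [h]; ring
    _ = _ := by rw [← integral_const_mul]; congr 1; ext x; ring

theorem linOp_eq (c : Fin N ⊕ Fin N → ℂ) :
    linOp c = ∑ j, c (.inl j) • posOp j + ∑ j, c (.inr j) • momOp j := by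
  simp [linOp, Fintype.sum_sum_type, quadOp]

/-- On the core, the adjoint of `linOp c` is `linOp (star c)`. -/
theorem ip_linOp (c : Fin N ⊕ Fin N → ℂ) (u v : Wave N) :
    ip u (linOp c v) = ip (linOp (star c) u) v := by
  simp [linOp_eq, ip_posOp, ip_momOp]

theorem linOp_add (c d : Fin N ⊕ Fin N → ℂ) : linOp (c + d) = linOp c + linOp d := by
  simp [linOp, add_smul, Finset.sum_add_distrib]

theorem linOp_smul (k : ℂ) (c : Fin N ⊕ Fin N → ℂ) : linOp (k • c) = k • linOp c := by
  simp [linOp, mul_smul, Finset.smul_sum]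

theorem linOp_single (a : Fin N ⊕ Fin N) : linOp (Pi.single a 1) = quadOp a := by
  rw [linOp, Finset.sum_eq_single a]
  · simp
  · intro b _ hb; simp [hb]
  · simp

theorem commutator_posOp_posOp (j k : Fin N) :
    (posOp j * posOp k - posOp k * posOp j : Op N) = 0 := by
  ext φ x
  simp only [LinearMap.sub_apply, Module.End.mul_apply, sub_apply,
    posOp_apply, LinearMap.zero_apply, zero_apply]
  ring

theorem commutator_momOp_momOp (j k : Fin N) :
    (momOp j * momOp k - momOp k * momOp j : Op N) = 0 := by
  have key : ∀ (φ : Wave N) (m n : Config N),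
      LineDeriv.lineDerivOp m (LineDeriv.lineDerivOp n φ)
        = LineDeriv.lineDerivOp n (LineDeriv.lineDerivOp m φ) := by
    intro φ m n
    have h2 : ∀ (m n x : Config N), (LineDeriv.lineDerivOp m (LineDeriv.lineDerivOp n φ)) x
        = fderiv ℝ (fderiv ℝ φ) x m n := by
      intro m n x
      rw [SchwartzMap.lineDerivOp_apply_eq_fderiv]
      have : (LineDeriv.lineDerivOp n φ : Wave N) = fun y => fderiv ℝ φ y n := by
        ext y; rw [SchwartzMap.lineDerivOp_apply_eq_fderiv]
      rw [this]
      have hd : DifferentiableAt ℝ (fderiv ℝ φ) x :=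
        ((φ.smooth 2).fderiv_right (m := 1) (by norm_num)).differentiable (by norm_num) x
      rw [fderiv_clm_apply hd (differentiableAt_const _)]
      simp
    ext x
    rw [h2, h2]
    exact ((φ.smooth 2).contDiffAt (x := x)).isSymmSndFDerivAt (by simp) m n
  ext φ x
  simp [momOp, key φ (EuclideanSpace.single j (1 : ℝ))]

theorem commutator_posOp_momOp (j k : Fin N) :
    (posOp j * momOp k - momOp k * posOp j : Op N) = if j = k then Complex.I • 1 else 0 := by
  ext φ x
  have hd : HasLineDerivAt ℝ (posOp j φ) (((x j : ℝ) : ℂ) *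
      lineDeriv ℝ φ x (EuclideanSpace.single k (1 : ℝ))
      + (if j = k then 1 else 0) * φ x) x (EuclideanSpace.single k (1 : ℝ)) := by
    have h1 : (posOp j φ : Config N → ℂ) = fun y =>
        (Complex.ofRealCLM.comp (EuclideanSpace.proj j : Config N →L[ℝ] ℝ)) y * φ y := by
      ext y; simp [posOp_apply]
    rw [h1]
    have h2 := ((Complex.ofRealCLM.comp
      (EuclideanSpace.proj j : Config N →L[ℝ] ℝ)).hasFDerivAt (x := x)).mul (φ.hasFDerivAt x)
    have h3 := h2.hasLineDerivAt (EuclideanSpace.single k (1 : ℝ))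
    rw [((φ.hasFDerivAt x).hasLineDerivAt (EuclideanSpace.single k (1 : ℝ))).lineDeriv]
    refine h3.congr_deriv ?_
    split_ifs with hjk
    · simp [hjk, mul_comm]
    · simp [hjk, mul_comm]
  simp only [LinearMap.sub_apply, Module.End.mul_apply, sub_apply,
    posOp_apply, momOp_apply, hd.lineDeriv]
  split_ifs
  · simp; ring
  · simp; ring

/-- The symplectic form on coefficient vectors. -/
def symp (u v : Fin N ⊕ Fin N → ℂ) : ℂ :=
  ∑ j, (u (.inl j) * v (.inr j) - u (.inr j) * v (.inl j))

theorem commutator_linOp_right (A : Op N) (v : Fin N ⊕ Fin N → ℂ) :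
    A * linOp v - linOp v * A = ∑ b, v b • (A * quadOp b - quadOp b * A) := by
  simp only [linOp, Finset.mul_sum, Finset.sum_mul, smul_sub, Finset.sum_sub_distrib,
    mul_smul_comm, smul_mul_assoc]

theorem commutator_linOp_left (A : Op N) (v : Fin N ⊕ Fin N → ℂ) :
    linOp v * A - A * linOp v = ∑ b, v b • (quadOp b * A - A * quadOp b) := by
  simp only [linOp, Finset.mul_sum, Finset.sum_mul, smul_sub, Finset.sum_sub_distrib,
    mul_smul_comm, smul_mul_assoc]

/-- The canonical commutation relations in symplectic form. -/
theorem commutator_linOp (u v : Fin N ⊕ Fin N → ℂ) :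
    linOp u * linOp v - linOp v * linOp u = (Complex.I * symp u v) • (1 : Op N) := by
  have hmp : ∀ j k, (momOp j * posOp k - posOp k * momOp j : Op N)
      = if k = j then -(Complex.I • 1) else 0 := by
    intro j k
    rw [← neg_sub, commutator_posOp_momOp]; split_ifs <;> simp
  simp only [commutator_linOp_left, commutator_linOp_right, Fintype.sum_sum_type, quadOp,
    Sum.elim_inl, Sum.elim_inr, commutator_posOp_posOp, hmp,
    commutator_momOp_momOp, commutator_posOp_momOp, symp, smul_zero, Finset.sum_const_zero,
    zero_add, add_zero, smul_ite, Finset.sum_ite_eq, Finset.sum_ite_eq', Finset.mem_univ, if_true]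
  rw [Finset.mul_sum, Finset.sum_smul, ← Finset.sum_add_distrib]
  refine Finset.sum_congr rfl fun j _ => ?_
  simp only [smul_smul, ← neg_smul, ← add_smul]
  congr 1; ring

/-! ### Operators acting on Schwartz kernels, and the trace -/

/-- The slice `K(x, ·)` of a kernel. -/
def kernelSlice (K : Kernel N) (x : Config N) : Wave N :=
  SchwartzMap.compCLMOfAntilipschitz ℂ (K := 1) (g := fun y : Config N => (x, y))
    (by
      have h := (Function.HasTemperateGrowth.const ((x, 0) : Config N × Config N)
        (E := Config N)).add (ContinuousLinearMap.inr ℝ (Config N) (Config N)).hasTemperateGrowth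
      have e : (fun y : Config N => (x, y)) = (fun _ : Config N => ((x, 0) : Config N × Config N))
          + (ContinuousLinearMap.inr ℝ (Config N) (Config N)) := by
        ext y <;> simp
      rw [e]; exact h)
    (AntilipschitzWith.of_le_mul_dist fun y z => by simp [Prod.dist_eq]) K

@[simp] theorem kernelSlice_apply (K : Kernel N) (x y : Config N) :
    kernelSlice K x y = K (x, y) := rfl

theorem lineDeriv_kernelSlice (K : Kernel N) (x y m : Config N) :
    lineDeriv ℝ (kernelSlice K x) y m = lineDeriv ℝ K (x, y) (0, m) := by
  simp [lineDeriv]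

theorem integrable_kernel_mul (K : Kernel N) (φ : Wave N) (x : Config N) :
    Integrable fun y => K (x, y) * φ y :=
  ((kernelSlice K x).memLp 2).integrable_mul (φ.memLp 2)

/-- The restriction of a kernel to the diagonal. -/
def kernelDiag : Kernel N →L[ℂ] Wave N :=
  SchwartzMap.compCLMOfAntilipschitz ℂ (K := 1) (g := fun y : Config N => (y, y))
    ((ContinuousLinearMap.id ℝ (Config N)).prod (.id ℝ (Config N))).hasTemperateGrowth
    (AntilipschitzWith.of_le_mul_dist fun y z => by simp [Prod.dist_eq])

@[simp] theorem kernelDiag_apply (K : Kernel N) (x : Config N) : kernelDiag K x = K (x, x) := rfl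

/-- The trace, as a continuous functional of the kernel. -/
def kernelTrace : Kernel N →L[ℂ] ℂ :=
  (SchwartzMap.integralCLM ℂ (volume : Measure (Config N))).comp kernelDiag

theorem HasKernel.opTrace_eq_kernelTrace {A : Op N} {K : Kernel N} (h : HasKernel A K) :
    opTrace A = kernelTrace K := by
  rw [h.opTrace_eq]; rfl

theorem hasTemperateGrowth_fst_coord (j : Fin N) :
    Function.HasTemperateGrowth fun p : Config N × Config N => ((p.1 j : ℝ) : ℂ) :=
  (Complex.ofRealCLM.comp ((EuclideanSpace.proj j : Config N →L[ℝ] ℝ).comp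
    (ContinuousLinearMap.fst ℝ (Config N) (Config N)))).hasTemperateGrowth

theorem hasTemperateGrowth_snd_coord (j : Fin N) :
    Function.HasTemperateGrowth fun p : Config N × Config N => ((p.2 j : ℝ) : ℂ) :=
  (Complex.ofRealCLM.comp ((EuclideanSpace.proj j : Config N →L[ℝ] ℝ).comp
    (ContinuousLinearMap.snd ℝ (Config N) (Config N)))).hasTemperateGrowth

theorem HasKernel.add {A B : Op N} {K L : Kernel N} (hA : HasKernel A K) (hB : HasKernel B L) :
    HasKernel (A + B) (K + L) := by
  intro φ x
  rw [LinearMap.add_apply, add_apply, hA φ x, hB φ x,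
    ← integral_add (integrable_kernel_mul K φ x) (integrable_kernel_mul L φ x)]
  simp [add_mul]

theorem HasKernel.smul {A : Op N} {K : Kernel N} (hA : HasKernel A K) (c : ℂ) :
    HasKernel (c • A) (c • K) := by
  intro φ x
  rw [LinearMap.smul_apply, smul_apply, hA φ x, smul_eq_mul, ← integral_const_mul]
  simp [mul_assoc]

theorem HasKernel.zero : HasKernel (0 : Op N) 0 := by
  intro φ x; simp

theorem HasKernel.posOp_mul {A : Op N} {K : Kernel N} (hA : HasKernel A K) (j : Fin N) :
    HasKernel (posOp j * A)
      (SchwartzMap.smulLeftCLM ℂ (fun p : Config N × Config N => ((p.1 j : ℝ) : ℂ)) K) := by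
  intro φ x
  rw [Module.End.mul_apply, posOp_apply, hA φ x, ← integral_const_mul]
  simp [SchwartzMap.smulLeftCLM_apply_apply (hasTemperateGrowth_fst_coord j), mul_assoc]

theorem HasKernel.mul_posOp {A : Op N} {K : Kernel N} (hA : HasKernel A K) (j : Fin N) :
    HasKernel (A * posOp j)
      (SchwartzMap.smulLeftCLM ℂ (fun p : Config N × Config N => ((p.2 j : ℝ) : ℂ)) K) := by
  intro φ x
  rw [Module.End.mul_apply, hA]
  congr 1; ext y
  simp [SchwartzMap.smulLeftCLM_apply_apply (hasTemperateGrowth_snd_coord j), posOp_apply]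
  ring

/-- Differentiation under the integral sign; the bound comes from the supremum of `∂K`. -/
theorem HasKernel.momOp_mul {A : Op N} {K : Kernel N} (hA : HasKernel A K) (j : Fin N) :
    HasKernel (momOp j * A)
      (((-Complex.I) • LineDeriv.lineDerivOpCLM ℂ (Kernel N)
        ((EuclideanSpace.single j (1 : ℝ), 0) : Config N × Config N)) K) := by
  intro φ x
  set e : Config N := EuclideanSpace.single j (1 : ℝ) with he
  set K' : Kernel N := LineDeriv.lineDerivOp ((e, 0) : Config N × Config N) K with hK'
  have hd : HasLineDerivAt ℝ (A φ) (∫ y, K' (x, y) * φ y) x e := by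
    have hfun : ∀ t : ℝ, A φ (x + t • e) = ∫ y, K (x + t • e, y) * φ y := fun t => hA φ _
    have := (hasDerivAt_integral_of_dominated_loc_of_deriv_le (μ := volume) (𝕜 := ℝ)
      (F := fun (t : ℝ) (y : Config N) => K (x + t • e, y) * φ y)
      (F' := fun (t : ℝ) (y : Config N) => K' (x + t • e, y) * φ y)
      (bound := fun y => SchwartzMap.seminorm ℝ 0 0 K' * ‖φ y‖) (x₀ := 0) (s := Set.univ)
      univ_mem
      (Eventually.of_forall fun t => (integrable_kernel_mul K φ _).aestronglyMeasurable)
      (integrable_kernel_mul K φ _) (integrable_kernel_mul K' φ _).aestronglyMeasurable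
      (Eventually.of_forall fun y t _ => by
        rw [norm_mul]
        gcongr
        exact SchwartzMap.norm_le_seminorm ℝ K' _)
      (φ.integrable.norm.const_mul _)
      (Eventually.of_forall fun y t _ => by
        have hc : HasDerivAt (fun t : ℝ => ((x + t • e, y) : Config N × Config N)) (e, 0) t := by
          refine HasDerivAt.prodMk ?_ (hasDerivAt_const _ _)
          simpa using ((hasDerivAt_id t).smul_const e).const_add x
        have := ((K.hasFDerivAt (x + t • e, y)).comp_hasDerivAt t hc).mul_const (φ y)
        rw [hK', SchwartzMap.lineDerivOp_apply_eq_fderiv]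
        exact this)).2
    simp only [zero_smul, add_zero] at this
    rw [HasLineDerivAt]
    simpa only [hfun] using this
  rw [Module.End.mul_apply, momOp_apply, hd.lineDeriv, ← integral_const_mul]
  simp [hK', mul_assoc]

theorem HasKernel.mul_momOp {A : Op N} {K : Kernel N} (hA : HasKernel A K) (j : Fin N) :
    HasKernel (A * momOp j)
      ((Complex.I • LineDeriv.lineDerivOpCLM ℂ (Kernel N)
        ((0, EuclideanSpace.single j (1 : ℝ)) : Config N × Config N)) K) := by
  intro φ x
  have h := SchwartzMap.integral_mul_lineDerivOp_right_eq_neg_left (μ := volume)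
    (kernelSlice K x) φ (EuclideanSpace.single j (1 : ℝ))
  simp only [SchwartzMap.lineDerivOp_apply, lineDeriv_kernelSlice, kernelSlice_apply] at h
  rw [Module.End.mul_apply, hA]
  calc ∫ y, K (x, y) * momOp j φ y
      = -Complex.I * ∫ y, K (x, y) * lineDeriv ℝ φ y (EuclideanSpace.single j (1 : ℝ)) := by
        rw [← integral_const_mul]; congr 1; ext y; rw [momOp_apply]; ring
    _ = Complex.I * ∫ y, lineDeriv ℝ K (x, y) (0, EuclideanSpace.single j (1 : ℝ)) * φ y := by
        rw [h]; ring
    _ = _ := by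
        rw [← integral_const_mul]; congr 1; ext y
        simp [SchwartzMap.lineDerivOp_apply]; ring

theorem integral_lineDeriv_eq_zero (f : Wave N) (v : Config N) :
    ∫ x, lineDeriv ℝ f x v = 0 := by
  have hi : Integrable fun x => (LineDeriv.lineDerivOp v f : Wave N) x :=
    (LineDeriv.lineDerivOp v f : Wave N).integrable
  simp only [SchwartzMap.lineDerivOp_apply] at hi
  have := integral_bilinear_hasLineDerivAt_right_eq_neg_left_of_integrable (μ := volume) (v := v)
    (f := fun _ : Config N => (1 : ℂ)) (f' := fun _ => 0) (g := f)
    (g' := fun x => lineDeriv ℝ f x v) (B := ContinuousLinearMap.mul ℝ ℂ)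
    (by simp) (by simpa using hi) (by simpa using f.integrable)
    (fun x _ => by simpa [HasLineDerivAt] using hasDerivAt_const (0 : ℝ) (1 : ℂ))
    (fun x _ => ((f.hasFDerivAt x).differentiableAt.lineDifferentiableAt).hasLineDerivAt)
  simpa using this

/-- `X` is an observable if multiplication by `X` on either side preserves the operators with
Schwartz kernel, acts continuously on the kernels, and is cyclic under the trace. -/
def IsObservable (X : Op N) : Prop :=
  (∃ Ψ : Kernel N →L[ℂ] Kernel N, ∀ A K, HasKernel A K → HasKernel (X * A) (Ψ K)) ∧
  (∃ Ψ : Kernel N →L[ℂ] Kernel N, ∀ A K, HasKernel A K → HasKernel (A * X) (Ψ K)) ∧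
  ∀ A K, HasKernel A K → opTrace (X * A) = opTrace (A * X)

theorem isObservable_posOp (j : Fin N) : IsObservable (posOp j : Op N) := by
  refine ⟨⟨_, fun A K h => h.posOp_mul j⟩, ⟨_, fun A K h => h.mul_posOp j⟩, fun A K h => ?_⟩
  rw [(h.posOp_mul j).opTrace_eq, (h.mul_posOp j).opTrace_eq]
  simp [SchwartzMap.smulLeftCLM_apply_apply (hasTemperateGrowth_snd_coord j),
    SchwartzMap.smulLeftCLM_apply_apply (hasTemperateGrowth_fst_coord j)]

theorem isObservable_momOp (j : Fin N) : IsObservable (momOp j : Op N) := by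
  refine ⟨⟨_, fun A K h => h.momOp_mul j⟩, ⟨_, fun A K h => h.mul_momOp j⟩, fun A K h => ?_⟩
  rw [(h.momOp_mul j).opTrace_eq_kernelTrace, (h.mul_momOp j).opTrace_eq_kernelTrace,
    ← sub_eq_zero, ← map_sub]
  set e : Config N := EuclideanSpace.single j (1 : ℝ) with he
  have h0 := integral_lineDeriv_eq_zero (kernelDiag K) e
  have h1 : ∀ x, lineDeriv ℝ (kernelDiag K) x e = lineDeriv ℝ K (x, x) (e, e) := by
    intro x; simp [lineDeriv]
  have h2 : ∀ x : Config N, lineDeriv ℝ K (x, x) (e, e)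
      = lineDeriv ℝ K (x, x) (e, 0) + lineDeriv ℝ K (x, x) (0, e) := by
    intro x
    have hK := (K.hasFDerivAt (x, x))
    rw [(hK.hasLineDerivAt _).lineDeriv, (hK.hasLineDerivAt _).lineDeriv,
      (hK.hasLineDerivAt _).lineDeriv, ← map_add]
    simp
  simp only [h1, h2] at h0
  calc _ = ∫ x, -Complex.I * (lineDeriv ℝ K (x, x) (e, 0) + lineDeriv ℝ K (x, x) (0, e)) := by
        change ∫ x, _ = _
        congr 1; ext x
        simp [SchwartzMap.lineDerivOp_apply]; ring
    _ = 0 := by rw [integral_const_mul, h0, mul_zero]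

/-- The algebra of observables; it contains the polynomials in position and momentum. -/
def observables (N : ℕ) : Subalgebra ℂ (Op N) where
  carrier := {X | IsObservable X}
  mul_mem' := by
    rintro X Y ⟨⟨Ψ₁, h1⟩, ⟨Ψ₂, h2⟩, h3⟩ ⟨⟨Φ₁, g1⟩, ⟨Φ₂, g2⟩, g3⟩
    refine ⟨⟨Ψ₁.comp Φ₁, fun A K h => ?_⟩, ⟨Φ₂.comp Ψ₂, fun A K h => ?_⟩, fun A K h => ?_⟩
    · rw [mul_assoc]; exact h1 _ _ (g1 _ _ h)
    · rw [← mul_assoc]; exact g2 _ _ (h2 _ _ h)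
    · rw [mul_assoc, h3 _ _ (g1 _ _ h), mul_assoc, g3 _ _ (h2 _ _ h), mul_assoc]
  add_mem' := by
    rintro X Y ⟨⟨Ψ₁, h1⟩, ⟨Ψ₂, h2⟩, h3⟩ ⟨⟨Φ₁, g1⟩, ⟨Φ₂, g2⟩, g3⟩
    refine ⟨⟨Ψ₁ + Φ₁, fun A K h => ?_⟩, ⟨Ψ₂ + Φ₂, fun A K h => ?_⟩, fun A K h => ?_⟩
    · rw [add_mul]; exact (h1 _ _ h).add (g1 _ _ h)
    · rw [mul_add]; exact (h2 _ _ h).add (g2 _ _ h)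
    · have e1 := h3 _ _ h
      have e2 := g3 _ _ h
      rw [(h1 _ _ h).opTrace_eq_kernelTrace, (h2 _ _ h).opTrace_eq_kernelTrace] at e1
      rw [(g1 _ _ h).opTrace_eq_kernelTrace, (g2 _ _ h).opTrace_eq_kernelTrace] at e2
      rw [add_mul, mul_add, ((h1 _ _ h).add (g1 _ _ h)).opTrace_eq_kernelTrace,
        ((h2 _ _ h).add (g2 _ _ h)).opTrace_eq_kernelTrace, map_add, map_add, e1, e2]
  algebraMap_mem' := by
    intro c
    have e1 : ∀ A : Op N, algebraMap ℂ (Op N) c * A = c • A := fun A => by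
      rw [Algebra.smul_def]
    have e2 : ∀ A : Op N, A * algebraMap ℂ (Op N) c = c • A := fun A => by
      rw [← Algebra.commutes, Algebra.smul_def]
    refine ⟨⟨c • ContinuousLinearMap.id ℂ _, fun A K h => ?_⟩,
      ⟨c • ContinuousLinearMap.id ℂ _, fun A K h => ?_⟩, fun A K h => by rw [e1, e2]⟩
    · rw [e1]; exact h.smul c
    · rw [e2]; exact h.smul c

theorem posOp_mem (j : Fin N) : (posOp j : Op N) ∈ observables N := isObservable_posOp j

theorem momOp_mem (j : Fin N) : (momOp j : Op N) ∈ observables N := isObservable_momOp j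

theorem quadOp_mem (a : Fin N ⊕ Fin N) : (quadOp a : Op N) ∈ observables N := by
  cases a
  · exact posOp_mem _
  · exact momOp_mem _

theorem linOp_mem (c : Fin N ⊕ Fin N → ℂ) : linOp c ∈ observables N :=
  sum_mem fun a _ => Subalgebra.smul_mem _ (quadOp_mem a) _

/-- The operators with Schwartz kernel. -/
def kernelOps (N : ℕ) : Submodule ℂ (Op N) where
  carrier := {A | ∃ K, HasKernel A K}
  add_mem' := by rintro A B ⟨K, hK⟩ ⟨L, hL⟩; exact ⟨_, hK.add hL⟩
  zero_mem' := ⟨0, HasKernel.zero⟩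
  smul_mem' := by rintro c A ⟨K, hK⟩; exact ⟨_, hK.smul c⟩

theorem mul_mem_kernelOps {X A : Op N} (hX : X ∈ observables N) (hA : A ∈ kernelOps N) :
    X * A ∈ kernelOps N := by
  obtain ⟨⟨Ψ, h⟩, -⟩ := hX
  obtain ⟨K, hK⟩ := hA
  exact ⟨_, h _ _ hK⟩

theorem mem_kernelOps_mul {X A : Op N} (hX : X ∈ observables N) (hA : A ∈ kernelOps N) :
    A * X ∈ kernelOps N := by
  obtain ⟨-, ⟨Ψ, h⟩, -⟩ := hX
  obtain ⟨K, hK⟩ := hA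
  exact ⟨_, h _ _ hK⟩

theorem opTrace_mul_comm {X A : Op N} (hX : X ∈ observables N) (hA : A ∈ kernelOps N) :
    opTrace (X * A) = opTrace (A * X) := by
  obtain ⟨K, hK⟩ := hA
  exact hX.2.2 _ _ hK

theorem opTrace_add {A B : Op N} (hA : A ∈ kernelOps N) (hB : B ∈ kernelOps N) :
    opTrace (A + B) = opTrace A + opTrace B := by
  obtain ⟨K, hK⟩ := hA
  obtain ⟨L, hL⟩ := hB
  rw [hK.opTrace_eq_kernelTrace, hL.opTrace_eq_kernelTrace,
    (hK.add hL).opTrace_eq_kernelTrace, map_add]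

theorem opTrace_smul {A : Op N} (hA : A ∈ kernelOps N) (c : ℂ) :
    opTrace (c • A) = c * opTrace A := by
  obtain ⟨K, hK⟩ := hA
  rw [hK.opTrace_eq_kernelTrace, (hK.smul c).opTrace_eq_kernelTrace, map_smul, smul_eq_mul]

/-- For an operator `ρ` with Schwartz kernel, the expectation `X ↦ tr(X ρ)` as a linear functional
of the observable. -/
def expect {ρ : Op N} (hρ : ρ ∈ kernelOps N) : observables N →ₗ[ℂ] ℂ where
  toFun X := opTrace (X.1 * ρ)
  map_add' X Y := by
    simp only [Subalgebra.coe_add, add_mul]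
    exact opTrace_add (mul_mem_kernelOps X.2 hρ) (mul_mem_kernelOps Y.2 hρ)
  map_smul' c X := by
    simp only [Subalgebra.coe_smul, smul_mul_assoc]
    exact opTrace_smul (mul_mem_kernelOps X.2 hρ) c

/-! ### Gaussian Schwartz functions -/

theorem norm_iteratedFDeriv_cexp (i : ℕ) (w : ℂ) :
    ‖iteratedFDeriv ℝ i Complex.exp w‖ = ‖Complex.exp w‖ := by
  have h := (Complex.contDiff_exp (𝕜 := ℂ) (n := i)).contDiffAt (x := w)
  rw [← (h.restrictScalars_iteratedFDeriv (𝕜 := ℝ)), Function.comp_apply,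
    ContinuousMultilinearMap.norm_restrictScalars, norm_iteratedFDeriv_eq_norm_iteratedDeriv,
    iteratedDeriv_eq_iterate, Complex.iter_deriv_exp]

/-- Gaussian decay beats polynomial growth, with explicit constants. -/
theorem one_add_pow_mul_exp_le {c : ℝ} (hc : 0 < c) (m : ℕ) {r : ℝ} (hr : 0 ≤ r) :
    (1 + r) ^ m * Real.exp (-(c * r ^ 2)) ≤ m.factorial * Real.exp (1 + 1 / (4 * c)) := by
  have h1 : (1 + r) ^ m ≤ m.factorial * Real.exp (1 + r) := by
    have := Real.pow_div_factorial_le_exp (1 + r) (by positivity) m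
    rwa [div_le_iff₀ (by positivity), mul_comm] at this
  have h2 : 1 + r - c * r ^ 2 ≤ 1 + 1 / (4 * c) := by
    have : r - c * r ^ 2 = 1 / (4 * c) - c * (r - 1 / (2 * c)) ^ 2 := by field_simp; ring
    have h3 : 0 ≤ c * (r - 1 / (2 * c)) ^ 2 := by positivity
    linarith
  calc (1 + r) ^ m * Real.exp (-(c * r ^ 2))
      ≤ m.factorial * Real.exp (1 + r) * Real.exp (-(c * r ^ 2)) := by gcongr
    _ = m.factorial * Real.exp (1 + r - c * r ^ 2) := by
        rw [mul_assoc, ← Real.exp_add, sub_eq_add_neg]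
    _ ≤ _ := by gcongr

/-- The exponential of a function of temperate growth whose real part is at most `-c ‖x‖²` is a
Schwartz function. -/
def expSchwartz {E : Type*} [NormedAddCommGroup E] [NormedSpace ℝ E] (q : E → ℂ)
    (hq : q.HasTemperateGrowth) (hre : ∃ c : ℝ, 0 < c ∧ ∀ x, (q x).re ≤ -(c * ‖x‖ ^ 2)) :
    𝓢(E, ℂ) where
  toFun x := Complex.exp (q x)
  smooth' := hq.1.cexp
  decay' := by
    intro k n
    obtain ⟨c, hc, hre⟩ := hre
    obtain ⟨l, C, hC, hgrowth⟩ := hq.norm_iteratedFDeriv_le_uniform n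
    refine ⟨n.factorial * (C + 1) ^ n *
      ((k + l * n).factorial * Real.exp (1 + 1 / (4 * c))), fun x => ?_⟩
    have h1 : ∀ i, 1 ≤ i → i ≤ n →
        ‖iteratedFDeriv ℝ i q x‖ ≤ ((C + 1) * (1 + ‖x‖) ^ l) ^ i := by
      intro i hi hin
      refine (hgrowth i hin x).trans (le_trans ?_ (le_self_pow₀ ?_ (by omega)))
      · gcongr; linarith
      · exact one_le_mul_of_one_le_of_one_le (by linarith)
          (one_le_pow₀ (by linarith [norm_nonneg x]))
    have h2 := norm_iteratedFDeriv_comp_le (𝕜 := ℝ) (n := n) (N := (⊤ : ℕ∞))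
      (Complex.contDiff_exp (𝕜 := ℝ)) hq.1 (mod_cast le_top) x
      (C := ‖Complex.exp (q x)‖) (fun i _ => (norm_iteratedFDeriv_cexp i _).le) h1
    have h3 : ‖Complex.exp (q x)‖ ≤ Real.exp (-(c * ‖x‖ ^ 2)) := by
      rw [Complex.norm_exp]; exact Real.exp_le_exp.2 (hre x)
    calc ‖x‖ ^ k * ‖iteratedFDeriv ℝ n (Complex.exp ∘ q) x‖
        ≤ (1 + ‖x‖) ^ k * (n.factorial * Real.exp (-(c * ‖x‖ ^ 2)) *
            ((C + 1) * (1 + ‖x‖) ^ l) ^ n) := by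
          refine mul_le_mul ?_ (h2.trans ?_) (norm_nonneg _) (by positivity)
          · gcongr; linarith
          · gcongr
      _ = n.factorial * (C + 1) ^ n *
            ((1 + ‖x‖) ^ (k + l * n) * Real.exp (-(c * ‖x‖ ^ 2))) := by
          rw [mul_pow, pow_add, pow_mul]; ring
      _ ≤ _ := by
          exact mul_le_mul_of_nonneg_left (one_add_pow_mul_exp_le hc _ (norm_nonneg x))
            (by positivity)

/-- A positive definite form is bounded below by a multiple of `‖x‖²`: its minimum on the unit
sphere, which is empty if there are no modes. -/
theorem exists_coercive {Y : Matrix (Fin N) (Fin N) ℝ} (hY : Y.PosDef) :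
    ∃ c : ℝ, 0 < c ∧ ∀ x : Config N, c * ‖x‖ ^ 2 ≤ ∑ j, ∑ k, x j * Y j k * x k := by
  set f : Config N → ℝ := fun x => ∑ j, ∑ k, x j * Y j k * x k with hf
  have hcont : Continuous f := by fun_prop
  have hpos : ∀ x : Config N, x ≠ 0 → 0 < f x := by
    intro x hx
    have hx' : WithLp.ofLp x ≠ 0 := fun h => hx (by ext i; exact congrFun h i)
    have := hY.dotProduct_mulVec_pos hx'
    simpa [hf, dotProduct, Matrix.mulVec, Finset.mul_sum, mul_assoc] using this
  have hhom : ∀ (t : ℝ) (x : Config N), f (t • x) = t ^ 2 * f x := by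
    intro t x
    simp only [hf, Finset.mul_sum, PiLp.smul_apply, smul_eq_mul]
    exact Finset.sum_congr rfl fun j _ => Finset.sum_congr rfl fun k _ => by ring
  rcases (Metric.sphere (0 : Config N) 1).eq_empty_or_nonempty with he | hne
  · refine ⟨1, one_pos, fun x => ?_⟩
    have hx : x = 0 := by
      by_contra hx
      have : ‖x‖⁻¹ • x ∈ Metric.sphere (0 : Config N) 1 := by
        simp [norm_smul, hx]
      simp [he] at this
    simp [hx]
  · obtain ⟨x₀, hx₀, hmin⟩ := (isCompact_sphere (0 : Config N) 1).exists_isMinOn hne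
      hcont.continuousOn
    have hx₀' : x₀ ≠ 0 := by rintro rfl; simp at hx₀
    refine ⟨f x₀, hpos x₀ hx₀', fun x => ?_⟩
    by_cases hx : x = 0
    · simp [hx]
    · have hm : ‖x‖⁻¹ • x ∈ Metric.sphere (0 : Config N) 1 := by simp [norm_smul, hx]
      have h1 : f x₀ ≤ f (‖x‖⁻¹ • x) := hmin hm
      rw [hhom] at h1
      have h2 : 0 < ‖x‖ ^ 2 := by positivity
      calc f x₀ * ‖x‖ ^ 2 ≤ ((‖x‖⁻¹) ^ 2 * f x) * ‖x‖ ^ 2 := by gcongr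
        _ = f x := by field_simp

/-- The exponent `(i/2) xᵀ Z x` of `gaussWave`. -/
def gaussExponent (Z : Matrix (Fin N) (Fin N) ℂ) (x : Config N) : ℂ :=
  (Complex.I / 2) * ∑ j, ∑ k, ((x j : ℝ) : ℂ) * Z j k * ((x k : ℝ) : ℂ)

theorem gaussWave_eq (Z : Matrix (Fin N) (Fin N) ℂ) (x : Config N) :
    gaussWave Z x = Complex.exp (gaussExponent Z x) := rfl

theorem hasTemperateGrowth_coord (j : Fin N) :
    Function.HasTemperateGrowth (fun x : Config N => ((x j : ℝ) : ℂ)) :=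
  (Complex.ofRealCLM.comp
    (EuclideanSpace.proj j : Config N →L[ℝ] ℝ)).hasTemperateGrowth

theorem hasTemperateGrowth_gaussExponent (Z : Matrix (Fin N) (Fin N) ℂ) :
    (gaussExponent Z).HasTemperateGrowth := by
  refine (Function.HasTemperateGrowth.const (Complex.I / 2)).mul ?_
  exact .sum fun j _ => .sum fun k _ =>
    ((hasTemperateGrowth_coord j).mul (.const _)).mul (hasTemperateGrowth_coord k)

theorem re_gaussExponent (Z : Matrix (Fin N) (Fin N) ℂ) (x : Config N) :
    (gaussExponent Z x).re = -(1 / 2) * ∑ j, ∑ k, x j * (Z.map Complex.im) j k * x k := by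
  have h : (∑ j, ∑ k, ((x j : ℝ) : ℂ) * Z j k * ((x k : ℝ) : ℂ)).im
      = ∑ j, ∑ k, x j * (Z.map Complex.im) j k * x k := by
    rw [Complex.im_sum]
    refine Finset.sum_congr rfl fun j _ => ?_
    rw [Complex.im_sum]
    refine Finset.sum_congr rfl fun k _ => ?_
    simp
  rw [gaussExponent, ← h]
  simp [Complex.mul_re]

theorem exists_re_gaussExponent_le {Z : Matrix (Fin N) (Fin N) ℂ} (hZ : IsGraphMatrix Z) :
    ∃ c : ℝ, 0 < c ∧ ∀ x, (gaussExponent Z x).re ≤ -(c * ‖x‖ ^ 2) := by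
  obtain ⟨c, hc, h⟩ := exists_coercive hZ.2
  refine ⟨c / 2, by positivity, fun x => ?_⟩
  rw [re_gaussExponent]
  linarith [h x]

/-- The Gaussian wave function as an element of the Schwartz space. -/
def gauss {Z : Matrix (Fin N) (Fin N) ℂ} (hZ : IsGraphMatrix Z) : Wave N :=
  expSchwartz (gaussExponent Z) (hasTemperateGrowth_gaussExponent Z) (exists_re_gaussExponent_le hZ)

theorem gauss_apply {Z : Matrix (Fin N) (Fin N) ℂ} (hZ : IsGraphMatrix Z) (x : Config N) :
    gauss hZ x = gaussWave Z x := rfl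

theorem gauss_zero {Z : Matrix (Fin N) (Fin N) ℂ} (hZ : IsGraphMatrix Z) : gauss hZ 0 = 1 := by
  simp [gauss_apply, gaussWave]

theorem gauss_ne_zero {Z : Matrix (Fin N) (Fin N) ℂ} (hZ : IsGraphMatrix Z) (x : Config N) :
    gauss hZ x ≠ 0 := Complex.exp_ne_zero _

theorem ip_gauss_ne_zero {Z : Matrix (Fin N) (Fin N) ℂ} (hZ : IsGraphMatrix Z) :
    ip (gauss hZ) (gauss hZ) ≠ 0 := fun h =>
  gauss_ne_zero hZ 0 (by rw [eq_zero_of_ip_self h]; rfl)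

theorem hasTemperateGrowth_pairExponent (Z : Matrix (Fin N) (Fin N) ℂ) :
    Function.HasTemperateGrowth (fun p : Config N × Config N =>
      gaussExponent Z p.1 + conj (gaussExponent Z p.2)) :=
  ((hasTemperateGrowth_gaussExponent Z).comp
    (ContinuousLinearMap.fst ℝ (Config N) (Config N)).hasTemperateGrowth).add
  ((Complex.conjCLE : ℂ →L[ℝ] ℂ).hasTemperateGrowth.comp
    ((hasTemperateGrowth_gaussExponent Z).comp
    (ContinuousLinearMap.snd ℝ (Config N) (Config N)).hasTemperateGrowth))

theorem exists_re_pairExponent_le {Z : Matrix (Fin N) (Fin N) ℂ} (hZ : IsGraphMatrix Z) :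
    ∃ c : ℝ, 0 < c ∧ ∀ p : Config N × Config N,
      (gaussExponent Z p.1 + conj (gaussExponent Z p.2)).re ≤ -(c * ‖p‖ ^ 2) := by
  obtain ⟨c, hc, h⟩ := exists_re_gaussExponent_le hZ
  refine ⟨c, hc, fun p => ?_⟩
  have h1 := h p.1
  have h2 := h p.2
  have h3 : ‖p‖ ^ 2 ≤ ‖p.1‖ ^ 2 + ‖p.2‖ ^ 2 := by
    rw [Prod.norm_def]
    rcases max_choice ‖p.1‖ ‖p.2‖ with h | h <;> rw [h] <;>
      nlinarith [sq_nonneg ‖p.1‖, sq_nonneg ‖p.2‖]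
  simp only [Complex.add_re, Complex.conj_re]
  nlinarith

/-- The kernel `ψ(x) ψ̄(y)` of the unnormalized Gaussian state. -/
def gaussKernel {Z : Matrix (Fin N) (Fin N) ℂ} (hZ : IsGraphMatrix Z) : Kernel N :=
  expSchwartz _ (hasTemperateGrowth_pairExponent Z) (exists_re_pairExponent_le hZ)

theorem gaussKernel_apply {Z : Matrix (Fin N) (Fin N) ℂ} (hZ : IsGraphMatrix Z)
    (x y : Config N) : gaussKernel hZ (x, y) = gauss hZ x * conj (gauss hZ y) := by
  change Complex.exp (gaussExponent Z x + conj (gaussExponent Z y)) = _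
  rw [Complex.exp_add, Complex.exp_conj]; rfl

/-! ### The pure Gaussian state as an operator -/

/-- The projection `|ψ⟩⟨ψ| / ⟨ψ|ψ⟩` onto the Gaussian wave function. -/
def gaussState {Z : Matrix (Fin N) (Fin N) ℂ} (hZ : IsGraphMatrix Z) : Op N :=
  (ip (gauss hZ) (gauss hZ))⁻¹ • (ip (gauss hZ)).smulRight (gauss hZ)

theorem gaussState_apply {Z : Matrix (Fin N) (Fin N) ℂ} (hZ : IsGraphMatrix Z) (φ : Wave N) :
    gaussState hZ φ = ((ip (gauss hZ) (gauss hZ))⁻¹ * ip (gauss hZ) φ) • gauss hZ := by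
  simp [gaussState, mul_smul]

theorem gaussState_gauss {Z : Matrix (Fin N) (Fin N) ℂ} (hZ : IsGraphMatrix Z) :
    gaussState hZ (gauss hZ) = gauss hZ := by
  rw [gaussState_apply, inv_mul_cancel₀ (ip_gauss_ne_zero hZ), one_smul]

theorem isPureGaussianState_iff {Z : Matrix (Fin N) (Fin N) ℂ} (hZ : IsGraphMatrix Z) {ρ : Op N} :
    IsPureGaussianState Z ρ ↔ ρ = gaussState hZ := by
  have key : ∀ (φ : Wave N) (x : Config N), gaussState hZ φ x =
      ((∫ y, conj (gaussWave Z y) * φ y) / ((∫ y, ‖gaussWave Z y‖ ^ 2 : ℝ) : ℂ)) *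
      gaussWave Z x := by
    intro φ x
    rw [gaussState_apply, ip_self, ip_apply]
    simp only [smul_apply, smul_eq_mul, gauss_apply]
    rw [div_eq_inv_mul]
  constructor
  · intro h; ext φ x; rw [h, key]
  · rintro rfl φ x; exact key φ x

theorem hasKernel_gaussState {Z : Matrix (Fin N) (Fin N) ℂ} (hZ : IsGraphMatrix Z) :
    HasKernel (gaussState hZ) ((ip (gauss hZ) (gauss hZ))⁻¹ • gaussKernel hZ) := by
  intro φ x
  rw [gaussState_apply, ip_apply _ φ]
  simp only [smul_apply, smul_eq_mul, gaussKernel_apply]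
  rw [mul_assoc, mul_comm _ (gauss hZ x), ← integral_const_mul, ← integral_const_mul]
  congr 1; ext y; ring

theorem isDensityOperator_iff {ρ : Op N} : IsDensityOperator ρ ↔
    ρ ∈ kernelOps N ∧ (∀ φ, 0 ≤ (ip φ (ρ φ)).re ∧ (ip φ (ρ φ)).im = 0) ∧ opTrace ρ = 1 := Iff.rfl

theorem isDensityOperator_gaussState {Z : Matrix (Fin N) (Fin N) ℂ} (hZ : IsGraphMatrix Z) :
    IsDensityOperator (gaussState hZ) := by
  refine isDensityOperator_iff.2 ⟨⟨_, hasKernel_gaussState hZ⟩, fun φ => ?_, ?_⟩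
  · have h : ip φ (gaussState hZ φ) = ((∫ x, ‖gauss hZ x‖ ^ 2 : ℝ) : ℂ)⁻¹ *
        ((‖ip (gauss hZ) φ‖ ^ 2 : ℝ) : ℂ) := by
      rw [gaussState_apply, map_smul, smul_eq_mul, ← conj_ip (gauss hZ) φ, ip_self, mul_assoc,
        Complex.mul_conj']
      push_cast; rfl
    rw [h, ← Complex.ofReal_inv, ← Complex.ofReal_mul]
    refine ⟨?_, Complex.ofReal_im _⟩
    rw [Complex.ofReal_re]
    have : 0 ≤ ∫ x, ‖gauss hZ x‖ ^ 2 := integral_nonneg fun x => by positivity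
    positivity
  · rw [(hasKernel_gaussState hZ).opTrace_eq]
    simp only [smul_apply, smul_eq_mul, gaussKernel_apply]
    rw [integral_const_mul, inv_mul_eq_one₀ (ip_gauss_ne_zero hZ), ip_apply]
    congr 1; ext x; ring

/-! ### Annihilation operators of the Gaussian state -/

theorem hasLineDerivAt_gaussExponent {Z : Matrix (Fin N) (Fin N) ℂ} (hZ : Z.IsSymm)
    (x : Config N) (m : Fin N) :
    HasLineDerivAt ℝ (gaussExponent Z) (Complex.I * ∑ k, Z m k * ((x k : ℝ) : ℂ)) x
      (EuclideanSpace.single m (1 : ℝ)) := by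
  have hc : ∀ j : Fin N, HasDerivAt
      (fun t : ℝ => (((x + t • EuclideanSpace.single m (1 : ℝ) : Config N) j : ℝ) : ℂ))
      (if j = m then 1 else 0) 0 := by
    intro j
    have h1 : HasDerivAt (fun t : ℝ => ((t : ℝ) : ℂ)) 1 0 := Complex.ofRealCLM.hasDerivAt
    have h2 := (h1.mul_const (if j = m then (1 : ℂ) else 0)).const_add ((x j : ℝ) : ℂ)
    rw [one_mul] at h2
    refine h2.congr_of_eventuallyEq (Eventually.of_forall fun t => ?_)
    by_cases h : j = m <;> simp [h]
  have h := (HasDerivAt.fun_sum (u := Finset.univ) fun j _ =>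
    HasDerivAt.fun_sum (u := Finset.univ) fun k _ =>
      ((hc j).mul_const (Z j k)).mul (hc k)).const_mul (Complex.I / 2)
  rw [HasLineDerivAt]
  refine h.congr_deriv ?_
  have hs : ∀ j, Z j m = Z m j := fun j => hZ.apply m j
  simp only [zero_smul, add_zero, Finset.sum_add_distrib, ite_mul, one_mul, zero_mul, mul_ite,
    mul_one, mul_zero, Finset.sum_ite_eq', Finset.mem_univ, if_true, hs]
  rw [Finset.sum_comm]
  simp only [Finset.sum_ite_eq', Finset.mem_univ, if_true, mul_comm _ (Z m _)]
  ring

theorem differentiable_gaussExponent (Z : Matrix (Fin N) (Fin N) ℂ) :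
    Differentiable ℝ (gaussExponent Z) :=
  (hasTemperateGrowth_gaussExponent Z).1.differentiable (by simp)

theorem momOp_gauss {Z : Matrix (Fin N) (Fin N) ℂ} (hZ : IsGraphMatrix Z) (j : Fin N)
    (x : Config N) :
    momOp j (gauss hZ) x = (∑ k, Z j k * ((x k : ℝ) : ℂ)) * gauss hZ x := by
  have h : HasLineDerivAt ℝ (gauss hZ) (Complex.exp (gaussExponent Z x) *
      (Complex.I * ∑ k, Z j k * ((x k : ℝ) : ℂ))) x (EuclideanSpace.single j (1 : ℝ)) := by
    have := (hasLineDerivAt_gaussExponent hZ.1 x j)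
    rw [HasLineDerivAt] at this ⊢
    exact this.cexp.congr_deriv (by simp)
  rw [momOp_apply, h.lineDeriv, gauss_apply, gaussWave_eq]
  linear_combination (-(Complex.exp (gaussExponent Z x) * ∑ k, Z j k * ((x k : ℝ) : ℂ))) *
    Complex.I_mul_I

/-- The coefficient vector of `∑ⱼ vⱼ (pⱼ - (Z q)ⱼ)`. For a graph matrix `Z` these operators
annihilate the Gaussian wave function. -/
def annVec (Z : Matrix (Fin N) (Fin N) ℂ) : (Fin N → ℂ) →ₗ[ℂ] (Fin N ⊕ Fin N → ℂ) where
  toFun v := Sum.elim (-(Z *ᵥ v)) v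
  map_add' u v := by ext (i | i) <;> simp [Matrix.mulVec_add, add_comm]
  map_smul' c v := by ext (i | i) <;> simp [Matrix.mulVec_smul]

theorem annVec_apply (Z : Matrix (Fin N) (Fin N) ℂ) (v : Fin N → ℂ) :
    annVec Z v = Sum.elim (-(Z *ᵥ v)) v := rfl

/-- `linOp` as a linear map. -/
def linOpₗ : (Fin N ⊕ Fin N → ℂ) →ₗ[ℂ] Op N where
  toFun := linOp
  map_add' := linOp_add
  map_smul' := linOp_smul

/-- The operator `∑ⱼ vⱼ (pⱼ - (Z q)ⱼ)`. -/
def ann (Z : Matrix (Fin N) (Fin N) ℂ) : (Fin N → ℂ) →ₗ[ℂ] Op N := linOpₗ ∘ₗ annVec Z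

theorem ann_eq (Z : Matrix (Fin N) (Fin N) ℂ) (v : Fin N → ℂ) :
    ann Z v = linOp (annVec Z v) := rfl

theorem ann_mem (Z : Matrix (Fin N) (Fin N) ℂ) (v : Fin N → ℂ) : ann Z v ∈ observables N :=
  linOp_mem _

theorem star_annVec (Z : Matrix (Fin N) (Fin N) ℂ) (v : Fin N → ℂ) :
    star (annVec Z v) = annVec (Z.map conj) (star v) := by
  ext (i | i)
  · simp [annVec_apply, Matrix.mulVec, dotProduct]
  · simp [annVec_apply]

theorem ip_ann (Z : Matrix (Fin N) (Fin N) ℂ) (v : Fin N → ℂ) (φ χ : Wave N) :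
    ip φ (ann Z v χ) = ip (ann (Z.map conj) (star v) φ) χ := by
  rw [ann_eq, ip_linOp, star_annVec]; rfl

theorem sum_wave_apply (f : Fin N → Wave N) (x : Config N) : (∑ j, f j) x = ∑ j, f j x :=
  map_sum (⟨⟨fun g : Wave N => g x, rfl⟩, fun _ _ => rfl⟩ : Wave N →+ ℂ) f _

theorem linOp_gauss {Z : Matrix (Fin N) (Fin N) ℂ} (hZ : IsGraphMatrix Z)
    (c : Fin N ⊕ Fin N → ℂ) (x : Config N) :
    linOp c (gauss hZ) x =
      (∑ j, (c (.inl j) + (Z *ᵥ fun k => c (.inr k)) j) * ((x j : ℝ) : ℂ)) * gauss hZ x := by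
  rw [linOp_eq, LinearMap.add_apply, add_apply, LinearMap.sum_apply, LinearMap.sum_apply,
    sum_wave_apply, sum_wave_apply]
  simp only [LinearMap.smul_apply, smul_apply, smul_eq_mul, posOp_apply, momOp_gauss, add_mul,
    Finset.sum_add_distrib, Finset.sum_mul, Finset.mul_sum, Matrix.mulVec, dotProduct]
  congr 1
  · exact Finset.sum_congr rfl fun j _ => by ring
  · rw [Finset.sum_comm]
    refine Finset.sum_congr rfl fun j _ => Finset.sum_congr rfl fun k _ => ?_
    rw [hZ.1.apply]; ring

/-- A linear operator annihilates the Gaussian wave function only if it is a combination of the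
annihilation operators. -/
theorem linOp_gauss_eq_zero_iff {Z : Matrix (Fin N) (Fin N) ℂ} (hZ : IsGraphMatrix Z)
    (c : Fin N ⊕ Fin N → ℂ) :
    linOp c (gauss hZ) = 0 ↔ ∀ j, c (.inl j) + (Z *ᵥ fun k => c (.inr k)) j = 0 := by
  constructor
  · intro h j
    have := linOp_gauss hZ c (EuclideanSpace.single j (1 : ℝ))
    rw [h, zero_apply, eq_comm, mul_eq_zero, or_iff_left (gauss_ne_zero hZ _),
      Finset.sum_eq_single j (fun b _ hb => by simp [hb]) (by simp)] at this
    simpa using this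
  · intro h
    ext x
    rw [linOp_gauss]; simp [h]

theorem ann_gauss {Z : Matrix (Fin N) (Fin N) ℂ} (hZ : IsGraphMatrix Z) (v : Fin N → ℂ) :
    ann Z v (gauss hZ) = 0 :=
  (linOp_gauss_eq_zero_iff hZ _).2 fun j => by simp [annVec_apply]

/-- The Gaussian wave function spans the joint kernel of the annihilation operators. -/
theorem eq_smul_gauss {Z : Matrix (Fin N) (Fin N) ℂ} (hZ : IsGraphMatrix Z) {f : Wave N}
    (hf : ∀ v, ann Z v f = 0) : f = f 0 • gauss hZ := by
  set g : Config N → ℂ := fun x => Complex.exp (-gaussExponent Z x) * f x with hg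
  have hdE : Differentiable ℝ fun x => Complex.exp (-gaussExponent Z x) :=
    (differentiable_gaussExponent Z).neg.cexp
  have hdf : Differentiable ℝ f := (f.smooth 1).differentiable (by norm_num)
  have hdg : Differentiable ℝ g := hdE.mul hdf
  have hder : ∀ x m, fderiv ℝ g x (EuclideanSpace.single m (1 : ℝ)) = 0 := by
    intro x m
    have h1 := hasLineDerivAt_gaussExponent hZ.1 x m
    have h2 : HasLineDerivAt ℝ f (lineDeriv ℝ f x (EuclideanSpace.single m (1 : ℝ))) x
        (EuclideanSpace.single m (1 : ℝ)) := (hdf x).lineDifferentiableAt.hasLineDerivAt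
    have h3 : HasLineDerivAt ℝ g
        (Complex.exp (-gaussExponent Z x) * (-(Complex.I * ∑ k, Z m k * ((x k : ℝ) : ℂ))) * f x
          + Complex.exp (-gaussExponent Z x) *
            lineDeriv ℝ f x (EuclideanSpace.single m (1 : ℝ))) x
        (EuclideanSpace.single m (1 : ℝ)) := by
      rw [HasLineDerivAt] at h1 h2 ⊢
      exact ((h1.neg.cexp).mul h2).congr_deriv (by simp)
    have h4 : ann Z (Pi.single m 1) f x = 0 := by rw [hf]; rfl
    have h5 : lineDeriv ℝ f x (EuclideanSpace.single m (1 : ℝ))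
        = Complex.I * (∑ k, Z m k * ((x k : ℝ) : ℂ)) * f x := by
      rw [ann_eq, linOp_eq, LinearMap.add_apply, add_apply, LinearMap.sum_apply,
        LinearMap.sum_apply, sum_wave_apply, sum_wave_apply] at h4
      simp only [annVec_apply, Sum.elim_inl, Sum.elim_inr, LinearMap.smul_apply, smul_apply,
        smul_eq_mul, posOp_apply, momOp_apply, Pi.neg_apply, Matrix.mulVec_single_one,
        Matrix.col_apply] at h4
      simp only [Pi.single_apply, ite_mul, one_mul, zero_mul, Finset.sum_ite_eq',
        Finset.mem_univ, if_true, hZ.1.apply] at h4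
      have h6 : ∑ k, -Z m k * (((x k : ℝ) : ℂ) * f x)
          = -((∑ k, Z m k * ((x k : ℝ) : ℂ)) * f x) := by
        rw [Finset.sum_mul, ← Finset.sum_neg_distrib]
        exact Finset.sum_congr rfl fun k _ => by ring
      rw [h6] at h4
      linear_combination Complex.I * h4 +
        lineDeriv ℝ f x (EuclideanSpace.single m (1 : ℝ)) * Complex.I_mul_I
    rw [← ((hdg x).hasFDerivAt.hasLineDerivAt _).lineDeriv, h3.lineDeriv, h5]
    ring
  have hzero : ∀ x, fderiv ℝ g x = 0 := by
    intro x
    refine ContinuousLinearMap.coe_injective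
      ((EuclideanSpace.basisFun (Fin N) ℝ).toBasis.ext fun m => ?_)
    simpa using hder x m
  ext x
  have hconst := is_const_of_fderiv_eq_zero hdg hzero x 0
  have h0 : gaussExponent Z 0 = 0 := by simp [gaussExponent]
  simp only [hg, h0, neg_zero, Complex.exp_zero, one_mul] at hconst
  rw [smul_apply, smul_eq_mul, gauss_apply, gaussWave_eq, ← hconst, mul_comm, ← mul_assoc,
    ← Complex.exp_add]
  simp

/-- The operators `ann` of two symmetric matrices commute up to a scalar. -/
theorem commutator_ann {W Z : Matrix (Fin N) (Fin N) ℂ} (hW : W.IsSymm) (u v : Fin N → ℂ) :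
    ann W u * ann Z v - ann Z v * ann W u = (Complex.I * (u ⬝ᵥ (Z - W) *ᵥ v)) • (1 : Op N) := by
  rw [ann_eq, ann_eq, commutator_linOp]
  congr 2
  rw [Matrix.sub_mulVec, dotProduct_sub, Matrix.dotProduct_mulVec u W v, ← Matrix.mulVec_transpose,
    hW.eq]
  simp only [symp, annVec_apply, Sum.elim_inl, Sum.elim_inr, dotProduct, ← Finset.sum_sub_distrib,
    Pi.neg_apply]
  exact Finset.sum_congr rfl fun j _ => by ring

theorem ann_commute {Z : Matrix (Fin N) (Fin N) ℂ} (hZ : Z.IsSymm) (u v : Fin N → ℂ) :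
    ann Z u * ann Z v = ann Z v * ann Z u := by
  rw [← sub_eq_zero, commutator_ann hZ]; simp

/-! ### Passive Hamiltonians -/

/-- The passive Hamiltonian `½ ∑ⱼₖ Rⱼₖ (qⱼ qₖ + pⱼ pₖ)`. -/
def hamOp (R : Matrix (Fin N) (Fin N) ℝ) : Op N :=
  (1 / 2 : ℂ) • ∑ j, ∑ k, ((R j k : ℝ) : ℂ) • (posOp j * posOp k + momOp j * momOp k)

theorem posOp_mul_comm (j k : Fin N) : (posOp j * posOp k : Op N) = posOp k * posOp j :=
  sub_eq_zero.1 (commutator_posOp_posOp j k)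

theorem momOp_mul_comm (j k : Fin N) : (momOp j * momOp k : Op N) = momOp k * momOp j :=
  sub_eq_zero.1 (commutator_momOp_momOp j k)

/-- The coefficients `g_{jk}` with `j ≤ k` define a symmetric matrix, with `2 g_{jj}` on the
diagonal. -/
theorem sum_Ici_eq_hamOp (g : Fin N → Fin N → ℝ) :
    ∑ j, ∑ k ∈ Finset.Ici j, ((g j k : ℝ) : ℂ) • (posOp j * posOp k + momOp j * momOp k)
      = hamOp (Matrix.of fun j k => (if j ≤ k then g j k else 0) + if k ≤ j then g k j else 0) := by
  set S : Fin N → Fin N → Op N := fun j k => posOp j * posOp k + momOp j * momOp k with hS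
  have hsymm : ∀ j k, S j k = S k j := fun j k => by
    simp only [hS]; rw [posOp_mul_comm, momOp_mul_comm]
  have h1 : ∑ j, ∑ k ∈ Finset.Ici j, ((g j k : ℝ) : ℂ) • S j k
      = ∑ j, ∑ k, ((if j ≤ k then g j k else 0 : ℝ) : ℂ) • S j k := by
    refine Finset.sum_congr rfl fun j _ => ?_
    rw [← Finset.filter_le_eq_Ici, Finset.sum_filter]
    refine Finset.sum_congr rfl fun k _ => ?_
    split_ifs <;> simp
  have h2 : ∑ j, ∑ k, ((if k ≤ j then g k j else 0 : ℝ) : ℂ) • S j k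
      = ∑ j, ∑ k, ((if j ≤ k then g j k else 0 : ℝ) : ℂ) • S j k := by
    rw [Finset.sum_comm]
    exact Finset.sum_congr rfl fun j _ => Finset.sum_congr rfl fun k _ => by rw [hsymm]
  rw [h1]
  simp only [hamOp, Matrix.of_apply, Complex.ofReal_add, add_smul, Finset.sum_add_distrib]
  change _ = (1 / 2 : ℂ) • (∑ j, ∑ k, ((if j ≤ k then g j k else 0 : ℝ) : ℂ) • S j k
    + ∑ j, ∑ k, ((if k ≤ j then g k j else 0 : ℝ) : ℂ) • S j k)
  rw [h2, ← two_smul ℂ, smul_smul]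
  norm_num

theorem isPassiveHamiltonian_iff {H : Op N} :
    IsPassiveHamiltonian H ↔ ∃ R : Matrix (Fin N) (Fin N) ℝ, R.IsSymm ∧ H = hamOp R := by
  constructor
  · rintro ⟨g, rfl⟩
    exact ⟨_, by ext j k; simp [add_comm], sum_Ici_eq_hamOp g⟩
  · rintro ⟨R, hR, rfl⟩
    refine ⟨fun j k => if j = k then R j k / 2 else R j k, ?_⟩
    rw [sum_Ici_eq_hamOp]
    congr 1
    ext j k
    have := hR.apply j k
    rcases lt_trichotomy j k with h | h | h
    · simp [h.le, h.not_ge, h.ne]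
    · simp [h]
    · simp [h.le, h.not_ge, h.ne, this]

theorem hamOp_mem (R : Matrix (Fin N) (Fin N) ℝ) : hamOp R ∈ observables N :=
  Subalgebra.smul_mem _ (sum_mem fun j _ => sum_mem fun k _ => Subalgebra.smul_mem _
    (add_mem (mul_mem (posOp_mem j) (posOp_mem k)) (mul_mem (momOp_mem j) (momOp_mem k))) _) _

theorem ip_hamOp {R : Matrix (Fin N) (Fin N) ℝ} (φ χ : Wave N) :
    ip φ (hamOp R χ) = ip (hamOp R φ) χ := by
  simp only [hamOp, LinearMap.smul_apply, LinearMap.sum_apply, LinearMap.add_apply, map_smul,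
    map_smulₛₗ, map_sum, map_add, LinearMap.sum_apply, Module.End.mul_apply, ip_posOp, ip_momOp,
    Complex.conj_ofReal, LinearMap.add_apply]
  have h2 : conj (1 / 2 : ℂ) = 1 / 2 := by rw [map_div₀, map_one, Complex.conj_ofNat]
  rw [h2]
  congr 1
  refine Finset.sum_congr rfl fun j _ => Finset.sum_congr rfl fun k _ => ?_
  rw [← Module.End.mul_apply, ← Module.End.mul_apply, posOp_mul_comm, momOp_mul_comm]
  rfl

/-- A passive Hamiltonian acts on linear operators by `q ↦ -i R p`, `p ↦ i R q`. -/
theorem commutator_hamOp_linOp {R : Matrix (Fin N) (Fin N) ℝ} (hR : R.IsSymm) (a b : Fin N → ℂ) :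
    hamOp R * linOp (Sum.elim a b) - linOp (Sum.elim a b) * hamOp R
      = linOp (Sum.elim (Complex.I • (R.map Complex.ofReal *ᵥ b))
          (-(Complex.I • (R.map Complex.ofReal *ᵥ a)))) := by
  set X : Op N := linOp (Sum.elim a b) with hX
  have hq : ∀ j, posOp j * X = X * posOp j + (Complex.I * b j) • (1 : Op N) := by
    intro j
    have := commutator_linOp (Pi.single (Sum.inl j) 1) (Sum.elim a b)
    rw [linOp_single, ← hX, sub_eq_iff_eq_add'] at this
    change quadOp (Sum.inl j) * X = X * quadOp (Sum.inl j) + _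
    rw [this]
    congr 3
    simp only [symp, Sum.elim_inl, Sum.elim_inr]
    rw [Finset.sum_eq_single j (fun k _ hk => by simp [hk]) (by simp)]
    simp
  have hp : ∀ j, momOp j * X = X * momOp j + (-(Complex.I * a j)) • (1 : Op N) := by
    intro j
    have := commutator_linOp (Pi.single (Sum.inr j) 1) (Sum.elim a b)
    rw [linOp_single, ← hX, sub_eq_iff_eq_add'] at this
    change quadOp (Sum.inr j) * X = X * quadOp (Sum.inr j) + _
    rw [this]
    congr 2
    simp only [symp, Sum.elim_inl, Sum.elim_inr]
    rw [Finset.sum_eq_single j (fun k _ hk => by simp [hk]) (by simp)]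
    simp
  have hjk : ∀ j k, (posOp j * posOp k + momOp j * momOp k) * X
      - X * (posOp j * posOp k + momOp j * momOp k)
      = (Complex.I * b k) • posOp j + (Complex.I * b j) • posOp k
        - ((Complex.I * a k) • momOp j + (Complex.I * a j) • momOp k) := by
    intro j k
    have e1 : posOp j * posOp k * X
        = X * (posOp j * posOp k) + (Complex.I * b j) • posOp k + (Complex.I * b k) • posOp j := by
      rw [mul_assoc, hq, mul_add, ← mul_assoc, hq, add_mul, mul_smul_comm, mul_one,
        smul_mul_assoc, one_mul, mul_assoc]
    have e2 : momOp j * momOp k * X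
        = X * (momOp j * momOp k) + (-(Complex.I * a j)) • momOp k
          + (-(Complex.I * a k)) • momOp j := by
      rw [mul_assoc, hp, mul_add, ← mul_assoc, hp, add_mul, mul_smul_comm, mul_one,
        smul_mul_assoc, one_mul, mul_assoc]
    rw [add_mul, mul_add, e1, e2, neg_smul, neg_smul]
    abel
  have hs : ∀ (f : Fin N → ℂ) (T : Fin N → Op N),
      ∑ j, ∑ k, ((R j k : ℝ) : ℂ) • ((Complex.I * f j) • T k)
        = ∑ j, ∑ k, ((R j k : ℝ) : ℂ) • ((Complex.I * f k) • T j) := by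
    intro f T
    rw [Finset.sum_comm]
    exact Finset.sum_congr rfl fun j _ => Finset.sum_congr rfl fun k _ => by rw [hR.apply]
  have ht : ∀ (f : Fin N → ℂ) (T : Fin N → Op N),
      ∑ j, (Complex.I * (R.map Complex.ofReal *ᵥ f) j) • T j
        = ∑ j, ∑ k, ((R j k : ℝ) : ℂ) • ((Complex.I * f k) • T j) := by
    intro f T
    refine Finset.sum_congr rfl fun j _ => ?_
    simp only [Matrix.mulVec, dotProduct, Matrix.map_apply, Finset.mul_sum, Finset.sum_smul,
      smul_smul]
    exact Finset.sum_congr rfl fun k _ => by congr 1; ring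
  have hsum : hamOp R * X - X * hamOp R = (1 / 2 : ℂ) • ∑ j, ∑ k, ((R j k : ℝ) : ℂ) •
      ((posOp j * posOp k + momOp j * momOp k) * X
        - X * (posOp j * posOp k + momOp j * momOp k)) := by
    simp only [hamOp, smul_mul_assoc, mul_smul_comm, Finset.sum_mul, Finset.mul_sum, smul_sub,
      Finset.sum_sub_distrib]
  rw [hsum]
  simp only [hjk, smul_sub, smul_add, Finset.sum_sub_distrib, Finset.sum_add_distrib, hs]
  rw [linOp_eq]
  simp only [Sum.elim_inl, Sum.elim_inr, Pi.smul_apply, Pi.neg_apply, smul_eq_mul, neg_smul,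
    Finset.sum_neg_distrib, ht]
  rw [← smul_add, ← smul_add, ← two_smul ℂ, ← two_smul ℂ, smul_smul, smul_smul]
  norm_num
  rw [sub_eq_add_neg]

/-! ### Positive operators with Schwartz kernel -/

/-- Positivity of the quadratic form `⟨φ, A φ⟩` on the core. -/
def IsPositiveOp (A : Op N) : Prop := ∀ φ : Wave N, 0 ≤ (ip φ (A φ)).re ∧ (ip φ (A φ)).im = 0

theorem IsPositiveOp.conj_symm {A : Op N} (hA : IsPositiveOp A) (u v : Wave N) :
    conj (ip v (A u)) = ip u (A v) := by
  have h1 := (hA (u + v)).2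
  have h2 := (hA (u + Complex.I • v)).2
  have hu := (hA u).2
  have hv := (hA v).2
  simp only [map_add, map_smul, map_smulₛₗ, LinearMap.add_apply, LinearMap.smul_apply,
    Complex.add_im, Complex.add_re, smul_eq_mul, Complex.conj_I, Complex.mul_im, Complex.mul_re,
    Complex.neg_re, Complex.neg_im, Complex.I_re, Complex.I_im, hu, hv] at h1 h2
  apply Complex.ext
  · simp only [Complex.conj_re]; linarith
  · simp only [Complex.conj_im]; linarith

/-- The semi-inner product `⟨u, A v⟩` of a positive operator. -/
abbrev IsPositiveOp.core {A : Op N} (hA : IsPositiveOp A) :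
    PreInnerProductSpace.Core ℂ (Wave N) where
  inner u v := ip u (A v)
  conj_inner_symm u v := hA.conj_symm u v
  re_inner_nonneg u := (hA u).1
  add_left u v w := by simp
  smul_left u v c := by simp

theorem IsPositiveOp.cauchy_schwarz {A : Op N} (hA : IsPositiveOp A) (u v : Wave N) :
    ‖ip u (A v)‖ * ‖ip u (A v)‖ ≤ (ip u (A u)).re * (ip v (A v)).re := by
  have h := InnerProductSpace.Core.inner_mul_inner_self_le (c := hA.core) u v
  have e : ‖ip v (A u)‖ = ‖ip u (A v)‖ := by rw [← hA.conj_symm u v, RCLike.norm_conj]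
  change ‖ip u (A v)‖ * ‖ip v (A u)‖ ≤ (ip u (A u)).re * (ip v (A v)).re at h
  rwa [e] at h

theorem IsPositiveOp.apply_eq_zero {A : Op N} (hA : IsPositiveOp A) {u : Wave N}
    (hu : ip u (A u) = 0) : A u = 0 := by
  have h := hA.cauchy_schwarz (A u) u
  rw [hu] at h
  have h0 : ‖ip (A u) (A u)‖ = 0 := by
    have := norm_nonneg (ip (A u) (A u))
    simp only [Complex.zero_re, mul_zero] at h
    nlinarith
  exact eq_zero_of_ip_self (norm_eq_zero.1 h0)

/-- The bump functions of an approximate identity at `x`. -/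
def deltaBump (x : Config N) (n : ℕ) : ContDiffBump x where
  rIn := 1 / (2 * (n + 1))
  rOut := 1 / (n + 1)
  rIn_pos := by positivity
  rIn_lt_rOut := by
    apply one_div_lt_one_div_of_lt
    · positivity
    · linarith [n.cast_nonneg (α := ℝ)]

/-- An approximate identity at `x` in the Schwartz space. -/
def delta (x : Config N) (n : ℕ) : Wave N :=
  HasCompactSupport.toSchwartzMap (f := fun y => (((deltaBump x n).normed volume y : ℝ) : ℂ))
    ((deltaBump x n).hasCompactSupport_normed.comp_left (g := fun r : ℝ => (r : ℂ)) (by simp))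
    (Complex.ofRealCLM.contDiff.comp (deltaBump x n).contDiff_normed)

theorem delta_apply (x : Config N) (n : ℕ) (y : Config N) :
    delta x n y = (((deltaBump x n).normed volume y : ℝ) : ℂ) := rfl

/-- Averaging against an approximate identity reproduces local values. -/
theorem norm_integral_delta_sub_le {x : Config N} {n : ℕ} {h : Config N → ℂ} {a : ℂ} {ε : ℝ}
    (hh : ∀ y, dist y x < 1 / (n + 1) → ‖h y - a‖ ≤ ε)
    (hi : Integrable fun y => delta x n y * h y) :
    ‖(∫ y, delta x n y * h y) - a‖ ≤ ε := by
  have h1 : ∫ y, delta x n y = 1 := by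
    simp only [delta_apply]
    rw [integral_complex_ofReal, (deltaBump x n).integral_normed, Complex.ofReal_one]
  have h2 : (∫ y, delta x n y * h y) - a = ∫ y, delta x n y * (h y - a) := by
    simp only [mul_sub]
    rw [integral_sub hi ((delta x n).integrable.mul_const a), integral_mul_const, h1, one_mul]
  rw [h2]
  have h3 := norm_integral_le_of_norm_le (f := fun y => delta x n y * (h y - a))
    (g := fun y => (deltaBump x n).normed volume y * ε) (μ := volume)
    ((deltaBump x n).integrable_normed.mul_const ε) (Eventually.of_forall fun y => by
      rw [norm_mul, delta_apply, Complex.norm_real, Real.norm_of_nonneg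
        ((deltaBump x n).nonneg_normed y)]
      by_cases hy : dist y x < 1 / (n + 1)
      · exact mul_le_mul_of_nonneg_left (hh y hy) ((deltaBump x n).nonneg_normed y)
      · have : (deltaBump x n).normed volume y = 0 := by
          have hs := (deltaBump x n).support_normed_eq (μ := volume)
          by_contra hne
          have : y ∈ Metric.ball x (deltaBump x n).rOut := hs ▸ hne
          exact hy this
        simp [this])
  rwa [integral_mul_const, (deltaBump x n).integral_normed, one_mul] at h3

/-- The kernel is recovered from the matrix elements between approximate identities. -/
theorem HasKernel.tendsto_delta {A : Op N} {K : Kernel N} (hA : HasKernel A K) (x y : Config N) :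
    Tendsto (fun n => ip (delta x n) (A (delta y n))) atTop (𝓝 (K (x, y))) := by
  rw [Metric.tendsto_atTop]
  intro ε hε
  obtain ⟨r, hr, hball⟩ := Metric.continuous_iff.1 K.continuous (x, y) (ε / 2) (by positivity)
  obtain ⟨n₀, hn₀⟩ := exists_nat_one_div_lt hr
  refine ⟨n₀, fun n hn => ?_⟩
  have hnr : 1 / ((n : ℝ) + 1) ≤ r := (one_div_le_one_div_of_le (by positivity)
    (by gcongr)).trans hn₀.le
  have hin : ∀ u, dist u x < 1 / ((n : ℝ) + 1) → ‖A (delta y n) u - K (x, y)‖ ≤ ε / 2 := by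
    intro u hu
    rw [hA]
    simp only [mul_comm (K _)]
    refine norm_integral_delta_sub_le (fun v hv => ?_) ?_
    · rw [← dist_eq_norm]
      exact (hball (u, v) (by
        rw [Prod.dist_eq]; exact max_lt (hu.trans_le hnr) (hv.trans_le hnr))).le
    · simpa only [mul_comm] using integrable_kernel_mul K (delta y n) u
  have hconj : ∀ u, conj (delta x n u) = delta x n u := fun u => by
    rw [delta_apply, Complex.conj_ofReal]
  have hfin := norm_integral_delta_sub_le (x := x) (n := n) (h := A (delta y n)) hin (by
    simpa only [hconj] using integrable_conj_mul (delta x n) (A (delta y n)))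
  rw [dist_eq_norm, ip_apply]
  simp only [hconj]
  linarith

theorem IsPositiveOp.kernel_diag {A : Op N} {K : Kernel N} (hA : IsPositiveOp A)
    (hK : HasKernel A K) (x : Config N) : 0 ≤ (K (x, x)).re ∧ (K (x, x)).im = 0 := by
  have h := hK.tendsto_delta x x
  constructor
  · exact ge_of_tendsto' ((Complex.continuous_re.tendsto _).comp h) fun n => (hA _).1
  · refine tendsto_nhds_unique ((Complex.continuous_im.tendsto _).comp h) ?_
    refine tendsto_const_nhds.congr fun n => ?_
    exact ((hA _).2).symm

theorem HasKernel.opTrace_re {A : Op N} {K : Kernel N} (hK : HasKernel A K) :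
    (opTrace A).re = ∫ x, (K (x, x)).re := by
  rw [hK.opTrace_eq]
  exact (integral_re (𝕜 := ℂ) (kernelDiag K).integrable).symm

theorem HasKernel.opTrace_im {A : Op N} {K : Kernel N} (hK : HasKernel A K) :
    (opTrace A).im = ∫ x, (K (x, x)).im := by
  rw [hK.opTrace_eq]
  exact (integral_im (𝕜 := ℂ) (kernelDiag K).integrable).symm

theorem IsPositiveOp.opTrace_nonneg {A : Op N} (hA : IsPositiveOp A) (hk : A ∈ kernelOps N) :
    0 ≤ (opTrace A).re ∧ (opTrace A).im = 0 := by
  obtain ⟨K, hK⟩ := hk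
  rw [hK.opTrace_re, hK.opTrace_im]
  refine ⟨integral_nonneg fun x => (hA.kernel_diag hK x).1, ?_⟩
  simp [fun x => (hA.kernel_diag hK x).2]

/-- A positive operator with Schwartz kernel and trace zero vanishes. -/
theorem IsPositiveOp.eq_zero_of_opTrace {A : Op N} (hA : IsPositiveOp A) (hk : A ∈ kernelOps N)
    (ht : opTrace A = 0) : A = 0 := by
  obtain ⟨K, hK⟩ := hk
  have h1 : ∫ x, (K (x, x)).re = 0 := by rw [← hK.opTrace_re, ht, Complex.zero_re]
  have hcd : Continuous fun x : Config N => K (x, x) := K.continuous.comp (by fun_prop)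
  rw [integral_eq_zero_iff_of_nonneg (fun x => (hA.kernel_diag hK x).1)
    ((kernelDiag K).integrable.re)] at h1
  have h2 := (Continuous.ae_eq_iff_eq volume (Complex.continuous_re.comp hcd)
    continuous_const).1 h1
  have hre : ∀ x, (K (x, x)).re = 0 := fun x => congrFun h2 x
  have hzero : ∀ x y, K (x, y) = 0 := by
    intro x y
    have hl := hK.tendsto_delta x y
    have hx := (Complex.continuous_re.tendsto _).comp (hK.tendsto_delta x x)
    have hy := (Complex.continuous_re.tendsto _).comp (hK.tendsto_delta y y)
    have := le_of_tendsto_of_tendsto' (hl.norm.mul hl.norm) (hx.mul hy)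
      fun n => hA.cauchy_schwarz _ _
    rw [hre, hre] at this
    have h0 := norm_nonneg (K (x, y))
    exact norm_eq_zero.1 (by nlinarith)
  ext φ x
  rw [hK]; simp [hzero]

/-! ### Necessary conditions for a Gaussian steady state -/

/-- The Lindblad generator with Hamiltonian `H` and a single Lindblad operator `L` with adjoint
`L'`. -/
def lind (H L L' ρ : Op N) : Op N :=
  (-Complex.I) • (H * ρ - ρ * H) +
    (L * ρ * L' - (1 / 2 : ℂ) • (L' * L * ρ) - (1 / 2 : ℂ) • (ρ * (L' * L)))

theorem lindbladian_eq_lind (H : Op N) (c : Fin N ⊕ Fin N → ℂ) (ρ : Op N) :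
    lindbladian H (fun _ : Fin 1 => c) ρ = lind H (linOp c) (linOp (star c)) ρ := by
  simp [lindbladian, lind]

theorem isGraphMatrix_map_conj_symm {Z : Matrix (Fin N) (Fin N) ℂ} (hZ : Z.IsSymm) :
    (Z.map conj).IsSymm := by
  ext i j; simp [hZ.apply i j]

/-- If the Gaussian state is stationary, the Lindblad operator annihilates its wave function: test
the stationarity equation against `φ ⊥ ψ`. -/
theorem linOp_gauss_of_steady {Z : Matrix (Fin N) (Fin N) ℂ} (hZ : IsGraphMatrix Z)
    {H : Op N} {c : Fin N ⊕ Fin N → ℂ}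
    (hs : lind H (linOp c) (linOp (star c)) (gaussState hZ) = 0) : linOp c (gauss hZ) = 0 := by
  set ψ := gauss hZ with hψ
  set n := ip ψ ψ with hn
  have hn0 : n ≠ 0 := ip_gauss_ne_zero hZ
  have hρ : ∀ φ, gaussState hZ φ = (n⁻¹ * ip ψ φ) • ψ := gaussState_apply hZ
  have key : ∀ φ, ip ψ φ = 0 → ip (linOp c ψ) φ = 0 := by
    intro φ hφ
    have hφ' : ip φ ψ = 0 := by rw [← conj_ip, hφ, map_zero]
    have h0 : ip φ (lind H (linOp c) (linOp (star c)) (gaussState hZ) φ) = 0 := by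
      rw [hs]; simp
    have hadj : ip ψ (linOp (star c) φ) = ip (linOp c ψ) φ := by
      rw [ip_linOp, star_star]
    simp only [lind, LinearMap.add_apply, LinearMap.sub_apply, LinearMap.smul_apply,
      Module.End.mul_apply, hρ, hφ, mul_zero, zero_smul, map_zero, map_add, map_sub, map_smul,
      hφ', smul_zero, sub_zero, zero_add, smul_eq_mul, hadj] at h0
    have h1 : ip φ (linOp c ψ) = conj (ip (linOp c ψ) φ) := (conj_ip _ _).symm
    rw [h1, mul_assoc, Complex.mul_conj', mul_eq_zero, or_iff_right (inv_ne_zero hn0)] at h0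
    simpa using h0
  set χ := linOp c ψ - (n⁻¹ * ip ψ (linOp c ψ)) • ψ with hχ
  have h1 : ip ψ χ = 0 := by
    simp only [hχ, map_sub, map_smul, smul_eq_mul, ← hn]
    field_simp; ring
  have h2 : ip χ χ = 0 := by
    have hsub : ∀ (k : ℂ) (y : Wave N),
        ip (linOp c ψ - k • ψ) y = ip (linOp c ψ) y - conj k * ip ψ y := by
      intro k y; rw [map_sub, map_smulₛₗ]; rfl
    exact (hsub _ χ).trans (by rw [key χ h1, h1]; simp)
  have h3 : linOp c ψ = (n⁻¹ * ip ψ (linOp c ψ)) • ψ := sub_eq_zero.1 (eq_zero_of_ip_self h2)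
  have h4 : linOp c ψ 0 = 0 := by rw [hψ, linOp_gauss]; simp
  rw [h3, smul_apply, hψ, gauss_zero, smul_eq_mul, mul_one] at h4
  rw [h3, h4, zero_smul]

theorem mul_gaussState {Z : Matrix (Fin N) (Fin N) ℂ} (hZ : IsGraphMatrix Z) {A : Op N}
    (hA : A (gauss hZ) = 0) : A * gaussState hZ = 0 := by
  ext1 φ
  rw [Module.End.mul_apply, gaussState_apply, map_smul, hA, smul_zero, LinearMap.zero_apply]

theorem gaussState_mul_linOp_star {Z : Matrix (Fin N) (Fin N) ℂ} (hZ : IsGraphMatrix Z)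
    {c : Fin N ⊕ Fin N → ℂ} (hc : linOp c (gauss hZ) = 0) :
    gaussState hZ * linOp (star c) = 0 := by
  ext1 φ
  rw [Module.End.mul_apply, gaussState_apply, ip_linOp, star_star, hc, map_zero]
  simp

/-- For a graph matrix, stationarity of the Gaussian state under the passive Hamiltonian `R` is the
equation `R + Z R Z = 0`, which says that `[H, a]` is again a combination of annihilation
operators. -/
theorem hamOp_gauss_iff {Z : Matrix (Fin N) (Fin N) ℂ} (hZ : IsGraphMatrix Z)
    {R : Matrix (Fin N) (Fin N) ℝ} (hR : R.IsSymm) :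
    (∃ E : ℂ, hamOp R (gauss hZ) = E • gauss hZ) ↔
      R.map Complex.ofReal + Z * R.map Complex.ofReal * Z = 0 := by
  have hcomm : ∀ v : Fin N → ℂ, hamOp R (ann Z v (gauss hZ)) - ann Z v (hamOp R (gauss hZ))
      = linOp (Sum.elim (Complex.I • (R.map Complex.ofReal *ᵥ v))
          (-(Complex.I • (R.map Complex.ofReal *ᵥ (-(Z *ᵥ v)))))) (gauss hZ) := by
    intro v
    have := congrArg (fun A : Op N => A (gauss hZ)) (commutator_hamOp_linOp hR (-(Z *ᵥ v)) v)
    exact this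
  have hvec : ∀ v : Fin N → ℂ,
      linOp (Sum.elim (Complex.I • (R.map Complex.ofReal *ᵥ v))
          (-(Complex.I • (R.map Complex.ofReal *ᵥ (-(Z *ᵥ v)))))) (gauss hZ) = 0 ↔
        (R.map Complex.ofReal + Z * R.map Complex.ofReal * Z) *ᵥ v = 0 := by
    intro v
    rw [linOp_gauss_eq_zero_iff]
    have : ∀ j, (Sum.elim (Complex.I • (R.map Complex.ofReal *ᵥ v))
          (-(Complex.I • (R.map Complex.ofReal *ᵥ (-(Z *ᵥ v))))) (Sum.inl j : Fin N ⊕ Fin N)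
        + (Z *ᵥ fun k => Sum.elim (Complex.I • (R.map Complex.ofReal *ᵥ v))
          (-(Complex.I • (R.map Complex.ofReal *ᵥ (-(Z *ᵥ v)))))
            (Sum.inr k : Fin N ⊕ Fin N)) j)
        = Complex.I * ((R.map Complex.ofReal + Z * R.map Complex.ofReal * Z) *ᵥ v) j := by
      intro j
      have h2 : (fun k => Sum.elim (Complex.I • (R.map Complex.ofReal *ᵥ v))
          (-(Complex.I • (R.map Complex.ofReal *ᵥ (-(Z *ᵥ v)))))
            (Sum.inr k : Fin N ⊕ Fin N)) = Complex.I • (R.map Complex.ofReal *ᵥ (Z *ᵥ v)) := by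
        ext k; simp [Matrix.mulVec_neg]
      rw [h2, Matrix.mulVec_smul, Matrix.add_mulVec, ← Matrix.mulVec_mulVec,
        ← Matrix.mulVec_mulVec]
      simp [mul_add]
    simp only [this, mul_eq_zero, Complex.I_ne_zero, false_or]
    exact ⟨fun h => funext h, fun h j => congrFun h j⟩
  constructor
  · rintro ⟨E, hE⟩
    have : ∀ v, (R.map Complex.ofReal + Z * R.map Complex.ofReal * Z) *ᵥ v = 0 := fun v => by
      rw [← hvec, ← hcomm, hE, map_smul, ann_gauss, map_zero, smul_zero, sub_zero]
    exact Matrix.ext_of_mulVec_single fun j => by rw [this, Matrix.zero_mulVec]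
  · intro h
    refine ⟨_, eq_smul_gauss hZ fun v => ?_⟩
    have := hcomm v
    rw [(hvec v).2 (by rw [h, Matrix.zero_mulVec]), ann_gauss, map_zero, zero_sub,
      neg_eq_zero] at this
    exact this

theorem hamOp_gauss_of_steady {Z : Matrix (Fin N) (Fin N) ℂ} (hZ : IsGraphMatrix Z)
    {H : Op N} {c : Fin N ⊕ Fin N → ℂ}
    (hs : lind H (linOp c) (linOp (star c)) (gaussState hZ) = 0) :
    ∃ E : ℂ, H (gauss hZ) = E • gauss hZ := by
  have hL := linOp_gauss_of_steady hZ hs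
  have h1 := mul_gaussState hZ hL
  have h2 := gaussState_mul_linOp_star hZ hL
  rw [lind, h1, mul_assoc _ (linOp c) (gaussState hZ), h1, ← mul_assoc (gaussState hZ), h2] at hs
  simp only [zero_mul, mul_zero, smul_zero, sub_zero, add_zero, smul_eq_zero, neg_eq_zero,
    Complex.I_ne_zero, false_or] at hs
  have h3 := congrArg (fun A : Op N => A (gauss hZ)) (sub_eq_zero.1 hs)
  simp only [Module.End.mul_apply, gaussState_gauss] at h3
  exact ⟨_, h3.trans (gaussState_apply hZ _)⟩

/-- Operators `D`, `D'` that commute with the Lindblad operators and shift the energy by opposite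
amounts intertwine the Lindblad generator with itself. -/
theorem lind_conj {H L L' D D' ρ : Op N} {ν : ℂ} (h1 : H * D = D * H + ν • D)
    (h2 : D' * H = H * D' + ν • D') (hL : L * D = D * L) (hL' : L' * D = D * L')
    (hD : D' * L = L * D') (hD' : D' * L' = L' * D') :
    lind H L L' (D * ρ * D') = D * lind H L L' ρ * D' := by
  have e1 : H * (D * ρ * D') - D * ρ * D' * H = D * (H * ρ - ρ * H) * D' := by
    have a1 : H * (D * ρ * D') = D * (H * ρ) * D' + ν • (D * ρ * D') := by
      calc H * (D * ρ * D') = H * D * ρ * D' := by noncomm_ring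
        _ = _ := by rw [h1]; simp only [add_mul, smul_mul_assoc, mul_assoc]
    have a2 : D * ρ * D' * H = D * (ρ * H) * D' + ν • (D * ρ * D') := by
      calc D * ρ * D' * H = D * ρ * (D' * H) := by noncomm_ring
        _ = _ := by rw [h2]; simp only [mul_add, mul_smul_comm, mul_assoc]
    rw [a1, a2, mul_sub, sub_mul]; abel
  have e2 : L * (D * ρ * D') * L' = D * (L * ρ * L') * D' := by
    calc L * (D * ρ * D') * L' = (L * D) * ρ * (D' * L') := by noncomm_ring
      _ = _ := by rw [hL, hD']; noncomm_ring
  have e3 : L' * L * (D * ρ * D') = D * (L' * L * ρ) * D' := by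
    calc L' * L * (D * ρ * D') = L' * (L * D) * ρ * D' := by noncomm_ring
      _ = (L' * D) * L * ρ * D' := by rw [hL]; noncomm_ring
      _ = _ := by rw [hL']; noncomm_ring
  have e4 : D * ρ * D' * (L' * L) = D * (ρ * (L' * L)) * D' := by
    calc D * ρ * D' * (L' * L) = D * ρ * (D' * L') * L := by noncomm_ring
      _ = D * ρ * L' * (D' * L) := by rw [hD']; noncomm_ring
      _ = _ := by rw [hD]; noncomm_ring
  rw [lind, lind, e1, e2, e3, e4]
  simp only [mul_add, mul_sub, add_mul, sub_mul, mul_smul_comm, smul_mul_assoc]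

theorem lind_smul (H L L' ρ : Op N) (k : ℂ) : lind H L L' (k • ρ) = k • lind H L L' ρ := by
  simp only [lind, mul_smul_comm, smul_mul_assoc, smul_add, smul_sub, smul_comm k]

/-- If a real eigenvector `w` of `R` is orthogonal to the coupling, the normal mode `w` decouples
from the reservoir, and exciting it gives a second steady state. -/
theorem exists_other_steadyState {Z : Matrix (Fin N) (Fin N) ℂ} (hZ : IsGraphMatrix Z)
    {R : Matrix (Fin N) (Fin N) ℝ} (hR : R.IsSymm) {c : Fin N ⊕ Fin N → ℂ}
    (hs : lind (hamOp R) (linOp c) (linOp (star c)) (gaussState hZ) = 0)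
    {w : Fin N → ℝ} (hw : w ≠ 0) {μ : ℝ} (hμ : R *ᵥ w = μ • w)
    (h1 : ∑ j, c (.inl j) * ((w j : ℝ) : ℂ) = 0) (h2 : ∑ j, c (.inr j) * ((w j : ℝ) : ℂ) = 0) :
    ∃ ρ, IsSteadyState (hamOp R) (fun _ : Fin 1 => c) ρ ∧ ρ ≠ gaussState hZ := by
  set wc : Fin N → ℂ := fun j => ((w j : ℝ) : ℂ) with hwc
  have hwc0 : wc ≠ 0 := by
    intro h; apply hw; ext j; simpa [hwc] using congrFun h j
  have hRw : R.map Complex.ofReal *ᵥ wc = (μ : ℂ) • wc := by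
    ext j
    have := congrArg (Complex.ofReal) (congrFun hμ j)
    simpa [Matrix.mulVec, dotProduct, hwc] using this
  -- one of the two quadratures of the mode does not annihilate `ψ`
  obtain ⟨s, hs2, hsc, hne⟩ : ∃ s : ℂ, s * s = -1 ∧ conj s = -s ∧
      linOp (Sum.elim wc (s • wc)) (gauss hZ) ≠ 0 := by
    by_contra! hcon
    have hp := hcon Complex.I Complex.I_mul_I (by simp)
    have hm := hcon (-Complex.I) (by simp) (by simp)
    rw [linOp_gauss_eq_zero_iff] at hp hm
    apply hwc0
    ext j
    have e1 := hp j
    have e2 := hm j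
    have e3 : ∀ t : ℂ, (Z *ᵥ fun k => Sum.elim wc (t • wc) (Sum.inr k : Fin N ⊕ Fin N)) j
        = t * (Z *ᵥ wc) j := by
      intro t
      change (Z *ᵥ (t • wc)) j = _
      rw [Matrix.mulVec_smul]; rfl
    rw [e3] at e1 e2
    simp only [Sum.elim_inl] at e1 e2
    simp only [Pi.zero_apply]
    linear_combination (e1 + e2) / 2
  set D : Op N := linOp (Sum.elim wc (s • wc)) with hD
  set D' : Op N := linOp (Sum.elim wc ((-s) • wc)) with hD'
  have hadj : ∀ φ χ, ip φ (D χ) = ip (D' φ) χ := by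
    intro φ χ
    have hst : star (Sum.elim wc (s • wc)) = Sum.elim wc ((-s) • wc) := by
      ext (j | j)
      · simp [hwc]
      · simp [hwc, hsc]
    rw [hD, ip_linOp, hD', hst]
  have hadj' : ∀ φ χ, ip φ (D' χ) = ip (D φ) χ := by
    intro φ χ; rw [← conj_ip, ← hadj, conj_ip]
  have hH : ∀ t : ℂ, t * t = -1 → hamOp R * linOp (Sum.elim wc (t • wc))
      = linOp (Sum.elim wc (t • wc)) * hamOp R
        + (Complex.I * t * μ) • linOp (Sum.elim wc (t • wc)) := by
    intro t ht
    have h := commutator_hamOp_linOp hR wc (t • wc)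
    rw [sub_eq_iff_eq_add'] at h
    rw [h, ← linOp_smul]
    congr 2
    rw [Matrix.mulVec_smul, hRw]
    ext (j | j)
    · simp; ring
    · simp only [Sum.elim_inr, Pi.neg_apply, Pi.smul_apply, smul_eq_mul]
      linear_combination (-Complex.I * μ * wc j) * ht
  have hcom : ∀ (d : Fin N ⊕ Fin N → ℂ) (t : ℂ), ∑ j, d (.inl j) * wc j = 0 →
      ∑ j, d (.inr j) * wc j = 0 →
      linOp d * linOp (Sum.elim wc (t • wc)) = linOp (Sum.elim wc (t • wc)) * linOp d := by
    intro d t e1 e2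
    rw [← sub_eq_zero, commutator_linOp]
    have : symp d (Sum.elim wc (t • wc)) = 0 := by
      have : symp d (Sum.elim wc (t • wc))
          = t * ∑ j, d (.inl j) * wc j - ∑ j, d (.inr j) * wc j := by
        rw [symp, Finset.mul_sum, ← Finset.sum_sub_distrib]
        refine Finset.sum_congr rfl fun j _ => ?_
        simp only [Sum.elim_inl, Sum.elim_inr, Pi.smul_apply, smul_eq_mul]; ring
      rw [this, e1, e2]; simp
    rw [this]; simp
  have h1s : ∑ j, (star c) (.inl j) * wc j = 0 := by
    have := congrArg conj h1
    simpa [hwc] using this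
  have h2s : ∑ j, (star c) (.inr j) * wc j = 0 := by
    have := congrArg conj h2
    simpa [hwc] using this
  have hlind : lind (hamOp R) (linOp c) (linOp (star c)) (D * gaussState hZ * D') = 0 := by
    rw [lind_conj (ν := Complex.I * s * μ) (hH s hs2) ?_ (hcom _ _ h1 h2) (hcom _ _ h1s h2s)
      (hcom _ _ h1 h2).symm (hcom _ _ h1s h2s).symm, hs]
    · simp
    · rw [hH (-s) (by rw [neg_mul_neg, hs2]), add_assoc, ← add_smul]
      have : Complex.I * -s * μ + Complex.I * s * μ = 0 := by ring
      rw [this, zero_smul, add_zero]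
  have hmem : D * gaussState hZ * D' ∈ kernelOps N :=
    mem_kernelOps_mul (linOp_mem _) (mul_mem_kernelOps (linOp_mem _) ⟨_, hasKernel_gaussState hZ⟩)
  have hpos : IsPositiveOp (D * gaussState hZ * D') := by
    intro φ
    rw [Module.End.mul_apply, Module.End.mul_apply, hadj]
    exact (isDensityOperator_gaussState hZ).2.1 (D' φ)
  have happ : ∀ χ, (D * gaussState hZ * D') χ
      = ((ip (gauss hZ) (gauss hZ))⁻¹ * ip (D (gauss hZ)) χ) • D (gauss hZ) := by
    intro χ
    rw [Module.End.mul_apply, Module.End.mul_apply, gaussState_apply, map_smul, hadj']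
  set τ := opTrace (D * gaussState hZ * D') with hτ
  have hτ0 : τ ≠ 0 := by
    intro h
    have h0 := hpos.eq_zero_of_opTrace hmem h
    have h3 := happ (D (gauss hZ))
    rw [h0, LinearMap.zero_apply, eq_comm, smul_eq_zero, or_iff_left hne, mul_eq_zero,
      or_iff_right (inv_ne_zero (ip_gauss_ne_zero hZ))] at h3
    exact hne (eq_zero_of_ip_self h3)
  obtain ⟨hτre, hτim⟩ := hpos.opTrace_nonneg hmem
  have hτr : τ⁻¹ = ((τ.re⁻¹ : ℝ) : ℂ) := by
    rw [Complex.ofReal_inv]; congr 1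
    exact Complex.ext (by simp) (by simpa using hτim)
  refine ⟨τ⁻¹ • (D * gaussState hZ * D'), ⟨isDensityOperator_iff.2
    ⟨Submodule.smul_mem _ _ hmem, fun φ => ?_, ?_⟩, ?_⟩, fun heq => ?_⟩
  · rw [LinearMap.smul_apply, map_smul, smul_eq_mul, hτr, Complex.re_ofReal_mul,
      Complex.im_ofReal_mul, (hpos φ).2, mul_zero]
    exact ⟨mul_nonneg (inv_nonneg.2 hτre) (hpos φ).1, rfl⟩
  · rw [opTrace_smul hmem, inv_mul_cancel₀ hτ0]
  · rw [lindbladian_eq_lind, lind_smul, hlind, smul_zero]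
  · have h3 := congrArg (fun A : Op N => A (gauss hZ) 0) heq
    simp only [LinearMap.smul_apply, happ, gaussState_gauss, smul_apply, gauss_zero] at h3
    rw [hD, linOp_gauss] at h3
    simp at h3

/-- Necessary conditions for the Gaussian state with graph matrix `Z` to be generated by the
passive Hamiltonian `R` and the Lindblad operator with coefficients `c`. -/
theorem Generates.necessary {Z : Matrix (Fin N) (Fin N) ℂ} (hZ : IsGraphMatrix Z)
    {R : Matrix (Fin N) (Fin N) ℝ} (hR : R.IsSymm) {c : Fin N ⊕ Fin N → ℂ}
    (h : Generates (hamOp R) (fun _ : Fin 1 => c) Z) :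
    (∀ j, c (.inl j) + (Z *ᵥ fun k => c (.inr k)) j = 0) ∧
    R.map Complex.ofReal + Z * R.map Complex.ofReal * Z = 0 ∧
    ∀ (w : Fin N → ℝ) (μ : ℝ), R *ᵥ w = μ • w → ∑ j, c (.inl j) * ((w j : ℝ) : ℂ) = 0 →
      ∑ j, c (.inr j) * ((w j : ℝ) : ℂ) = 0 → w = 0 := by
  obtain ⟨⟨ρ, hρ, hst, huniq⟩, -⟩ := h
  rw [isPureGaussianState_iff hZ] at hρ
  subst hρ
  have hs := hst.2
  rw [lindbladian_eq_lind] at hs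
  refine ⟨(linOp_gauss_eq_zero_iff hZ c).1 (linOp_gauss_of_steady hZ hs),
    (hamOp_gauss_iff hZ hR).1 (hamOp_gauss_of_steady hZ hs), fun w μ hμ h1 h2 => ?_⟩
  by_contra hw
  obtain ⟨ρ', hρ', hne⟩ := exists_other_steadyState hZ hR hs hw hμ h1 h2
  exact hne (huniq ρ' hρ')

/-! ### Decay of linear systems -/

theorem tendsto_zero_of_hasDerivWithinAt {μ : ℂ} (hμ : μ.re < 0) {f g : ℝ → ℂ}
    (hf : ∀ t, 0 ≤ t → HasDerivWithinAt f (μ * f t + g t) (Set.Ici 0) t)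
    (hg : Tendsto g atTop (𝓝 0)) : Tendsto f atTop (𝓝 0) := by
  set a := -μ.re with ha
  have ha0 : 0 < a := by linarith
  rw [Metric.tendsto_atTop]
  intro ε hε
  obtain ⟨T₀, hT₀⟩ := Metric.tendsto_atTop.1 hg (a * (ε / 2)) (by positivity)
  set T := max T₀ 0 with hT
  have hT0 : 0 ≤ T := le_max_right _ _
  set v : ℝ → ℂ := fun t => Complex.exp (-(μ * t)) * f t with hv
  have hnorm : ∀ t : ℝ, ‖Complex.exp (-(μ * t))‖ = Real.exp (a * t) := by
    intro t; rw [Complex.norm_exp]; congr 1; simp [ha]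
  have hvd : ∀ t : ℝ, 0 ≤ t →
      HasDerivWithinAt v (Complex.exp (-(μ * t)) * g t) (Set.Ici 0) t := by
    intro t ht
    have h1 : HasDerivAt (fun t : ℝ => Complex.exp (-(μ * t)))
        (Complex.exp (-(μ * t)) * (-(μ * 1))) t :=
      (((Complex.ofRealCLM.hasDerivAt (x := t)).const_mul μ).neg).cexp
    exact (h1.hasDerivWithinAt.mul (hf t ht)).congr_deriv (by ring)
  have hbound : ∀ t, T ≤ t → ‖v t‖ ≤ ‖v T‖ + (ε / 2) * (Real.exp (a * t) - Real.exp (a * T)) := by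
    intro t ht
    refine image_norm_le_of_norm_deriv_right_le_deriv_boundary (f := v) (a := T) (b := t)
      (B := fun s => ‖v T‖ + (ε / 2) * (Real.exp (a * s) - Real.exp (a * T)))
      (B' := fun s => (ε / 2) * (Real.exp (a * s) * a))
      (f' := fun s => Complex.exp (-(μ * s)) * g s) ?_ ?_ ?_ ?_ ?_ ⟨ht, le_rfl⟩
    · intro s hs
      exact ((hvd s (hT0.trans hs.1)).continuousWithinAt).mono fun r hr => hT0.trans hr.1
    · intro s hs
      exact (hvd s (hT0.trans hs.1)).mono (Set.Ici_subset_Ici.2 (hT0.trans hs.1))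
    · simp
    · intro s
      have h1 : HasDerivAt (fun s : ℝ => Real.exp (a * s)) (Real.exp (a * s) * a) s := by
        simpa using ((hasDerivAt_id s).const_mul a).exp
      exact ((h1.sub_const _).const_mul (ε / 2)).const_add _
    · intro s hs
      rw [norm_mul, hnorm]
      have := hT₀ s ((le_max_left _ _).trans hs.1)
      rw [dist_zero_right] at this
      calc Real.exp (a * s) * ‖g s‖ ≤ Real.exp (a * s) * (a * (ε / 2)) := by gcongr
        _ = _ := by ring
  have hexp : Tendsto (fun t : ℝ => Real.exp (-(a * t)) * ‖v T‖) atTop (𝓝 0) := by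
    have : Tendsto (fun t : ℝ => Real.exp (-(a * t))) atTop (𝓝 0) :=
      Real.tendsto_exp_neg_atTop_nhds_zero.comp (tendsto_id.const_mul_atTop ha0)
    simpa using this.mul_const ‖v T‖
  obtain ⟨T₁, hT₁⟩ := Metric.tendsto_atTop.1 hexp (ε / 2) (by positivity)
  refine ⟨max T T₁, fun t ht => ?_⟩
  have hb := hbound t ((le_max_left _ _).trans ht)
  have h1 := hT₁ t ((le_max_right _ _).trans ht)
  rw [Real.dist_0_eq_abs, abs_of_nonneg (by positivity)] at h1
  have hvt : ‖v t‖ = Real.exp (a * t) * ‖f t‖ := by rw [hv, norm_mul, hnorm]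
  have hft : ‖f t‖ = Real.exp (-(a * t)) * ‖v t‖ := by
    rw [hvt, ← mul_assoc, ← Real.exp_add]; simp
  have hee : Real.exp (-(a * t)) * Real.exp (a * t) = 1 := by rw [← Real.exp_add]; simp
  rw [dist_zero_right, hft]
  have hTpos := Real.exp_pos (a * T)
  have hpos := Real.exp_pos (-(a * t))
  calc Real.exp (-(a * t)) * ‖v t‖
      ≤ Real.exp (-(a * t)) * (‖v T‖ + (ε / 2) * (Real.exp (a * t) - Real.exp (a * T))) := by
        gcongr
    _ = Real.exp (-(a * t)) * ‖v T‖ + (ε / 2) * (Real.exp (-(a * t)) * Real.exp (a * t))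
        - (ε / 2) * (Real.exp (-(a * t)) * Real.exp (a * T)) := by ring
    _ < ε := by
        rw [hee]
        have : 0 < (ε / 2) * (Real.exp (-(a * t)) * Real.exp (a * T)) := by positivity
        linarith

/-- Successive application of `M - μ` for `μ` in a list. -/
def killList {V : Type*} [AddCommGroup V] [Module ℂ V] (M : Module.End ℂ V) (l : List ℂ) (v : V) :
    V :=
  l.foldl (fun v μ => M v - μ • v) v

theorem killList_eq_aeval {V : Type*} [AddCommGroup V] [Module ℂ V] (M : Module.End ℂ V)
    (l : List ℂ) (v : V) : killList M l v
      = Polynomial.aeval M (l.map fun μ => Polynomial.X - Polynomial.C μ).prod v := by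
  induction l generalizing v with
  | nil => simp [killList]
  | cons μ l ih =>
    change killList M l (M v - μ • v) = _
    rw [ih, List.map_cons, List.prod_cons, mul_comm, map_mul, Module.End.mul_apply]
    simp

/-- Cayley–Hamilton: `∏ (M - μ) = 0` over a list of eigenvalues `μ`. -/
theorem exists_killList {V : Type*} [AddCommGroup V] [Module ℂ V] [FiniteDimensional ℂ V]
    (M : Module.End ℂ V) :
    ∃ l : List ℂ, (∀ μ ∈ l, M.HasEigenvalue μ) ∧ ∀ v, killList M l v = 0 := by
  have hm : (minpoly ℂ M).Monic := minpoly.monic (Algebra.IsIntegral.isIntegral M)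
  refine ⟨(minpoly ℂ M).roots.toList, fun μ hμ => ?_, fun v => ?_⟩
  · rw [Multiset.mem_toList, Polynomial.mem_roots hm.ne_zero] at hμ
    exact Module.End.hasEigenvalue_of_isRoot hμ
  · have h := (IsAlgClosed.splits (minpoly ℂ M)).eq_prod_roots_of_monic hm
    have h2 : ((minpoly ℂ M).roots.toList.map fun μ => Polynomial.X - Polynomial.C μ).prod
        = minpoly ℂ M := by
      rw [← Multiset.prod_coe, ← Multiset.map_coe, Multiset.coe_toList, ← h]
    rw [killList_eq_aeval, h2, minpoly.aeval, LinearMap.zero_apply]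

/-- A linear functional transported by the flow of a Hurwitz map decays. -/
theorem tendsto_zero_linear {V : Type*} [AddCommGroup V] [Module ℂ V] (M : Module.End ℂ V)
    (f : ℝ → V →ₗ[ℂ] ℂ)
    (hf : ∀ v t, 0 ≤ t → HasDerivWithinAt (fun t => f t v) (f t (M v)) (Set.Ici 0) t)
    (l : List ℂ) (hl : ∀ μ ∈ l, μ.re < 0) (v : V) (hv : killList M l v = 0) :
    Tendsto (fun t => f t v) atTop (𝓝 0) := by
  induction l generalizing v with
  | nil =>
    have : v = 0 := hv
    simp [this]
  | cons μ l ih =>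
    have h := ih (fun ν hν => hl ν (List.mem_cons_of_mem _ hν)) (M v - μ • v) hv
    refine tendsto_zero_of_hasDerivWithinAt (hl μ List.mem_cons_self) (fun t ht => ?_) h
    refine (hf v t ht).congr_deriv ?_
    simp

/-- The bilinear version of `tendsto_zero_linear`. -/
theorem tendsto_zero_bilinear {V W : Type*} [AddCommGroup V] [Module ℂ V] [AddCommGroup W]
    [Module ℂ W] (M : Module.End ℂ V) (M' : Module.End ℂ W) (f : ℝ → V →ₗ[ℂ] W →ₗ[ℂ] ℂ)
    (hf : ∀ v w t, 0 ≤ t →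
      HasDerivWithinAt (fun t => f t v w) (f t (M v) w + f t v (M' w)) (Set.Ici 0) t)
    (l l' : List ℂ) (hl : ∀ μ ∈ l, μ.re < 0) (hl' : ∀ μ ∈ l', μ.re < 0) (v : V) (w : W)
    (hv : killList M l v = 0) (hw : killList M' l' w = 0) :
    Tendsto (fun t => f t v w) atTop (𝓝 0) := by
  induction l generalizing v w l' with
  | nil =>
    have : v = 0 := hv
    simp [this]
  | cons μ l ih =>
    induction l' generalizing v w with
    | nil =>
      have : w = 0 := hw
      simp [this]
    | cons ν l' ih' =>
      have h1 := ih (ν :: l') (fun κ hκ => hl κ (List.mem_cons_of_mem _ hκ)) hl' (M v - μ • v) w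
        hv hw
      have h2 := ih' (fun κ hκ => hl' κ (List.mem_cons_of_mem _ hκ)) v (M' w - ν • w) hv hw
      have h3 : (μ + ν).re < 0 := by
        have := hl μ List.mem_cons_self
        have := hl' ν List.mem_cons_self
        rw [Complex.add_re]; linarith
      have h4 := h1.add h2
      rw [add_zero] at h4
      refine tendsto_zero_of_hasDerivWithinAt h3 (fun t ht => ?_) h4
      refine (hf v w t ht).congr_deriv ?_
      simp; ring

/-! ### The Heisenberg picture -/

/-- The dual (Heisenberg) generator. -/
def lindDual (H L L' X : Op N) : Op N :=
  Complex.I • (H * X - X * H) +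
    (L' * X * L - (1 / 2 : ℂ) • (L' * L * X) - (1 / 2 : ℂ) • (X * (L' * L)))

theorem lindDual_mem {H L L' X : Op N} (hH : H ∈ observables N) (hL : L ∈ observables N)
    (hL' : L' ∈ observables N) (hX : X ∈ observables N) : lindDual H L L' X ∈ observables N := by
  have h := mul_mem hL' hL
  exact add_mem (Subalgebra.smul_mem _ (sub_mem (mul_mem hH hX) (mul_mem hX hH)) _)
    (sub_mem (sub_mem (mul_mem (mul_mem hL' hX) hL) (Subalgebra.smul_mem _ (mul_mem h hX) _))
      (Subalgebra.smul_mem _ (mul_mem hX h) _))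

/-- Duality of the generators in the Schrödinger and Heisenberg pictures. -/
theorem opTrace_mul_lind {H L L' X ρ : Op N} (hH : H ∈ observables N) (hL : L ∈ observables N)
    (hL' : L' ∈ observables N) (hX : X ∈ observables N) (hρ : ρ ∈ kernelOps N) :
    opTrace (X * lind H L L' ρ) = opTrace (lindDual H L L' X * ρ) := by
  -- the difference is a combination of commutators with observables
  set T : Submodule ℂ (Op N) :=
    { carrier := {A | A ∈ kernelOps N ∧ opTrace A = 0}
      add_mem' := fun hA hB => ⟨add_mem hA.1 hB.1, by
        rw [opTrace_add hA.1 hB.1, hA.2, hB.2, add_zero]⟩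
      zero_mem' := ⟨zero_mem _, by simpa using opTrace_smul (zero_mem (kernelOps N)) 0⟩
      smul_mem' := fun c A hA => ⟨Submodule.smul_mem _ _ hA.1, by
        rw [opTrace_smul hA.1, hA.2, mul_zero]⟩ } with hT
  have hcomm : ∀ {Y A : Op N}, Y ∈ observables N → A ∈ kernelOps N → A * Y - Y * A ∈ T := by
    intro Y A hY hA
    have h1 := mul_mem_kernelOps hY hA
    have h2 := mem_kernelOps_mul hY hA
    refine ⟨sub_mem h2 h1, ?_⟩
    have h3 := opTrace_add h2 (Submodule.smul_mem _ (-1) h1)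
    rw [opTrace_smul h1, opTrace_mul_comm hY hA] at h3
    rw [sub_eq_add_neg, ← neg_one_smul ℂ (Y * A), h3]; ring
  have hXρ := mul_mem_kernelOps hX hρ
  have hLL := mul_mem hL' hL
  have hdecomp : X * lind H L L' ρ = lindDual H L L' X * ρ +
      (Complex.I • (X * ρ * H - H * (X * ρ)) + (X * L * ρ * L' - L' * (X * L * ρ))
        - (1 / 2 : ℂ) • (X * ρ * (L' * L) - L' * L * (X * ρ))) := by
    simp only [lind, lindDual, mul_add, mul_sub, add_mul, sub_mul, smul_sub, mul_smul_comm,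
      smul_mul_assoc, neg_smul, mul_neg, mul_assoc]
    abel
  have hmem : Complex.I • (X * ρ * H - H * (X * ρ)) + (X * L * ρ * L' - L' * (X * L * ρ))
        - (1 / 2 : ℂ) • (X * ρ * (L' * L) - L' * L * (X * ρ)) ∈ T :=
    sub_mem (add_mem (Submodule.smul_mem _ _ (hcomm hH hXρ))
      (hcomm hL' (mul_mem_kernelOps (mul_mem hX hL) hρ)))
      (Submodule.smul_mem _ _ (hcomm hLL hXρ))
  rw [hdecomp, opTrace_add (mul_mem_kernelOps (lindDual_mem hH hL hL' hX) hρ) hmem.1, hmem.2,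
    add_zero]

/-- The Leibniz rule of the Heisenberg generator. -/
theorem lindDual_mul (H L L' X Y : Op N) :
    lindDual H L L' (X * Y) = lindDual H L L' X * Y + X * lindDual H L L' Y
      + (L' * X - X * L') * (Y * L - L * Y) := by
  have h : ∀ A : Op N, A = (1 / 2 : ℂ) • A + (1 / 2 : ℂ) • A := fun A => by
    rw [← add_smul]; norm_num
  simp only [lindDual, mul_add, mul_sub, add_mul, sub_mul, smul_sub, mul_smul_comm,
    smul_mul_assoc, mul_assoc]
  have e := h (X * (L' * (L * Y)))
  nth_rewrite 3 [e]
  abel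

/-- The chain rule for a continuous functional on the Schwartz space of kernels, where the
derivative is that of a curve in a topological vector space which is not normed. -/
theorem hasDerivWithinAt_clm_comp (T : Kernel N →L[ℂ] ℂ) {κ : ℝ → Kernel N} {κ' : Kernel N}
    {s : Set ℝ} {t : ℝ} (h : HasDerivWithinAt κ κ' s t) :
    HasDerivWithinAt (fun t => T (κ t)) (T κ') s t := by
  refine HasFDerivAtFilter.of_isLittleOTVS ?_
  have h1 := (T.restrictScalars ℝ).isBigOTVS_comp.trans_isLittleOTVS
    (HasFDerivAtFilter.isLittleOTVS h)
  refine h1.congr_left fun p => ?_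
  simp

theorem IsSolution.hasDerivWithinAt {H : Op N} {c : Fin N ⊕ Fin N → ℂ} {ρ : ℝ → Op N}
    (h : IsSolution H (fun _ : Fin 1 => c) ρ) {X : Op N} (hH : H ∈ observables N)
    (hX : X ∈ observables N) {t : ℝ} (ht : 0 ≤ t) :
    HasDerivWithinAt (fun t => opTrace (X * ρ t))
      (opTrace (lindDual H (linOp c) (linOp (star c)) X * ρ t)) (Set.Ici 0) t := by
  obtain ⟨κ, κ', hκ⟩ := h
  obtain ⟨⟨Ψ, hΨ⟩, -⟩ := id hX
  obtain ⟨hd, hk, hk', hder⟩ := hκ t ht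
  have h1 := hasDerivWithinAt_clm_comp (kernelTrace.comp Ψ) hder
  rw [← opTrace_mul_lind hH (linOp_mem _) (linOp_mem _) hX ⟨_, hk⟩, ← lindbladian_eq_lind,
    (hΨ _ _ hk').opTrace_eq_kernelTrace]
  refine h1.congr_of_mem (fun s hs => ?_) ht
  exact (hΨ _ _ (hκ s hs).2.1).opTrace_eq_kernelTrace

open scoped Classical in
/-- The expectation `X ↦ tr(X ρ)` on observables, as a linear functional for every `ρ`
(zero if `ρ` has no Schwartz kernel). -/
def expectation (ρ : Op N) : observables N →ₗ[ℂ] ℂ :=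
  if h : ρ ∈ kernelOps N then expect h else 0

theorem expectation_apply {ρ : Op N} (h : ρ ∈ kernelOps N) (X : observables N) :
    expectation ρ X = opTrace (X.1 * ρ) := by
  rw [expectation, dif_pos h]; rfl

theorem IsSolution.mem_kernelOps {K : ℕ} {H : Op N} {C : Matrix (Fin K) (Fin N ⊕ Fin N) ℂ}
    {ρ : ℝ → Op N} (h : IsSolution H C ρ) {t : ℝ} (ht : 0 ≤ t) : ρ t ∈ kernelOps N := by
  obtain ⟨κ, κ', hκ⟩ := h
  exact ⟨_, (hκ t ht).2.1⟩

/-- The equation of motion of expectations. -/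
theorem IsSolution.hasDerivWithinAt_expectation {H : Op N} {c : Fin N ⊕ Fin N → ℂ} {ρ : ℝ → Op N}
    (h : IsSolution H (fun _ : Fin 1 => c) ρ) (hH : H ∈ observables N) (X X' : observables N)
    (hX : lindDual H (linOp c) (linOp (star c)) X = X') {t : ℝ} (ht : 0 ≤ t) :
    HasDerivWithinAt (fun t => expectation (ρ t) X) (expectation (ρ t) X') (Set.Ici 0) t := by
  have h1 := h.hasDerivWithinAt hH X.2 ht
  rw [hX, ← expectation_apply (h.mem_kernelOps ht)] at h1
  exact h1.congr_of_mem (fun s hs => expectation_apply (h.mem_kernelOps hs) X) ht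

/-! ### The Heisenberg equations of the annihilation operators -/

theorem mulVec_apply_of_row {W : Matrix (Fin N) (Fin N) ℂ} {l : Fin N} {z : ℂ}
    (hl : ∀ j, W l j = if j = l then z else 0) (v : Fin N → ℂ) : (W *ᵥ v) l = z * v l := by
  simp [Matrix.mulVec, dotProduct, hl]

/-- The drift of the annihilation operators `ann W v` under the passive Hamiltonian `R` and damping
at rate `y` on mode `l`. -/
def drift (R : Matrix (Fin N) (Fin N) ℝ) (l : Fin N) (y : ℝ) (W : Matrix (Fin N) (Fin N) ℂ) :
    Module.End ℂ (Fin N → ℂ) where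
  toFun v := -(R.map Complex.ofReal *ᵥ (W *ᵥ v)) - (y * v l) • Pi.single l (1 : ℂ)
  map_add' u v := by
    simp only [Matrix.mulVec_add, Pi.add_apply, mul_add, add_smul]; abel
  map_smul' k v := by
    simp only [Matrix.mulVec_smul, Pi.smul_apply, smul_eq_mul, RingHom.id_apply, smul_sub,
      smul_neg, smul_smul]
    congr 2; ring

theorem drift_apply (R : Matrix (Fin N) (Fin N) ℝ) (l : Fin N) (y : ℝ)
    (W : Matrix (Fin N) (Fin N) ℂ) (v : Fin N → ℂ) :
    drift R l y W v = -(R.map Complex.ofReal *ᵥ (W *ᵥ v)) - (y * v l) • Pi.single l (1 : ℂ) := rfl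

/-- The equation `R + W R W = 0` keeps the span of the `ann W v` invariant under the
Hamiltonian flow. -/
theorem I_smul_commutator_hamOp_ann {R : Matrix (Fin N) (Fin N) ℝ} (hR : R.IsSymm)
    {W : Matrix (Fin N) (Fin N) ℂ}
    (hW : R.map Complex.ofReal + W * R.map Complex.ofReal * W = 0) (v : Fin N → ℂ) :
    Complex.I • (hamOp R * ann W v - ann W v * hamOp R)
      = ann W (-(R.map Complex.ofReal *ᵥ (W *ᵥ v))) := by
  have h := commutator_hamOp_linOp hR (-(W *ᵥ v)) v
  rw [ann_eq, annVec_apply, h, ← linOp_smul, ann_eq, annVec_apply]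
  congr 1
  have h2 : R.map Complex.ofReal *ᵥ v = -(W *ᵥ (R.map Complex.ofReal *ᵥ (W *ᵥ v))) := by
    rw [Matrix.mulVec_mulVec, Matrix.mulVec_mulVec, ← Matrix.neg_mulVec]
    congr 1
    exact eq_neg_of_add_eq_zero_left hW
  ext (j | j)
  · simp only [Pi.smul_apply, Sum.elim_inl, smul_eq_mul, h2, Matrix.mulVec_neg, Pi.neg_apply]
    rw [← mul_assoc, Complex.I_mul_I]; ring
  · simp only [Pi.smul_apply, Sum.elim_inr, smul_eq_mul, Matrix.mulVec_neg, Pi.neg_apply]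
    linear_combination ((R.map Complex.ofReal *ᵥ (W *ᵥ v)) j) * Complex.I_mul_I

/-- The Heisenberg generator in terms of commutators. -/
theorem lindDual_eq (H L L' X : Op N) : lindDual H L L' X = Complex.I • (H * X - X * H)
    + (1 / 2 : ℂ) • (L' * (X * L - L * X) + (L' * X - X * L') * L) := by
  have e : L' * X * L = (1 / 2 : ℂ) • (L' * X * L) + (1 / 2 : ℂ) • (L' * X * L) := by
    rw [← add_smul]; norm_num
  rw [lindDual, e]
  simp only [mul_sub, sub_mul, smul_add, smul_sub, mul_assoc]
  abel

theorem sub_map_conj (Z : Matrix (Fin N) (Fin N) ℂ) :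
    Z - Z.map conj = (2 * Complex.I) • (Z.map Complex.im).map Complex.ofReal := by
  ext i j
  simp [Complex.sub_conj]
  ring

/-- A real positive definite matrix is positive definite on complex vectors. -/
theorem complex_quadForm_pos {Y : Matrix (Fin N) (Fin N) ℝ} (hY : Y.PosDef) {x : Fin N → ℂ}
    (hx : x ≠ 0) : 0 < (star x ⬝ᵥ (Y.map Complex.ofReal *ᵥ x)).re ∧
      (star x ⬝ᵥ (Y.map Complex.ofReal *ᵥ x)).im = 0 := by
  have hsym : ∀ i j, Y i j = Y j i := fun i j => by simpa using hY.1.apply j i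
  constructor
  · have hre : (star x ⬝ᵥ (Y.map Complex.ofReal *ᵥ x)).re
        = (fun i => (x i).re) ⬝ᵥ (Y *ᵥ fun i => (x i).re)
          + (fun i => (x i).im) ⬝ᵥ (Y *ᵥ fun i => (x i).im) := by
      simp only [dotProduct, Matrix.mulVec, Matrix.map_apply, Complex.re_sum, Finset.mul_sum,
        ← Finset.sum_add_distrib, Pi.star_apply, RCLike.star_def]
      refine Finset.sum_congr rfl fun i _ => Finset.sum_congr rfl fun j _ => ?_
      simp
    rw [hre]
    have h1 := hY.posSemidef.dotProduct_mulVec_nonneg fun i => (x i).re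
    have h2 := hY.posSemidef.dotProduct_mulVec_nonneg fun i => (x i).im
    rw [star_trivial] at h1 h2
    by_cases hre : (fun i => (x i).re) = 0
    · have him : (fun i => (x i).im) ≠ 0 := by
        intro him; apply hx; ext i
        exact Complex.ext (congrFun hre i) (congrFun him i)
      have h3 := hY.dotProduct_mulVec_pos him
      rw [star_trivial] at h3
      linarith
    · have h3 := hY.dotProduct_mulVec_pos hre
      rw [star_trivial] at h3
      linarith
  · have hcross : ∑ i, ∑ j, ((x i).re * (Y i j * (x j).im) - (x i).im * (Y i j * (x j).re))
        = 0 := by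
      simp only [Finset.sum_sub_distrib]
      rw [sub_eq_zero, Finset.sum_comm]
      exact Finset.sum_congr rfl fun i _ => Finset.sum_congr rfl fun j _ => by
        rw [hsym]; ring
    rw [← hcross]
    simp only [dotProduct, Matrix.mulVec, Matrix.map_apply, Complex.im_sum, Finset.mul_sum,
      Pi.star_apply, RCLike.star_def]
    refine Finset.sum_congr rfl fun i _ => Finset.sum_congr rfl fun j _ => ?_
    simp; ring

/-- The data of a passive system that generates the Gaussian state with graph matrix `Z`: a
Hamiltonian compatible with `Z`, damping on a mode `l` that is an eigenvector of `Z`, and no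
eigenmode of the Hamiltonian decoupled from the damping. -/
structure Drives (Z : Matrix (Fin N) (Fin N) ℂ) (R : Matrix (Fin N) (Fin N) ℝ) (l : Fin N)
    (z : ℂ) : Prop where
  graph : IsGraphMatrix Z
  symm : R.IsSymm
  ricc : R.map Complex.ofReal + Z * R.map Complex.ofReal * Z = 0
  row : ∀ j, Z l j = if j = l then z else 0
  obs : ∀ (μ : ℂ) (v : Fin N → ℂ), R.map Complex.ofReal *ᵥ (Z *ᵥ v) = μ • v → v l = 0 → v = 0

namespace Drives

variable {Z : Matrix (Fin N) (Fin N) ℂ} {R : Matrix (Fin N) (Fin N) ℝ} {l : Fin N} {z : ℂ}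

theorem row_conj (h : Drives Z R l z) (j : Fin N) :
    (Z.map conj) l j = if j = l then conj z else 0 := by
  rw [Matrix.map_apply, h.row]; split_ifs <;> simp

theorem ricc_conj (h : Drives Z R l z) :
    R.map Complex.ofReal + Z.map conj * R.map Complex.ofReal * Z.map conj = 0 := by
  have := congrArg (fun M : Matrix (Fin N) (Fin N) ℂ => M.map conj) h.ricc
  have hr : (R.map Complex.ofReal).map conj = R.map Complex.ofReal := by
    ext i j; simp
  simpa [Matrix.map_add, Matrix.map_mul, hr] using this

theorem im_pos (h : Drives Z R l z) : 0 < z.im := by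
  have h1 := h.graph.2.diag_pos (i := l)
  simpa [h.row] using h1

/-- The commutator of the damping with an annihilation operator. -/
theorem commutator_damping (h : Drives Z R l z) (v : Fin N → ℂ) :
    ann (Z.map conj) (Pi.single l 1) * ann Z v - ann Z v * ann (Z.map conj) (Pi.single l 1)
      = (-2 * (z.im * v l)) • (1 : Op N) := by
  rw [commutator_ann (isGraphMatrix_map_conj_symm h.graph.1)]
  congr 1
  rw [Matrix.sub_mulVec, single_one_dotProduct, Pi.sub_apply, mulVec_apply_of_row h.row,
    mulVec_apply_of_row h.row_conj, ← sub_mul, Complex.sub_conj]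
  push_cast
  linear_combination (2 * z.im * v l) * Complex.I_mul_I

theorem commutator_damping' (h : Drives Z R l z) (v : Fin N → ℂ) :
    ann (Z.map conj) v * ann Z (Pi.single l 1) - ann Z (Pi.single l 1) * ann (Z.map conj) v
      = (-2 * (z.im * v l)) • (1 : Op N) := by
  rw [commutator_ann (isGraphMatrix_map_conj_symm h.graph.1), ← h.commutator_damping,
    commutator_ann (isGraphMatrix_map_conj_symm h.graph.1)]
  congr 2
  have hs : (Z - Z.map conj)ᵀ = Z - Z.map conj := by
    rw [Matrix.transpose_sub, h.graph.1.eq, (isGraphMatrix_map_conj_symm h.graph.1).eq]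
  rw [Matrix.dotProduct_mulVec, ← Matrix.mulVec_transpose, hs, dotProduct_comm]

/-- The damping enters through the commutator with `L*` alone, as the `ann Z v` commute with `L`. -/
theorem lindDual_ann (h : Drives Z R l z) (v : Fin N → ℂ) :
    lindDual (hamOp R) (ann Z (Pi.single l 1)) (ann (Z.map conj) (Pi.single l 1)) (ann Z v)
      = ann Z (drift R l z.im Z v) := by
  rw [lindDual_eq, I_smul_commutator_hamOp_ann h.symm h.ricc, h.commutator_damping,
    ann_commute h.graph.1 v, sub_self, mul_zero, zero_add, smul_mul_assoc, one_mul, smul_smul,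
    drift_apply, map_sub, map_smul, sub_eq_add_neg, ← neg_smul]
  congr 2; ring

theorem lindDual_ann_conj (h : Drives Z R l z) (v : Fin N → ℂ) :
    lindDual (hamOp R) (ann Z (Pi.single l 1)) (ann (Z.map conj) (Pi.single l 1))
      (ann (Z.map conj) v) = ann (Z.map conj) (drift R l z.im (Z.map conj) v) := by
  rw [lindDual_eq, I_smul_commutator_hamOp_ann h.symm h.ricc_conj, h.commutator_damping',
    ann_commute (isGraphMatrix_map_conj_symm h.graph.1) _ v, sub_self, zero_mul, add_zero,
    mul_smul_comm, mul_one, smul_smul,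
    drift_apply, map_sub, map_smul, sub_eq_add_neg, ← neg_smul]
  congr 2; ring

/-- `Y = Im Z` is a Lyapunov function of the drift. -/
theorem drift_hurwitz (h : Drives Z R l z) {μ : ℂ} {v : Fin N → ℂ} (hv : v ≠ 0)
    (hμ : drift R l z.im Z v = μ • v) : μ.re < 0 := by
  set Rc := R.map Complex.ofReal with hRc
  set Zb := Z.map conj with hZb
  set Y := (Z.map Complex.im).map Complex.ofReal with hY
  have hZbs : Zb.IsSymm := isGraphMatrix_map_conj_symm h.graph.1
  have hRs : Rc.IsSymm := by ext i j; simp [hRc, h.symm.apply i j]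
  have hlyap : Y * Rc * Z + Zb * Rc * Y = 0 := by
    have e : (2 * Complex.I) • (Y * Rc * Z + Zb * Rc * Y)
        = (Z - Zb) * Rc * Z + Zb * Rc * (Z - Zb) := by
      rw [sub_map_conj]; simp [← hY]
    have e2 : (Z - Zb) * Rc * Z + Zb * Rc * (Z - Zb) = 0 := by
      have h1 := h.ricc
      have h2 := h.ricc_conj
      rw [← hRc] at h1 h2
      calc (Z - Zb) * Rc * Z + Zb * Rc * (Z - Zb)
          = (Rc + Z * Rc * Z) - (Rc + Zb * Rc * Zb) := by noncomm_ring
        _ = 0 := by rw [h1, h2, sub_zero]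
    rw [e2, smul_eq_zero, or_iff_right (by simp)] at e
    exact e
  have hYl : ∀ u : Fin N → ℂ, (Y *ᵥ u) l = z.im * u l := fun u =>
    mulVec_apply_of_row (fun j => by
      simp only [hY, Matrix.map_apply, h.row]; split_ifs <;> simp) u
  -- the quadratic form of `Y` at `v`
  set q : ℂ := star v ⬝ᵥ (Y *ᵥ v) with hq
  obtain ⟨hqre, hqim⟩ := complex_quadForm_pos h.graph.2 hv
  have hYherm : Yᴴ = Y := by ext i j; simp [hY, h.graph.1.apply i j]
  have e1 : μ * q = -(star v ⬝ᵥ ((Y * Rc * Z) *ᵥ v)) - z.im * v l * (z.im * conj (v l)) := by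
    have : star v ⬝ᵥ (Y *ᵥ drift R l z.im Z v) = μ * q := by
      rw [hμ, Matrix.mulVec_smul, dotProduct_smul, smul_eq_mul]
    have hYs : Yᵀ = Y := by ext i j; simp [hY, h.graph.1.apply i j]
    have hsing : star v ⬝ᵥ (Y *ᵥ Pi.single l 1) = z.im * conj (v l) := by
      rw [Matrix.dotProduct_mulVec, ← Matrix.mulVec_transpose, hYs, dotProduct_single_one, hYl]
      simp
    rw [← this, drift_apply, Matrix.mulVec_sub, Matrix.mulVec_neg, Matrix.mulVec_smul,
      dotProduct_sub, dotProduct_neg, dotProduct_smul, Matrix.mulVec_mulVec,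
      Matrix.mulVec_mulVec, smul_eq_mul, ← hRc, hsing, ← mul_assoc]
  have e2 : conj (star v ⬝ᵥ ((Y * Rc * Z) *ᵥ v)) = -(star v ⬝ᵥ ((Y * Rc * Z) *ᵥ v)) := by
    have h1 : Zb * Rc * Y = (Y * Rc * Z)ᴴ := by
      rw [Matrix.conjTranspose_mul, Matrix.conjTranspose_mul, hYherm, ← mul_assoc]
      congr 2
      · ext i j; simp [hZb, h.graph.1.apply i j]
      · ext i j; simp [hRc, h.symm.apply i j]
    have h2 : Y * Rc * Z = -(Y * Rc * Z)ᴴ := by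
      rw [← h1]; exact eq_neg_of_add_eq_zero_left hlyap
    have h3 : star (star v ⬝ᵥ ((Y * Rc * Z) *ᵥ v)) = star v ⬝ᵥ ((Y * Rc * Z)ᴴ *ᵥ v) := by
      rw [← Matrix.star_dotProduct ((Y * Rc * Z) *ᵥ v) v, Matrix.star_mulVec,
        ← Matrix.dotProduct_mulVec]
    change star (star v ⬝ᵥ ((Y * Rc * Z) *ᵥ v)) = _
    rw [h3]
    conv_rhs => rw [h2]
    rw [Matrix.neg_mulVec, dotProduct_neg, neg_neg]
  have e3 : μ.re * q.re = -(z.im * z.im * Complex.normSq (v l)) := by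
    have h1 := congrArg Complex.re e1
    have h2 := congrArg Complex.re e2
    have h3 : (z.im * v l * (z.im * conj (v l)) : ℂ)
        = ((z.im * z.im * Complex.normSq (v l) : ℝ) : ℂ) := by
      push_cast
      rw [Complex.normSq_eq_conj_mul_self]; ring
    rw [h3] at h1
    simp only [Complex.mul_re, Complex.sub_re, Complex.neg_re, Complex.conj_re,
      Complex.ofReal_re] at h1 h2
    have : q.im = 0 := hqim
    rw [this] at h1
    linarith
  have hy := h.im_pos
  have hq0 : 0 < q.re := hqre
  by_contra hneg
  push Not at hneg
  have h0 : Complex.normSq (v l) = 0 := by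
    have h1 : 0 ≤ μ.re * q.re := by positivity
    have h2 := Complex.normSq_nonneg (v l)
    have h3 : 0 < z.im * z.im := by positivity
    rw [e3] at h1
    nlinarith
  have hvl : v l = 0 := Complex.normSq_eq_zero.1 h0
  apply hv
  apply h.obs (-μ) v _ hvl
  rw [drift_apply, hvl] at hμ
  simp only [mul_zero, zero_smul, sub_zero] at hμ
  rw [neg_smul, ← hμ, neg_neg]

theorem drift_hurwitz_conj (h : Drives Z R l z) {μ : ℂ} {v : Fin N → ℂ} (hv : v ≠ 0)
    (hμ : drift R l z.im (Z.map conj) v = μ • v) : μ.re < 0 := by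
  have h1 : drift R l z.im Z (star v) = conj μ • star v := by
    have h2 := congrArg star hμ
    have hm : ∀ (M : Matrix (Fin N) (Fin N) ℂ) (u : Fin N → ℂ),
        star (M *ᵥ u) = M.map conj *ᵥ star u := by
      intro M u; ext i; simp [Matrix.mulVec, dotProduct]
    have hr : (R.map Complex.ofReal).map conj = R.map Complex.ofReal := by ext i j; simp
    have hzz : (Z.map conj).map conj = Z := by ext i j; simp
    rw [drift_apply, star_sub, star_neg, hm, hm, hr, hzz, star_smul] at h2
    rw [drift_apply]
    convert h2 using 1
    · congr 1
      ext i
      by_cases hi : i = l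
      · subst hi; simp
      · simp [hi]
    · ext i; simp
  have := h.drift_hurwitz (star_ne_zero.2 hv) h1
  simpa using this

end Drives

/-! ### Decay of the moments and convergence of mean and covariance -/

/-- `ann W` with values in the algebra of observables. -/
def annObs (W : Matrix (Fin N) (Fin N) ℂ) : (Fin N → ℂ) →ₗ[ℂ] observables N where
  toFun v := ⟨ann W v, ann_mem W v⟩
  map_add' u v := Subtype.ext (map_add _ u v)
  map_smul' c v := Subtype.ext (map_smul _ c v)

/-- The second moments `⟨(ann W v) (ann W' w)⟩`. -/
def secondMoment (ρ : Op N) (W W' : Matrix (Fin N) (Fin N) ℂ) :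
    (Fin N → ℂ) →ₗ[ℂ] (Fin N → ℂ) →ₗ[ℂ] ℂ :=
  LinearMap.mk₂ ℂ (fun v w => expectation ρ (annObs W v * annObs W' w))
    (fun u v w => by rw [map_add, add_mul, map_add])
    (fun c v w => by rw [map_smul, smul_mul_assoc, map_smul])
    (fun u v w => by rw [map_add, mul_add, map_add])
    (fun c v w => by rw [map_smul, mul_smul_comm, map_smul])

theorem secondMoment_apply (ρ : Op N) (W W' : Matrix (Fin N) (Fin N) ℂ) (v w : Fin N → ℂ) :
    secondMoment ρ W W' v w = expectation ρ (annObs W v * annObs W' w) := rfl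

theorem expectation_one {ρ : Op N} (h : IsDensityOperator ρ) : expectation ρ 1 = 1 := by
  rw [expectation_apply h.1]
  simpa using h.2.2

theorem IsSolution.isDensityOperator {K : ℕ} {H : Op N} {C : Matrix (Fin K) (Fin N ⊕ Fin N) ℂ}
    {ρ : ℝ → Op N} (h : IsSolution H C ρ) {t : ℝ} (ht : 0 ≤ t) : IsDensityOperator (ρ t) := by
  obtain ⟨κ, κ', hκ⟩ := h
  exact (hκ t ht).1

/-- A steady state gives a constant solution. -/
theorem IsSteadyState.isSolution {K : ℕ} {H : Op N} {C : Matrix (Fin K) (Fin N ⊕ Fin N) ℂ}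
    {ρ : Op N} (h : IsSteadyState H C ρ) : IsSolution H C fun _ => ρ := by
  obtain ⟨hd, h0⟩ := h
  obtain ⟨K, hK⟩ := id hd.1
  refine ⟨fun _ => K, fun _ => 0, fun t _ => ⟨hd, hK, ?_, ?_⟩⟩
  · rw [h0]; exact HasKernel.zero
  · simp only [hasDerivWithinAt_iff_hasFDerivWithinAt]
    refine HasFDerivWithinAt.of_isLittleOTVS ?_
    simp only [sub_self, ContinuousLinearMap.toSpanSingleton_zero, zero_apply]
    exact Asymptotics.IsLittleOTVS.zero (𝕜 := ℝ) (E := Kernel N) (fun x : ℝ => x - t) _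

theorem map_ofReal_mul (A B : Matrix (Fin N) (Fin N) ℝ) :
    (A * B).map Complex.ofReal = A.map Complex.ofReal * B.map Complex.ofReal :=
  Matrix.map_mul (f := Complex.ofRealHom)

theorem map_ofReal_one : (1 : Matrix (Fin N) (Fin N) ℝ).map Complex.ofReal = 1 :=
  Matrix.map_one Complex.ofReal (by simp) (by simp)

namespace Drives

variable {Z : Matrix (Fin N) (Fin N) ℂ} {R : Matrix (Fin N) (Fin N) ℝ} {l : Fin N} {z : ℂ}

theorem star_coupling (Z : Matrix (Fin N) (Fin N) ℂ) (l : Fin N) :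
    linOp (star (annVec Z (Pi.single l 1))) = ann (Z.map conj) (Pi.single l 1) := by
  rw [star_annVec, ann_eq]
  congr 2
  ext j; by_cases hj : j = l
  · subst hj; simp
  · simp [hj]

theorem exists_kill (h : Drives Z R l z) :
    ∃ L : List ℂ, (∀ μ ∈ L, μ.re < 0) ∧ ∀ v, killList (drift R l z.im Z) L v = 0 := by
  obtain ⟨L, h1, h2⟩ := exists_killList (drift R l z.im Z)
  refine ⟨L, fun μ hμ => ?_, h2⟩
  obtain ⟨v, hv⟩ := (h1 μ hμ).exists_hasEigenvector
  exact h.drift_hurwitz hv.2 hv.apply_eq_smul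

theorem exists_kill_conj (h : Drives Z R l z) :
    ∃ L : List ℂ, (∀ μ ∈ L, μ.re < 0) ∧ ∀ v, killList (drift R l z.im (Z.map conj)) L v = 0 := by
  obtain ⟨L, h1, h2⟩ := exists_killList (drift R l z.im (Z.map conj))
  refine ⟨L, fun μ hμ => ?_, h2⟩
  obtain ⟨v, hv⟩ := (h1 μ hμ).exists_hasEigenvector
  exact h.drift_hurwitz_conj hv.2 hv.apply_eq_smul

section
variable {ρ : ℝ → Op N}

theorem tendsto_ann (h : Drives Z R l z)
    (hρ : IsSolution (hamOp R) (fun _ : Fin 1 => annVec Z (Pi.single l 1)) ρ) (v : Fin N → ℂ) :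
    Tendsto (fun t => expectation (ρ t) (annObs Z v)) atTop (𝓝 0) := by
  obtain ⟨L, h1, h2⟩ := h.exists_kill
  refine tendsto_zero_linear (drift R l z.im Z) (fun t => expectation (ρ t) ∘ₗ annObs Z)
    (fun v t ht => ?_) L h1 v (h2 v)
  refine hρ.hasDerivWithinAt_expectation (hamOp_mem R) (annObs Z v) (annObs Z _) ?_ ht
  rw [star_coupling]
  exact h.lindDual_ann v

theorem tendsto_ann_conj (h : Drives Z R l z)
    (hρ : IsSolution (hamOp R) (fun _ : Fin 1 => annVec Z (Pi.single l 1)) ρ) (v : Fin N → ℂ) :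
    Tendsto (fun t => expectation (ρ t) (annObs (Z.map conj) v)) atTop (𝓝 0) := by
  obtain ⟨L, h1, h2⟩ := h.exists_kill_conj
  refine tendsto_zero_linear (drift R l z.im (Z.map conj))
    (fun t => expectation (ρ t) ∘ₗ annObs (Z.map conj)) (fun v t ht => ?_) L h1 v (h2 v)
  refine hρ.hasDerivWithinAt_expectation (hamOp_mem R) (annObs _ v) (annObs _ _) ?_ ht
  rw [star_coupling]
  exact h.lindDual_ann_conj v

/-- Second moments decay whenever the two factors satisfy linear Heisenberg equations without a
cross term, that is, in normal order. -/
theorem tendsto_secondMoment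
    (hρ : IsSolution (hamOp R) (fun _ : Fin 1 => annVec Z (Pi.single l 1)) ρ)
    {W W' : Matrix (Fin N) (Fin N) ℂ}
    (hW : ∀ v, lindDual (hamOp R) (ann Z (Pi.single l 1)) (ann (Z.map conj) (Pi.single l 1))
      (ann W v) = ann W (drift R l z.im W v))
    (hW' : ∀ v, lindDual (hamOp R) (ann Z (Pi.single l 1)) (ann (Z.map conj) (Pi.single l 1))
      (ann W' v) = ann W' (drift R l z.im W' v))
    (hk : ∃ L : List ℂ, (∀ μ ∈ L, μ.re < 0) ∧ ∀ v, killList (drift R l z.im W) L v = 0)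
    (hk' : ∃ L : List ℂ, (∀ μ ∈ L, μ.re < 0) ∧ ∀ v, killList (drift R l z.im W') L v = 0)
    (hcross : ∀ v w, (ann (Z.map conj) (Pi.single l 1) * ann W v
      - ann W v * ann (Z.map conj) (Pi.single l 1)) *
      (ann W' w * ann Z (Pi.single l 1) - ann Z (Pi.single l 1) * ann W' w) = 0)
    (v w : Fin N → ℂ) :
    Tendsto (fun t => secondMoment (ρ t) W W' v w) atTop (𝓝 0) := by
  obtain ⟨L, h1, h2⟩ := hk
  obtain ⟨L', h1', h2'⟩ := hk'
  refine tendsto_zero_bilinear (drift R l z.im W) (drift R l z.im W')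
    (fun t => secondMoment (ρ t) W W') (fun v w t ht => ?_) L L' h1 h1' v w (h2 v) (h2' w)
  have := hρ.hasDerivWithinAt_expectation (hamOp_mem R) (annObs W v * annObs W' w)
    (annObs W (drift R l z.im W v) * annObs W' w + annObs W v * annObs W' (drift R l z.im W' w))
    (by
      rw [star_coupling]
      change lindDual (hamOp R) (ann Z (Pi.single l 1)) _ (ann W v * ann W' w) = _
      rw [lindDual_mul, hW, hW', hcross, add_zero]
      rfl) ht
  simpa [secondMoment_apply] using this

theorem tendsto_ann_ann (h : Drives Z R l z)
    (hρ : IsSolution (hamOp R) (fun _ : Fin 1 => annVec Z (Pi.single l 1)) ρ)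
    (v w : Fin N → ℂ) : Tendsto (fun t => secondMoment (ρ t) Z Z v w) atTop (𝓝 0) :=
  tendsto_secondMoment hρ h.lindDual_ann h.lindDual_ann h.exists_kill h.exists_kill
    (fun v w => by rw [ann_commute h.graph.1 w, sub_self, mul_zero]) v w

theorem tendsto_conj_ann (h : Drives Z R l z)
    (hρ : IsSolution (hamOp R) (fun _ : Fin 1 => annVec Z (Pi.single l 1)) ρ)
    (v w : Fin N → ℂ) : Tendsto (fun t => secondMoment (ρ t) (Z.map conj) Z v w) atTop (𝓝 0) :=
  tendsto_secondMoment hρ h.lindDual_ann_conj h.lindDual_ann h.exists_kill_conj h.exists_kill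
    (fun v w => by rw [ann_commute h.graph.1 w, sub_self, mul_zero]) v w

theorem tendsto_conj_conj (h : Drives Z R l z)
    (hρ : IsSolution (hamOp R) (fun _ : Fin 1 => annVec Z (Pi.single l 1)) ρ)
    (v w : Fin N → ℂ) :
    Tendsto (fun t => secondMoment (ρ t) (Z.map conj) (Z.map conj) v w) atTop (𝓝 0) :=
  tendsto_secondMoment hρ h.lindDual_ann_conj h.lindDual_ann_conj h.exists_kill_conj
    h.exists_kill_conj
    (fun v w => by
      rw [ann_commute (isGraphMatrix_map_conj_symm h.graph.1) _ v, sub_self, zero_mul]) v w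

/-- In antinormal order the commutator contributes the vacuum fluctuations. -/
theorem tendsto_ann_conj' (h : Drives Z R l z)
    (hρ : IsSolution (hamOp R) (fun _ : Fin 1 => annVec Z (Pi.single l 1)) ρ)
    (v w : Fin N → ℂ) :
    Tendsto (fun t => secondMoment (ρ t) Z (Z.map conj) v w) atTop
      (𝓝 (2 * (v ⬝ᵥ (Z.map Complex.im).map Complex.ofReal *ᵥ w))) := by
  have hc : annObs Z v * annObs (Z.map conj) w = annObs (Z.map conj) w * annObs Z v
      + (2 * (v ⬝ᵥ (Z.map Complex.im).map Complex.ofReal *ᵥ w)) • 1 := by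
    apply Subtype.ext
    have h1 := commutator_ann (Z := Z.map conj) h.graph.1 v w
    rw [sub_eq_iff_eq_add'] at h1
    refine h1.trans ?_
    change _ = ann (Z.map conj) w * ann Z v + _ • (1 : Op N)
    congr 2
    rw [← neg_sub, sub_map_conj, Matrix.neg_mulVec, Matrix.smul_mulVec, dotProduct_neg,
      dotProduct_smul, smul_eq_mul]
    linear_combination (-2 * (v ⬝ᵥ (Z.map Complex.im).map Complex.ofReal *ᵥ w)) * Complex.I_mul_I
  have h2 := (h.tendsto_conj_ann hρ w v).add_const
    (2 * (v ⬝ᵥ (Z.map Complex.im).map Complex.ofReal *ᵥ w))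
  rw [zero_add] at h2
  refine h2.congr' ?_
  filter_upwards [eventually_ge_atTop (0 : ℝ)] with t ht
  rw [secondMoment_apply, secondMoment_apply, hc, map_add, map_smul,
    expectation_one (hρ.isDensityOperator ht), smul_eq_mul, mul_one]

end

/-! ### Uniqueness of the steady state -/

/-- A positive operator with `a ρ a* = 0` for all annihilation operators is a multiple of the
Gaussian state. -/
theorem _root_.LinQuantum.IsPositiveOp.eq_smul_gaussState (hZ : IsGraphMatrix Z) {ρ : Op N}
    (hpos : IsPositiveOp ρ)
    (h0 : ∀ v : Fin N → ℂ, ann Z v * ρ * ann (Z.map conj) (star v) = 0) :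
    ∃ k : ℂ, ρ = k • gaussState hZ := by
  have hzz : (Z.map conj).map conj = Z := by ext i j; simp
  have hadj : ∀ (v : Fin N → ℂ) (φ χ : Wave N),
      ip φ (ann Z v χ) = ip (ann (Z.map conj) (star v) φ) χ := fun v => ip_ann Z v
  have h1 : ∀ (v : Fin N → ℂ) (φ : Wave N), ρ (ann (Z.map conj) (star v) φ) = 0 := by
    intro v φ
    apply hpos.apply_eq_zero
    rw [← hadj]
    have := congrArg (fun A : Op N => ip φ (A φ)) (h0 v)
    simpa using this
  have h2 : ∀ (v : Fin N → ℂ) (u : Wave N), ann Z v (ρ u) = 0 := by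
    intro v u
    apply eq_zero_of_ip_self
    rw [hadj, ← hpos.conj_symm, h1, map_zero, map_zero]
  have h3 : ∀ u, ρ u = (ρ u 0) • gauss hZ := fun u => eq_smul_gauss hZ fun v => h2 v u
  refine ⟨conj (ρ (gauss hZ) 0), ?_⟩
  ext1 u
  have h4 : ip (gauss hZ) (ρ u) = ρ u 0 * ip (gauss hZ) (gauss hZ) := by
    conv_lhs => rw [h3 u, map_smul, smul_eq_mul]
  have h5 : ip (gauss hZ) (ρ u) = conj (ρ (gauss hZ) 0) * ip (gauss hZ) u := by
    rw [← hpos.conj_symm, h3 (gauss hZ), map_smul, smul_eq_mul, map_mul, conj_ip, smul_apply,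
      gauss_zero, smul_eq_mul, mul_one]
  rw [h4] at h5
  rw [LinearMap.smul_apply, gaussState_apply, smul_smul]
  conv_lhs => rw [h3 u]
  congr 1
  have hn := ip_gauss_ne_zero hZ
  field_simp
  linear_combination h5

/-- A steady state is a constant solution, so its normally ordered second moments vanish. Hence
`a ρ a*`, a positive operator of trace zero, is zero for every annihilation operator `a`. -/
theorem steadyState_unique (h : Drives Z R l z) {ρ : Op N}
    (hρ : IsSteadyState (hamOp R) (fun _ : Fin 1 => annVec Z (Pi.single l 1)) ρ) :
    ρ = gaussState h.graph := by
  have hd := hρ.1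
  have hpos : IsPositiveOp ρ := hd.2.1
  have hmom : ∀ v w, opTrace (ann (Z.map conj) v * ann Z w * ρ) = 0 := by
    intro v w
    have h1 := h.tendsto_conj_ann hρ.isSolution v w
    have h2 := tendsto_nhds_unique h1 tendsto_const_nhds
    rw [secondMoment_apply, expectation_apply hd.1] at h2
    exact h2.symm
  have h0 : ∀ v : Fin N → ℂ, ann Z v * ρ * ann (Z.map conj) (star v) = 0 := by
    intro v
    have hmem := mul_mem_kernelOps (ann_mem Z v) hd.1
    refine IsPositiveOp.eq_zero_of_opTrace (fun φ => ?_)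
      (mem_kernelOps_mul (ann_mem _ _) hmem) ?_
    · rw [Module.End.mul_apply, Module.End.mul_apply, ip_ann]
      exact hpos _
    · rw [← opTrace_mul_comm (ann_mem _ _) hmem, ← mul_assoc]
      exact hmom _ _
  obtain ⟨k, hk⟩ := hpos.eq_smul_gaussState h.graph h0
  have ht := hd.2.2
  have hg := isDensityOperator_gaussState h.graph
  rw [hk, opTrace_smul hg.1, hg.2.2, mul_one] at ht
  rw [hk, ht, one_smul]

theorem isSteadyState_gaussState (h : Drives Z R l z) :
    IsSteadyState (hamOp R) (fun _ : Fin 1 => annVec Z (Pi.single l 1)) (gaussState h.graph) := by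
  refine ⟨isDensityOperator_gaussState h.graph, ?_⟩
  rw [lindbladian_eq_lind]
  have hL : linOp (annVec Z (Pi.single l 1)) (gauss h.graph) = 0 := ann_gauss h.graph _
  have h1 := mul_gaussState h.graph hL
  have h2 := gaussState_mul_linOp_star h.graph hL
  obtain ⟨E, hE⟩ := (hamOp_gauss_iff h.graph h.symm).2 h.ricc
  -- `E` is real because the Hamiltonian is symmetric
  have hEr : conj E = E := by
    have := ip_hamOp (R := R) (gauss h.graph) (gauss h.graph)
    rw [hE, map_smul, map_smulₛₗ, LinearMap.smul_apply] at this
    exact (mul_right_cancel₀ (ip_gauss_ne_zero h.graph) this).symm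
  have h3 : hamOp R * gaussState h.graph = gaussState h.graph * hamOp R := by
    ext1 φ
    rw [Module.End.mul_apply, Module.End.mul_apply, gaussState_apply, gaussState_apply, map_smul,
      hE, ip_hamOp, hE, map_smulₛₗ, LinearMap.smul_apply, hEr, smul_smul]
    congr 1
    rw [smul_eq_mul]; ring
  rw [lind, h1, mul_assoc _ (linOp _) (gaussState h.graph), h1, ← mul_assoc (gaussState h.graph),
    h2, h3]
  simp

/-! ### The limit of the covariance matrix -/

/-- The columns of `[1, W]`. -/
def quadCol (W : Matrix (Fin N) (Fin N) ℂ) : Fin N ⊕ Fin N → Fin N → ℂ :=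
  Sum.elim (fun j => Pi.single j 1) (fun j => W *ᵥ Pi.single j 1)

/-- The inverse of `Im Z`, as a complex matrix. -/
def invIm (Z : Matrix (Fin N) (Fin N) ℂ) : Matrix (Fin N) (Fin N) ℂ :=
  (Z.map Complex.im)⁻¹.map Complex.ofReal

theorem invIm_mul (hZ : IsGraphMatrix Z) : invIm Z * (Z.map Complex.im).map Complex.ofReal = 1 := by
  rw [invIm, ← map_ofReal_mul, Matrix.nonsing_inv_mul _ hZ.2.det_pos.ne'.isUnit, map_ofReal_one]

theorem mul_invIm (hZ : IsGraphMatrix Z) : (Z.map Complex.im).map Complex.ofReal * invIm Z = 1 := by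
  rw [invIm, ← map_ofReal_mul, Matrix.mul_nonsing_inv _ hZ.2.det_pos.ne'.isUnit, map_ofReal_one]

theorem invIm_symm (hZ : IsGraphMatrix Z) : (invIm Z)ᵀ = invIm Z := by
  have hs : (Z.map Complex.im)ᵀ = Z.map Complex.im := by ext i j; simp [hZ.1.apply i j]
  rw [invIm, ← Matrix.transpose_map, Matrix.transpose_nonsing_inv, hs]

/-- Positions and momenta in terms of annihilation and creation operators. -/
theorem quad_decomposition (hZ : IsGraphMatrix Z) (a : Fin N ⊕ Fin N) :
    (quadOp a : Op N) =
      ann (Z.map conj) ((2 * Complex.I)⁻¹ • (invIm Z *ᵥ quadCol Z a))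
      + ann Z (-((2 * Complex.I)⁻¹ • (invIm Z *ᵥ quadCol (Z.map conj) a))) := by
  set Yc := (Z.map Complex.im).map Complex.ofReal with hYc
  set Zb := Z.map conj with hZb
  have hsub : Z - Zb = (2 * Complex.I) • Yc := sub_map_conj Z
  have hI : (2 * Complex.I) ≠ 0 := by simp
  have hswap : Z * invIm Z * Zb = Zb * invIm Z * Z := by
    have e1 : Z * invIm Z = Zb * invIm Z + (2 * Complex.I) • 1 := by
      rw [← sub_eq_iff_eq_add', ← sub_mul, hsub, smul_mul_assoc, mul_invIm hZ]
    have e2 : invIm Z * Z = invIm Z * Zb + (2 * Complex.I) • 1 := by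
      rw [← sub_eq_iff_eq_add', ← mul_sub, hsub, mul_smul_comm, invIm_mul hZ]
    rw [e1, mul_assoc, e2, add_mul, mul_add, mul_smul_comm, mul_one, smul_mul_assoc, one_mul,
      mul_assoc]
  rw [← linOp_single, ann_eq, ann_eq, ← linOp_add]
  congr 1
  have hvec : ∀ v : Fin N → ℂ, (2 * Complex.I)⁻¹ • (Z *ᵥ v) - (2 * Complex.I)⁻¹ • (Zb *ᵥ v)
      = Yc *ᵥ v := by
    intro v
    rw [← smul_sub, ← Matrix.sub_mulVec, hsub, Matrix.smul_mulVec, smul_smul,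
      inv_mul_cancel₀ hI, one_smul]
  rcases a with j | j
  · have h1 : quadCol Z (Sum.inl j) = Pi.single j 1 := rfl
    have h2 : quadCol Zb (Sum.inl j) = Pi.single j 1 := rfl
    have h3 := hvec (invIm Z *ᵥ Pi.single j 1)
    rw [Matrix.mulVec_mulVec _ Yc, mul_invIm hZ, Matrix.one_mulVec] at h3
    ext (i | i)
    · have h4 := congrFun h3 i
      simp only [annVec_apply, h1, h2, Pi.add_apply, Sum.elim_inl, Matrix.mulVec_neg,
        Matrix.mulVec_smul, Pi.neg_apply, Pi.sub_apply, neg_neg] at h4 ⊢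
      rw [Pi.single_apply] at h4 ⊢
      simp only [Sum.inl.injEq]
      rw [← h4]; ring
    · simp [annVec_apply, h1, h2]
  · have h1 : quadCol Z (Sum.inr j) = Z *ᵥ Pi.single j 1 := rfl
    have h2 : quadCol Zb (Sum.inr j) = Zb *ᵥ Pi.single j 1 := rfl
    ext (i | i)
    · have h4 : (Z *ᵥ (invIm Z *ᵥ (Zb *ᵥ Pi.single j (1 : ℂ))))
          = (Zb *ᵥ (invIm Z *ᵥ (Z *ᵥ Pi.single j (1 : ℂ)))) := by
        rw [Matrix.mulVec_mulVec, Matrix.mulVec_mulVec, Matrix.mulVec_mulVec,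
          Matrix.mulVec_mulVec, hswap]
      simp only [annVec_apply, h1, h2, Pi.add_apply, Sum.elim_inl, Matrix.mulVec_neg,
        Matrix.mulVec_smul, Pi.neg_apply, neg_neg, h4]
      simp
    · have h4 : (2 * Complex.I)⁻¹ • (invIm Z *ᵥ (Z *ᵥ Pi.single j (1 : ℂ)))
          - (2 * Complex.I)⁻¹ • (invIm Z *ᵥ (Zb *ᵥ Pi.single j (1 : ℂ))) = Pi.single j 1 := by
        rw [← Matrix.mulVec_smul (invIm Z), ← Matrix.mulVec_smul (invIm Z), ← Matrix.mulVec_sub,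
          hvec, Matrix.mulVec_mulVec, invIm_mul hZ, Matrix.one_mulVec]
      have h5 := congrFun h4 i
      simp only [annVec_apply, h1, h2, Pi.add_apply, Sum.elim_inr, Pi.neg_apply,
        Pi.sub_apply] at h5 ⊢
      rw [Pi.single_apply] at h5 ⊢
      simp only [Sum.inr.injEq]
      rw [← h5]; ring

/-- `quadOp` with values in the algebra of observables. -/
def _root_.LinQuantum.quadObs (a : Fin N ⊕ Fin N) : observables N := ⟨quadOp a, quadOp_mem a⟩

theorem quadObs_eq (hZ : IsGraphMatrix Z) (a : Fin N ⊕ Fin N) : quadObs a =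
      annObs (Z.map conj) ((2 * Complex.I)⁻¹ • (invIm Z *ᵥ quadCol Z a))
      + annObs Z (-((2 * Complex.I)⁻¹ • (invIm Z *ᵥ quadCol (Z.map conj) a))) :=
  Subtype.ext (quad_decomposition hZ a)

theorem mean_eq {ρ : Op N} (h : IsDensityOperator ρ) (a : Fin N ⊕ Fin N) :
    mean ρ a = expectation ρ (quadObs a) := by
  rw [expectation_apply h.1]; rfl

theorem cov_eq {ρ : Op N} (h : IsDensityOperator ρ) (a b : Fin N ⊕ Fin N) :
    cov ρ a b = (1 / 2 : ℂ) * (expectation ρ (quadObs a * quadObs b)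
      + expectation ρ (quadObs b * quadObs a)) - mean ρ a * mean ρ b := by
  have h1 : cov ρ a b = (1 / 2 : ℂ) * expectation ρ
      ((quadObs a - mean ρ a • 1) * (quadObs b - mean ρ b • 1)
        + (quadObs b - mean ρ b • 1) * (quadObs a - mean ρ a • 1)) := by
    rw [expectation_apply h.1]; rfl
  have h2 : (quadObs a - mean ρ a • 1) * (quadObs b - mean ρ b • 1)
        + (quadObs b - mean ρ b • 1) * (quadObs a - mean ρ a • 1)
      = quadObs a * quadObs b + quadObs b * quadObs a - (2 * mean ρ a) • quadObs b
        - (2 * mean ρ b) • quadObs a + (2 * mean ρ a * mean ρ b) • (1 : observables N) := by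
    simp only [sub_mul, mul_sub, smul_mul_assoc, mul_smul_comm, one_mul, mul_one, smul_smul,
      smul_sub, two_mul, add_smul, add_mul, mul_comm (mean ρ b) (mean ρ a)]
    abel
  rw [h1, h2]
  simp only [map_add, map_sub, map_smul, smul_eq_mul, expectation_one h, mean_eq h]
  ring

section
variable {ρ : ℝ → Op N}

theorem tendsto_mean (h : Drives Z R l z)
    (hρ : IsSolution (hamOp R) (fun _ : Fin 1 => annVec Z (Pi.single l 1)) ρ)
    (a : Fin N ⊕ Fin N) : Tendsto (fun t => mean (ρ t) a) atTop (𝓝 0) := by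
  have h1 := (h.tendsto_ann_conj hρ ((2 * Complex.I)⁻¹ • (invIm Z *ᵥ quadCol Z a))).add
    (h.tendsto_ann hρ (-((2 * Complex.I)⁻¹ • (invIm Z *ᵥ quadCol (Z.map conj) a))))
  rw [zero_add] at h1
  refine h1.congr' ?_
  filter_upwards [eventually_ge_atTop (0 : ℝ)] with t ht
  rw [mean_eq (hρ.isDensityOperator ht), quadObs_eq h.graph, map_add]

/-- Only the antinormally ordered part contributes to the limit, through its commutator. -/
theorem tendsto_quad_quad (h : Drives Z R l z)
    (hρ : IsSolution (hamOp R) (fun _ : Fin 1 => annVec Z (Pi.single l 1)) ρ)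
    (a b : Fin N ⊕ Fin N) :
    Tendsto (fun t => expectation (ρ t) (quadObs a * quadObs b)) atTop
      (𝓝 ((1 / 2 : ℂ) * (quadCol (Z.map conj) a ⬝ᵥ (invIm Z *ᵥ quadCol Z b)))) := by
  set sa := (2 * Complex.I)⁻¹ • (invIm Z *ᵥ quadCol Z a) with hsa
  set sb := (2 * Complex.I)⁻¹ • (invIm Z *ᵥ quadCol Z b) with hsb
  set ta := -((2 * Complex.I)⁻¹ • (invIm Z *ᵥ quadCol (Z.map conj) a)) with hta
  set tb := -((2 * Complex.I)⁻¹ • (invIm Z *ᵥ quadCol (Z.map conj) b)) with htb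
  have h1 := (((h.tendsto_conj_conj hρ sa sb).add (h.tendsto_conj_ann hρ sa tb)).add
    (h.tendsto_ann_conj' hρ ta sb)).add (h.tendsto_ann_ann hρ ta tb)
  have hlim : (0 : ℂ) + 0 + 2 * (ta ⬝ᵥ (Z.map Complex.im).map Complex.ofReal *ᵥ sb) + 0
      = (1 / 2 : ℂ) * (quadCol (Z.map conj) a ⬝ᵥ (invIm Z *ᵥ quadCol Z b)) := by
    have e1 : (Z.map Complex.im).map Complex.ofReal *ᵥ sb
        = (2 * Complex.I)⁻¹ • quadCol Z b := by
      rw [hsb, Matrix.mulVec_smul, Matrix.mulVec_mulVec, mul_invIm h.graph, Matrix.one_mulVec]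
    have e2 : (invIm Z *ᵥ quadCol (Z.map conj) a) ⬝ᵥ quadCol Z b
        = quadCol (Z.map conj) a ⬝ᵥ (invIm Z *ᵥ quadCol Z b) := by
      rw [Matrix.dotProduct_mulVec, ← Matrix.mulVec_transpose, invIm_symm h.graph]
    have e3 : (2 * Complex.I)⁻¹ * (2 * Complex.I)⁻¹ = -(1 / 4 : ℂ) := by
      rw [← mul_inv, show (2 * Complex.I) * (2 * Complex.I) = 4 * (Complex.I * Complex.I) by ring,
        Complex.I_mul_I]
      norm_num
    rw [e1, hta, neg_dotProduct, smul_dotProduct, dotProduct_smul, e2, smul_eq_mul, smul_eq_mul]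
    linear_combination
      (-2 * (quadCol (Z.map conj) a ⬝ᵥ (invIm Z *ᵥ quadCol Z b))) * e3
  rw [hlim] at h1
  refine h1.congr fun t => ?_
  simp only [secondMoment_apply]
  rw [quadObs_eq h.graph a, quadObs_eq h.graph b, mul_add, add_mul, add_mul, map_add, map_add,
    map_add]
  ring

/-- The covariance matrix of the Gaussian state is the symmetrization of
`½ [1, Z̄]ᵀ (Im Z)⁻¹ [1, Z]`. -/
theorem graphCov_eq (hZ : IsGraphMatrix Z) (a b : Fin N ⊕ Fin N) :
    ((graphCov Z a b : ℝ) : ℂ) = (1 / 2 : ℂ) *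
      ((1 / 2 : ℂ) * (quadCol (Z.map conj) a ⬝ᵥ (invIm Z *ᵥ quadCol Z b))
      + (1 / 2 : ℂ) * (quadCol (Z.map conj) b ⬝ᵥ (invIm Z *ᵥ quadCol Z a))) := by
  set Yi := invIm Z with hYi
  set Yc := (Z.map Complex.im).map Complex.ofReal with hYc
  set Xc := (Z.map Complex.re).map Complex.ofReal with hXc
  set Zb := Z.map conj with hZb
  have hZ1 : Z = Xc + Complex.I • Yc := by
    ext i j; simp [hXc, hYc, mul_comm Complex.I]
  have hZ2 : Zb = Xc - Complex.I • Yc := by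
    ext i j
    apply Complex.ext <;> simp [hXc, hYc, hZb]
  have hYs := invIm_symm hZ
  have hZbs : Zbᵀ = Zb := (isGraphMatrix_map_conj_symm hZ.1).eq
  have hZs : Zᵀ = Z := hZ.1.eq
  have hentry : ∀ (M : Matrix (Fin N) (Fin N) ℂ) (j k : Fin N),
      Pi.single j (1 : ℂ) ⬝ᵥ (M *ᵥ Pi.single k 1) = M j k := by
    intro M j k; simp
  -- the four blocks of `[1, Z̄]ᵀ Y⁻¹ [1, Z]`
  have hqq : ∀ j k, quadCol Zb (.inl j) ⬝ᵥ (Yi *ᵥ quadCol Z (.inl k)) = Yi j k :=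
    fun j k => hentry _ _ _
  have hqp : ∀ j k, quadCol Zb (.inl j) ⬝ᵥ (Yi *ᵥ quadCol Z (.inr k)) = (Yi * Z) j k := by
    intro j k
    rw [← hentry (Yi * Z) j k, ← Matrix.mulVec_mulVec]; rfl
  have hmv : ∀ (j : Fin N) (u : Fin N → ℂ), (Zb *ᵥ Pi.single j 1) ⬝ᵥ u
      = Pi.single j 1 ⬝ᵥ (Zb *ᵥ u) := by
    intro j u
    rw [Matrix.dotProduct_mulVec, ← Matrix.mulVec_transpose, hZbs]
  have hpq : ∀ j k, quadCol Zb (.inr j) ⬝ᵥ (Yi *ᵥ quadCol Z (.inl k)) = (Zb * Yi) j k := by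
    intro j k
    rw [← hentry (Zb * Yi) j k, ← Matrix.mulVec_mulVec, ← hmv]; rfl
  have hpp : ∀ j k, quadCol Zb (.inr j) ⬝ᵥ (Yi *ᵥ quadCol Z (.inr k)) = (Zb * Yi * Z) j k := by
    intro j k
    rw [← hentry (Zb * Yi * Z) j k, ← Matrix.mulVec_mulVec, ← Matrix.mulVec_mulVec, ← hmv]; rfl
  have hswap : ∀ (M : Matrix (Fin N) (Fin N) ℂ) (j k : Fin N), M k j = Mᵀ j k := fun _ _ _ => rfl
  have hYY : Yi * Yc = 1 := invIm_mul hZ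
  have hYY' : Yc * Yi = 1 := mul_invIm hZ
  have hcast : ∀ (M : Matrix (Fin N) (Fin N) ℝ) (j k : Fin N),
      ((M j k : ℝ) : ℂ) = (M.map Complex.ofReal) j k := fun _ _ _ => rfl
  have hYiZ : Yi * Z = Yi * Xc + Complex.I • 1 := by
    rw [hZ1, mul_add, mul_smul_comm, hYY]
  have hYiZb : Yi * Zb = Yi * Xc - Complex.I • 1 := by
    rw [hZ2, mul_sub, mul_smul_comm, hYY]
  have hZYi : Z * Yi = Xc * Yi + Complex.I • 1 := by
    rw [hZ1, add_mul, smul_mul_assoc, hYY']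
  have hZbYi : Zb * Yi = Xc * Yi - Complex.I • 1 := by
    rw [hZ2, sub_mul, smul_mul_assoc, hYY']
  have hZYZ : Zb * Yi * Z = Xc * Yi * Xc + Yc := by
    rw [hZbYi, hZ1, sub_mul, mul_add, mul_smul_comm, mul_assoc, mul_assoc, hYY, smul_mul_assoc,
      one_mul, mul_one, smul_add, smul_smul, Complex.I_mul_I]
    module
  have hZYZ' : Z * Yi * Zb = Xc * Yi * Xc + Yc := by
    rw [hZYi, hZ2, add_mul, mul_sub, mul_smul_comm, mul_assoc, mul_assoc, hYY, smul_mul_assoc,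
      one_mul, mul_one, smul_sub, smul_smul, Complex.I_mul_I]
    module
  rcases a with j | j <;> rcases b with k | k
  · rw [hqq, hqq, hswap Yi j k, hYs]
    simp only [graphCov, Matrix.smul_apply, Matrix.fromBlocks_apply₁₁, smul_eq_mul,
      Complex.ofReal_mul, hcast]
    rw [← invIm, ← hYi]
    push_cast; ring
  · rw [hqp, hpq, hswap (Zb * Yi) j k, Matrix.transpose_mul, hYs, hZbs, hYiZ, hYiZb]
    simp only [graphCov, Matrix.smul_apply, Matrix.fromBlocks_apply₁₂, smul_eq_mul,
      Complex.ofReal_mul, hcast, map_ofReal_mul, Matrix.add_apply, Matrix.sub_apply]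
    rw [← invIm, ← hYi, ← hXc]
    push_cast; ring
  · rw [hpq, hqp, hswap (Yi * Z) j k, Matrix.transpose_mul, hYs, hZs, hZYi, hZbYi]
    simp only [graphCov, Matrix.smul_apply, Matrix.fromBlocks_apply₂₁, smul_eq_mul,
      Complex.ofReal_mul, hcast, map_ofReal_mul, Matrix.add_apply, Matrix.sub_apply]
    rw [← invIm, ← hYi, ← hXc]
    push_cast; ring
  · rw [hpp, hpp, hswap (Zb * Yi * Z) j k, Matrix.transpose_mul, Matrix.transpose_mul, hYs, hZs,
      hZbs, ← mul_assoc, hZYZ, hZYZ']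
    simp only [graphCov, Matrix.smul_apply, Matrix.fromBlocks_apply₂₂, smul_eq_mul,
      Complex.ofReal_mul, Matrix.add_apply, Complex.ofReal_add]
    rw [hcast, hcast, map_ofReal_mul, map_ofReal_mul, ← invIm, ← hYi, ← hXc, ← hYc]
    push_cast; ring

theorem tendsto_cov (h : Drives Z R l z)
    (hρ : IsSolution (hamOp R) (fun _ : Fin 1 => annVec Z (Pi.single l 1)) ρ)
    (a b : Fin N ⊕ Fin N) :
    Tendsto (fun t => cov (ρ t) a b) atTop (𝓝 ((graphCov Z a b : ℝ) : ℂ)) := by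
  have h1 := (((h.tendsto_quad_quad hρ a b).add (h.tendsto_quad_quad hρ b a)).const_mul
    (1 / 2 : ℂ)).sub ((h.tendsto_mean hρ a).mul (h.tendsto_mean hρ b))
  rw [mul_zero, sub_zero, ← graphCov_eq h.graph] at h1
  refine h1.congr' ?_
  filter_upwards [eventually_ge_atTop (0 : ℝ)] with t ht
  rw [cov_eq (hρ.isDensityOperator ht)]

end

theorem generates (h : Drives Z R l z) :
    Generates (hamOp R) (fun _ : Fin 1 => annVec Z (Pi.single l 1)) Z :=
  ⟨⟨gaussState h.graph, (isPureGaussianState_iff h.graph).2 rfl, h.isSteadyState_gaussState,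
    fun _ hρ' => h.steadyState_unique hρ'⟩,
    fun _ hρ => ⟨fun a => h.tendsto_mean hρ a, fun a b => h.tendsto_cov hρ a b⟩⟩

theorem canBeGenerated (h : Drives Z R l z) : CanBeGenerated Z := by
  refine ⟨_, _, isPassiveHamiltonian_iff.2 ⟨R, h.symm, rfl⟩, ⟨-z, 1, l, ?_⟩, h.generates⟩
  funext k
  ext (j | j)
  · have : Z j l = Z l j := h.graph.1.apply l j
    by_cases hj : j = l
    · subst hj; simp [annVec_apply, h.row]
    · simp [annVec_apply, this, h.row, hj]
  · simp [annVec_apply]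

end Drives

/-! ### The spectrum of the graph matrix along the Krylov basis -/

/-- The alternating sequence `z, -1/z, z, -1/z, …`. -/
def alternating (z : ℂ) (k : ℕ) : ℂ := if Even k then z else -1 / z

theorem alternating_zero (z : ℂ) : alternating z 0 = z := by simp [alternating]

theorem alternating_ne_zero {z : ℂ} (hz : z ≠ 0) (k : ℕ) : alternating z k ≠ 0 := by
  rw [alternating]; split_ifs <;> simp [hz]

theorem alternating_mul_succ {z : ℂ} (hz : z ≠ 0) (k : ℕ) :
    alternating z k * alternating z (k + 1) = -1 := by
  rw [alternating, alternating]
  by_cases hk : Even k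
  · rw [if_pos hk, if_neg (by simpa [Nat.even_add_one] using hk)]; field_simp
  · rw [if_neg hk, if_pos (by simpa [Nat.even_add_one] using hk)]; field_simp

theorem alternating_add_two (z : ℂ) (k : ℕ) : alternating z (k + 2) = alternating z k := by
  simp [alternating, Nat.even_add]

/-- The complexification of a real vector. -/
def complexify (v : EuclideanSpace ℝ (Fin N)) : Fin N → ℂ := fun j => ((v j : ℝ) : ℂ)

theorem complexify_dotProduct (v w : EuclideanSpace ℝ (Fin N)) :
    complexify v ⬝ᵥ complexify w = ((inner ℝ v w : ℝ) : ℂ) := by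
  simp [complexify, dotProduct, PiLp.inner_apply, mul_comm]

theorem mulVec_complexify (R : Matrix (Fin N) (Fin N) ℝ) (v : EuclideanSpace ℝ (Fin N)) :
    R.map Complex.ofReal *ᵥ complexify v = complexify (WithLp.toLp 2 (R *ᵥ v)) := by
  ext j; simp [complexify, Matrix.mulVec, dotProduct]

/-- The Gram–Schmidt process turns eigenvectors of a complex symmetric matrix into eigenvectors:
two of them are orthogonal already unless they belong to the same eigenvalue. -/
theorem mulVec_gramSchmidt {Z : Matrix (Fin N) (Fin N) ℂ} (hZ : Z.IsSymm)
    {f : Fin N → EuclideanSpace ℝ (Fin N)} {ζ : Fin N → ℂ}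
    (hf : ∀ k, Z *ᵥ complexify (f k) = ζ k • complexify (f k)) (k : Fin N) :
    Z *ᵥ complexify (InnerProductSpace.gramSchmidt ℝ f k)
      = ζ k • complexify (InnerProductSpace.gramSchmidt ℝ f k) := by
  induction k using WellFoundedLT.induction with
  | _ k ih =>
  set g := InnerProductSpace.gramSchmidt ℝ f with hg
  have key : ∀ i < k, ∀ r : ℝ, r = inner ℝ (g i) (f k) / ‖g i‖ ^ 2 →
      Z *ᵥ complexify (r • g i) = ζ k • complexify (r • g i) := by
    intro i hi r hr
    have hs : complexify (r • g i) = (r : ℂ) • complexify (g i) := by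
      ext j; simp [complexify]
    have h1 : ζ i * (complexify (g i) ⬝ᵥ complexify (f k))
        = ζ k * (complexify (g i) ⬝ᵥ complexify (f k)) := by
      rw [← smul_eq_mul, ← smul_dotProduct, ← ih i hi, ← smul_eq_mul (ζ k), ← dotProduct_smul,
        ← hf k, Matrix.dotProduct_mulVec, ← Matrix.mulVec_transpose, hZ.eq]
    rw [complexify_dotProduct] at h1
    rw [hs, Matrix.mulVec_smul, ih i hi, smul_smul, smul_smul]
    congr 1
    rw [hr]; push_cast
    linear_combination (((‖g i‖ : ℝ) : ℂ) ^ 2)⁻¹ * h1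
  have hsum : g k = f k - ∑ i ∈ Finset.Iio k, (inner ℝ (g i) (f k) / ‖g i‖ ^ 2) • g i := by
    rw [eq_sub_iff_add_eq]
    exact (InnerProductSpace.gramSchmidt_def'' ℝ f k).symm
  have hc : complexify (g k) = complexify (f k)
      - ∑ i ∈ Finset.Iio k, complexify ((inner ℝ (g i) (f k) / ‖g i‖ ^ 2) • g i) := by
    rw [hsum]
    ext j; simp [complexify]
  rw [hc, Matrix.mulVec_sub, hf, Matrix.mulVec_sum, smul_sub, Finset.smul_sum]
  congr 1
  exact Finset.sum_congr rfl fun i hi => key i (Finset.mem_Iio.1 hi) _ rfl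

/-- A real symmetric matrix without eigenvectors orthogonal to `e_l` has a simple spectrum, and
`e_l` is a cyclic vector for it. -/
theorem linearIndependent_krylov {R : Matrix (Fin N) (Fin N) ℝ} (hR : R.IsSymm) {l : Fin N}
    (hobs : ∀ (w : Fin N → ℝ) (μ : ℝ), R *ᵥ w = μ • w → w l = 0 → w = 0) :
    LinearIndependent ℝ fun k : Fin N =>
      (WithLp.toLp 2 ((R ^ (k : ℕ)) *ᵥ Pi.single l 1) : EuclideanSpace ℝ (Fin N)) := by
  have hH : R.IsHermitian := by
    rw [Matrix.IsHermitian, Matrix.conjTranspose_eq_transpose_of_trivial]; exact hR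
  set u := hH.eigenvectorBasis with hu
  have hev : ∀ i, R *ᵥ (u i) = hH.eigenvalues i • ⇑(u i) := hH.mulVec_eigenvectorBasis
  have hul : ∀ i, u i l ≠ 0 := by
    intro i h0
    have := hobs _ _ (hev i) h0
    apply u.orthonormal.ne_zero i
    ext j; exact congrFun this j
  have hinj : Function.Injective hH.eigenvalues := by
    intro i j hij
    by_contra hne
    have h1 : R *ᵥ (u j l • ⇑(u i) - u i l • ⇑(u j))
        = hH.eigenvalues i • (u j l • ⇑(u i) - u i l • ⇑(u j)) := by
      rw [Matrix.mulVec_sub, Matrix.mulVec_smul, Matrix.mulVec_smul, hev, hev, ← hij, smul_sub,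
        smul_comm, smul_comm (u i l)]
    have h2 := hobs _ _ h1 (by simp [mul_comm])
    have h3 : u j l • u i - u i l • u j = 0 := by
      ext k; exact congrFun h2 k
    have h4 := congrArg (inner ℝ (u j)) h3
    rw [inner_sub_right, inner_smul_right, inner_smul_right, u.orthonormal.2 (Ne.symm hne),
      inner_zero_right, real_inner_self_eq_norm_sq, u.orthonormal.1 j] at h4
    apply hul i
    linarith
  have hpow : ∀ (i : Fin N) (k : ℕ),
      (⇑(u i)) ⬝ᵥ ((R ^ k) *ᵥ Pi.single l 1) = hH.eigenvalues i ^ k * u i l := by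
    intro i k
    induction k with
    | zero => rw [pow_zero, Matrix.one_mulVec, dotProduct_single, mul_one, pow_zero, one_mul]
    | succ k ih =>
      rw [pow_succ', ← Matrix.mulVec_mulVec, Matrix.dotProduct_mulVec, ← Matrix.mulVec_transpose,
        hR.eq, hev, smul_dotProduct, ih, smul_eq_mul, pow_succ']
      ring
  rw [Fintype.linearIndependent_iff]
  intro a ha
  refine congrFun (Matrix.eq_zero_of_forall_index_sum_pow_mul_eq_zero hinj fun i => ?_)
  have h1 : ∑ k : Fin N, a k • ((R ^ (k : ℕ)) *ᵥ Pi.single l (1 : ℝ)) = 0 := by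
    have := congrArg (WithLp.ofLp) ha
    simpa using this
  have h2 := congrArg (fun w => (⇑(u i)) ⬝ᵥ w) h1
  simp only [dotProduct_sum, dotProduct_smul, hpow, dotProduct_zero, smul_eq_mul] at h2
  have h3 : (∑ k : Fin N, hH.eigenvalues i ^ (k : ℕ) * a k) * u i l = 0 := by
    rw [Finset.sum_mul, ← h2]
    exact Finset.sum_congr rfl fun k _ => by ring
  exact (mul_eq_zero.1 h3).resolve_right (hul i)

/-- From `Z R Z = -R`: if `Z f = ζ f` then `Z (R f) = ζ⁻¹ Z R Z f = -ζ⁻¹ R f`. -/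
theorem mulVec_krylov {Z : Matrix (Fin N) (Fin N) ℂ} {R : Matrix (Fin N) (Fin N) ℝ}
    (hricc : R.map Complex.ofReal + Z * R.map Complex.ofReal * Z = 0) {l : Fin N} {z : ℂ}
    (hz : z ≠ 0) (hl : Z *ᵥ Pi.single l 1 = z • Pi.single l 1) (k : ℕ) :
    Z *ᵥ complexify (WithLp.toLp 2 ((R ^ k) *ᵥ Pi.single l 1))
      = alternating z k • complexify (WithLp.toLp 2 ((R ^ k) *ᵥ Pi.single l 1)) := by
  induction k with
  | zero =>
    have : complexify (WithLp.toLp 2 ((R ^ 0) *ᵥ Pi.single l 1)) = Pi.single l 1 := by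
      ext j; by_cases hj : j = l
      · subst hj; simp [complexify]
      · simp [complexify, hj]
    rw [this, hl, alternating_zero]
  | succ k ih =>
    set f := complexify (WithLp.toLp 2 ((R ^ k) *ᵥ Pi.single l 1)) with hf
    have hsucc : complexify (WithLp.toLp 2 ((R ^ (k + 1)) *ᵥ Pi.single l 1))
        = R.map Complex.ofReal *ᵥ f := by
      rw [hf, mulVec_complexify, pow_succ', ← Matrix.mulVec_mulVec]
    rw [hsucc]
    have h1 : R.map Complex.ofReal *ᵥ f
        + alternating z k • (Z *ᵥ (R.map Complex.ofReal *ᵥ f)) = 0 := by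
      have := congrArg (fun M => M *ᵥ f) hricc
      simp only [Matrix.add_mulVec, Matrix.zero_mulVec] at this
      rwa [← Matrix.mulVec_mulVec, ← Matrix.mulVec_mulVec, ih, Matrix.mulVec_smul,
        Matrix.mulVec_smul] at this
    have h2 := congrArg (fun v => alternating z (k + 1) • v) h1
    have h3 : alternating z (k + 1) * alternating z k = -1 := by
      rw [mul_comm, alternating_mul_succ hz]
    simp only [smul_add, smul_zero, smul_smul, h3] at h2
    rw [neg_one_smul, ← sub_eq_add_neg, sub_eq_zero] at h2
    exact h2.symm

/-! ### Bordered matrices -/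

theorem bordered_zero_zero {n : ℕ} (z : ℂ) (M : Matrix (Fin n) (Fin n) ℂ) :
    bordered z M 0 0 = z := rfl

theorem bordered_zero_succ {n : ℕ} (z : ℂ) (M : Matrix (Fin n) (Fin n) ℂ) (j : Fin n) :
    bordered z M 0 j.succ = 0 := rfl

theorem bordered_succ_zero {n : ℕ} (z : ℂ) (M : Matrix (Fin n) (Fin n) ℂ) (i : Fin n) :
    bordered z M i.succ 0 = 0 := rfl

theorem bordered_succ_succ {n : ℕ} (z : ℂ) (M : Matrix (Fin n) (Fin n) ℂ) (i j : Fin n) :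
    bordered z M i.succ j.succ = M i j := rfl

theorem bordered_mul {n : ℕ} (a b : ℂ) (A B : Matrix (Fin n) (Fin n) ℂ) :
    bordered a A * bordered b B = bordered (a * b) (A * B) := by
  ext i j
  rw [Matrix.mul_apply, Fin.sum_univ_succ]
  refine Fin.cases ?_ (fun i => ?_) i <;> refine Fin.cases ?_ (fun j => ?_) j <;>
    simp [bordered_zero_zero, bordered_zero_succ, bordered_succ_zero, bordered_succ_succ,
      Matrix.mul_apply]

theorem bordered_transpose {n : ℕ} (a : ℂ) (A : Matrix (Fin n) (Fin n) ℂ) :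
    (bordered a A)ᵀ = bordered a Aᵀ := by
  ext i j
  refine Fin.cases ?_ (fun i => ?_) i <;> refine Fin.cases ?_ (fun j => ?_) j <;> rfl

theorem bordered_diagonal {n : ℕ} (a : ℂ) (d : Fin n → ℂ) :
    bordered a (Matrix.diagonal d) = Matrix.diagonal (Fin.cons a d) := by
  ext i j
  refine Fin.cases ?_ (fun i => ?_) i <;> refine Fin.cases ?_ (fun j => ?_) j <;>
    simp [bordered_zero_zero, bordered_zero_succ, bordered_succ_zero, bordered_succ_succ,
      Matrix.diagonal_apply, Fin.succ_ne_zero, (Fin.succ_ne_zero _).symm]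

theorem bordered_one_one {n : ℕ} : bordered 1 (1 : Matrix (Fin n) (Fin n) ℂ) = 1 := by
  rw [← Matrix.diagonal_one, bordered_diagonal, ← Matrix.diagonal_one]
  congr 1
  ext i; refine Fin.cases ?_ (fun i => ?_) i <;> simp

/-- The real block matrix `[1, 0; 0, Q]`. -/
def realBordered {n : ℕ} (Q : Matrix (Fin n) (Fin n) ℝ) : Matrix (Fin (n + 1)) (Fin (n + 1)) ℝ :=
  Matrix.of (Fin.cons (Fin.cons 1 0) (fun i => Fin.cons 0 (Q i)))

theorem map_realBordered {n : ℕ} (Q : Matrix (Fin n) (Fin n) ℝ) :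
    (realBordered Q).map Complex.ofReal = bordered 1 (Q.map Complex.ofReal) := by
  ext i j
  rw [Matrix.map_apply, realBordered, Matrix.of_apply]
  refine Fin.cases ?_ (fun i => ?_) i <;> refine Fin.cases ?_ (fun j => ?_) j <;>
    simp [bordered_zero_zero, bordered_zero_succ, bordered_succ_zero, bordered_succ_succ]

theorem realBordered_mul_transpose {n : ℕ} {Q : Matrix (Fin n) (Fin n) ℝ} (hQ : Q * Qᵀ = 1) :
    realBordered Q * (realBordered Q)ᵀ = 1 := by
  have h : ((realBordered Q * (realBordered Q)ᵀ).map Complex.ofReal)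
      = (1 : Matrix _ _ ℝ).map Complex.ofReal := by
    rw [map_ofReal_mul, Matrix.transpose_map, map_realBordered, bordered_transpose, bordered_mul,
      ← Matrix.transpose_map, ← map_ofReal_mul, hQ, map_ofReal_one, one_mul, bordered_one_one,
      map_ofReal_one]
  exact Matrix.map_injective Complex.ofReal_injective h

theorem assembled_apply {n : ℕ} (σ : Equiv.Perm (Fin (n + 1))) (Q : Matrix (Fin n) (Fin n) ℝ)
    (z : ℂ) (M : Matrix (Fin n) (Fin n) ℂ) (i j : Fin (n + 1)) :
    assembled σ Q z M i j
      = bordered z ((Q.map Complex.ofReal)ᵀ * M * Q.map Complex.ofReal) (σ.symm i) (σ.symm j) := by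
  rw [assembled, Equiv.Perm.permMatrix, ← PEquiv.toMatrix_symm, ← Equiv.toPEquiv_symm,
    PEquiv.toMatrix_toPEquiv_mul, PEquiv.mul_toMatrix_toPEquiv]
  rfl

/-- The states whose graph matrix has a real orthonormal eigenbasis, containing a basis vector
`e_l` with eigenvalue `z`, along which the eigenvalues alternate between `z` and `-1/z`. -/
def HasAlternatingForm {n : ℕ} (Z : Matrix (Fin (n + 1)) (Fin (n + 1)) ℂ) : Prop :=
  ∃ (σ : Equiv.Perm (Fin (n + 1))) (Q : Matrix (Fin n) (Fin n) ℝ) (z : ℂ),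
    Q ∈ Matrix.orthogonalGroup (Fin n) ℝ ∧ 0 < z.im ∧
    Z = assembled σ Q z (Matrix.diagonal fun i => alternating z (i + 1))

/-- The Krylov sequence `R^k e_l` consists of eigenvectors of `Z` with alternating eigenvalues, and
its Gram–Schmidt basis gives the rows of `Q`. -/
theorem CanBeGenerated.hasAlternatingForm {n : ℕ} {Z : Matrix (Fin (n + 1)) (Fin (n + 1)) ℂ}
    (hZ : IsGraphMatrix Z) (h : CanBeGenerated Z) : HasAlternatingForm Z := by
  obtain ⟨H, C, hH, ⟨c₁, c₂, l, rfl⟩, hgen⟩ := h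
  obtain ⟨R, hR, rfl⟩ := isPassiveHamiltonian_iff.1 hH
  obtain ⟨hker, hricc, hobs'⟩ := hgen.necessary hZ hR
  have hobs : ∀ (w : Fin (n + 1) → ℝ) (μ : ℝ), R *ᵥ w = μ • w → w l = 0 → w = 0 := by
    intro w μ hw hwl
    apply hobs' w μ hw <;>
    · refine Finset.sum_eq_zero fun j _ => ?_
      by_cases hj : j = l
      · subst hj; simp [hwl]
      · simp [hj]
  have hker1 : ∀ j, (Pi.single l c₁ : Fin (n + 1) → ℂ) j + c₂ * Z j l = 0 := by
    intro j
    have := hker j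
    have e : (fun k => (Sum.elim (Pi.single l c₁) (Pi.single l c₂) : _ → ℂ) (Sum.inr k))
        = Pi.single l c₂ := rfl
    rw [e] at this
    simpa [mul_comm] using this
  have hIm : 0 < (Z l l).im := by simpa using hZ.2.diag_pos (i := l)
  have hc₂ : c₂ ≠ 0 := by
    rintro rfl
    have hc₁ : c₁ = 0 := by simpa using hker1 l
    subst hc₁
    have hH : R.IsHermitian := by
      rw [Matrix.IsHermitian, Matrix.conjTranspose_eq_transpose_of_trivial]; exact hR
    apply hH.eigenvectorBasis.orthonormal.ne_zero 0
    ext j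
    exact congrFun (hobs' _ _ (hH.mulVec_eigenvectorBasis 0) (by simp) (by simp)) j
  set z := Z l l with hz
  have hz0 : z ≠ 0 := by rintro h0; rw [h0] at hIm; simp at hIm
  have hcol : ∀ j, j ≠ l → Z j l = 0 := by
    intro j hj
    have := hker1 j
    rw [Pi.single_eq_of_ne hj, zero_add] at this
    exact (mul_eq_zero.1 this).resolve_left hc₂
  have hl : Z *ᵥ Pi.single l 1 = z • Pi.single l 1 := by
    ext j
    by_cases hj : j = l
    · subst hj; simp [hz]
    · simp [hj, hcol j hj]
  -- the Gram–Schmidt basis of the Krylov sequence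
  set f : Fin (n + 1) → EuclideanSpace ℝ (Fin (n + 1)) :=
    fun k => WithLp.toLp 2 ((R ^ (k : ℕ)) *ᵥ Pi.single l 1) with hf
  have hli : LinearIndependent ℝ f := linearIndependent_krylov hR hobs
  set b := InnerProductSpace.gramSchmidtNormed ℝ f with hb
  have hon : Orthonormal ℝ b := InnerProductSpace.gramSchmidtNormed_orthonormal hli
  have heig : ∀ k : Fin (n + 1), Z *ᵥ complexify (b k) = alternating z k • complexify (b k) := by
    intro k
    have h1 := mulVec_gramSchmidt hZ.1 (f := f) (ζ := fun k => alternating z k)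
      (fun k => mulVec_krylov hricc hz0 hl k) k
    have h2 : complexify (b k)
        = ((‖InnerProductSpace.gramSchmidt ℝ f k‖⁻¹ : ℝ) : ℂ)
          • complexify (InnerProductSpace.gramSchmidt ℝ f k) := by
      ext j; simp [complexify, hb, InnerProductSpace.gramSchmidtNormed]
    rw [h2, Matrix.mulVec_smul, h1, smul_comm]
  have hb0 : b 0 = EuclideanSpace.single l 1 := by
    have h1 : f 0 = EuclideanSpace.single l 1 := by
      ext j; simp [hf, Matrix.one_apply]
    have h2 : InnerProductSpace.gramSchmidt ℝ f 0 = f 0 := InnerProductSpace.gramSchmidt_bot ℝ f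
    simp only [hb, InnerProductSpace.gramSchmidtNormed, h2, h1]
    simp
  have hbl : ∀ k : Fin n, b k.succ l = 0 := by
    intro k
    have : inner ℝ (b 0) (b k.succ) = 0 := hon.2 (Fin.succ_ne_zero k).symm
    rw [hb0, EuclideanSpace.inner_single_left] at this
    simpa using this
  set σ : Equiv.Perm (Fin (n + 1)) := Equiv.swap 0 l with hσ
  have hσ0 : σ 0 = l := Equiv.swap_apply_left _ _
  set Q : Matrix (Fin n) (Fin n) ℝ := Matrix.of fun k j => b k.succ (σ j.succ) with hQ
  have hQQ : Q * Qᵀ = 1 := by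
    ext k k'
    have h1 := orthonormal_iff_ite.1 hon k.succ k'.succ
    rw [PiLp.inner_apply, ← Equiv.sum_comp σ, Fin.sum_univ_succ, hσ0, hbl] at h1
    simp only [inner_zero_left, zero_add, Fin.succ_inj] at h1
    rw [Matrix.one_apply, ← h1, Matrix.mul_apply]
    exact Finset.sum_congr rfl fun j _ => by simp [hQ, mul_comm]
  have hQQ' : Qᵀ * Q = 1 := mul_eq_one_comm.1 hQQ
  refine ⟨σ, Q, z, (Matrix.mem_orthogonalGroup_iff _ _).2 hQQ, hIm, ?_⟩
  set M : Matrix (Fin n) (Fin n) ℂ := Matrix.of fun i j => Z (σ i.succ) (σ j.succ) with hM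
  set Qc := Q.map Complex.ofReal with hQc
  have hQc1 : Qcᵀ * Qc = 1 := by
    rw [hQc, ← Matrix.transpose_map, ← map_ofReal_mul, hQQ', map_ofReal_one]
  have hMQ : M * Qcᵀ = Qcᵀ * Matrix.diagonal fun i : Fin n => alternating z (i + 1) := by
    ext i k
    have h1 := congrFun (heig k.succ) (σ i.succ)
    rw [Matrix.mulVec, dotProduct, ← Equiv.sum_comp σ, Fin.sum_univ_succ, hσ0] at h1
    simp only [complexify, hbl, Complex.ofReal_zero, mul_zero, zero_add, Pi.smul_apply,
      smul_eq_mul, Fin.val_succ] at h1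
    rw [Matrix.mul_diagonal, Matrix.mul_apply, mul_comm]
    exact h1
  have hMeq : Qcᵀ * (Matrix.diagonal fun i : Fin n => alternating z (i + 1)) * Qc = M := by
    rw [← hMQ, Matrix.mul_assoc, hQc1, Matrix.mul_one]
  have hlow : ∀ j : Fin n, σ j.succ ≠ l := fun j h =>
    Fin.succ_ne_zero j (σ.injective (h.trans hσ0.symm))
  have hval : ∀ i j, Z (σ i) (σ j) = bordered z M i j := by
    intro i j
    refine Fin.cases ?_ (fun i => ?_) i <;> refine Fin.cases ?_ (fun j => ?_) j
    · rw [hσ0, bordered_zero_zero]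
    · rw [hσ0, bordered_zero_succ, ← hZ.1.apply, hcol _ (hlow j)]
    · rw [hσ0, bordered_succ_zero, hcol _ (hlow i)]
    · rfl
  ext i j
  rw [assembled_apply, hMeq, ← hval, Equiv.apply_symm_apply, Equiv.apply_symm_apply]

/-! ### Construction of a generating system -/

/-- The adjacency matrix of the path `0 — 1 — 2 — ⋯`. -/
def pathMatrix (n : ℕ) : Matrix (Fin n) (Fin n) ℝ :=
  Matrix.of fun i j => if (i : ℕ) = j + 1 ∨ (j : ℕ) = i + 1 then 1 else 0

theorem pathMatrix_symm (n : ℕ) : (pathMatrix n).IsSymm := by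
  ext i j
  simp [pathMatrix, or_comm]

/-- Neighbours on the path carry eigenvalues whose product is `-1`. -/
theorem pathMatrix_add {n : ℕ} {z : ℂ} (hz : z ≠ 0) :
    (pathMatrix n).map Complex.ofReal + (Matrix.diagonal fun i : Fin n => alternating z i) *
      (pathMatrix n).map Complex.ofReal * (Matrix.diagonal fun i : Fin n => alternating z i)
      = 0 := by
  ext i j
  rw [Matrix.add_apply, Matrix.mul_diagonal, Matrix.diagonal_mul, Matrix.map_apply, pathMatrix,
    Matrix.of_apply, Matrix.zero_apply]
  split_ifs with h
  · rcases h with h | h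
    · rw [h, Complex.ofReal_one]
      linear_combination alternating_mul_succ hz j
    · rw [h, Complex.ofReal_one]
      linear_combination alternating_mul_succ hz i
  · simp

/-- An eigenvector of a weighted path is determined by its first coordinate. -/
theorem eq_zero_of_pathMatrix {n : ℕ} {z : ℂ} (hz : z ≠ 0) {u : Fin (n + 1) → ℂ} {μ : ℂ}
    (hu : (pathMatrix (n + 1)).map Complex.ofReal *ᵥ
      ((Matrix.diagonal fun i : Fin (n + 1) => alternating z i) *ᵥ u) = μ • u)
    (h0 : u 0 = 0) : u = 0 := by
  have key : ∀ (k : ℕ) (hk : k < n + 1), u ⟨k, hk⟩ = 0 := by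
    intro k
    induction k using Nat.strong_induction_on with
    | _ k ih =>
    intro hk
    rcases k with _ | k
    · exact h0
    have h1 := congrFun hu ⟨k, by omega⟩
    rw [Pi.smul_apply, ih k (by omega), smul_zero, Matrix.mulVec, dotProduct,
      Finset.sum_eq_single ⟨k + 1, hk⟩] at h1
    · rw [Matrix.mulVec_diagonal] at h1
      have h2 : (pathMatrix (n + 1)).map Complex.ofReal ⟨k, by omega⟩ ⟨k + 1, hk⟩ = 1 := by
        simp [pathMatrix]
      rw [h2, one_mul] at h1
      exact (mul_eq_zero.1 h1).resolve_left (alternating_ne_zero hz _)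
    · rintro ⟨j, hj⟩ - hne
      rw [Matrix.mulVec_diagonal]
      by_cases hjk : j < k + 1
      · rw [ih j hjk hj, mul_zero, mul_zero]
      · have hne' : j ≠ k + 1 := fun h => hne (Fin.ext h)
        have h2 : (pathMatrix (n + 1)).map Complex.ofReal ⟨k, by omega⟩ ⟨j, hj⟩ = 0 := by
          rw [Matrix.map_apply, pathMatrix, Matrix.of_apply, if_neg]
          · simp
          · simp only; omega
        rw [h2, zero_mul]
    · simp
  ext ⟨k, hk⟩
  exact key k hk

/-- The eigenbasis of `Z` is coupled as a chain, with the reservoir at its first site `e_l`,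
`l = σ 0`. -/
theorem HasAlternatingForm.canBeGenerated {n : ℕ} {Z : Matrix (Fin (n + 1)) (Fin (n + 1)) ℂ}
    (hZ : IsGraphMatrix Z) (h : HasAlternatingForm Z) : CanBeGenerated Z := by
  obtain ⟨σ, Q, z, hQ, hz, hZe⟩ := h
  have hz0 : z ≠ 0 := by rintro rfl; simp at hz
  have hQQ : Q * Qᵀ = 1 := (Matrix.mem_orthogonalGroup_iff _ _).1 hQ
  -- the rows of `G` are the eigenvectors of `Z`
  set G : Matrix (Fin (n + 1)) (Fin (n + 1)) ℝ := (realBordered Q).submatrix id σ.symm with hG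
  set Gc := G.map Complex.ofReal with hGc
  set Qc := Q.map Complex.ofReal with hQc
  have hGsub : Gc = (bordered 1 Qc).submatrix id σ.symm := by
    rw [hGc, hG, ← Matrix.submatrix_map, map_realBordered]
  have hGG : Gc * Gcᵀ = 1 := by
    rw [hGc, ← Matrix.transpose_map, ← map_ofReal_mul, hG, Matrix.transpose_submatrix,
      Matrix.submatrix_mul_equiv, realBordered_mul_transpose hQQ, Matrix.submatrix_id_id,
      map_ofReal_one]
  have hGG' : Gcᵀ * Gc = 1 := mul_eq_one_comm.1 hGG
  set D := Matrix.diagonal fun i : Fin (n + 1) => alternating z i with hD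
  have hDb : D = bordered z (Matrix.diagonal fun i : Fin n => alternating z (i + 1)) := by
    rw [bordered_diagonal, hD]
    congr 1
    ext i; refine Fin.cases ?_ (fun i => ?_) i
    · simp [alternating_zero]
    · simp
  have hZG : Z = Gcᵀ * D * Gc := by
    ext i j
    rw [hZe, assembled_apply, hGsub, hDb, Matrix.transpose_submatrix, bordered_transpose]
    have h1 : bordered z (Qcᵀ * (Matrix.diagonal fun i : Fin n => alternating z (i + 1)) * Qc)
        = bordered 1 Qcᵀ * bordered z (Matrix.diagonal fun i : Fin n => alternating z (i + 1))
          * bordered 1 Qc := by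
      rw [bordered_mul, bordered_mul, one_mul, mul_one]
    rw [h1]
    rfl
  set T := (pathMatrix (n + 1)).map Complex.ofReal with hT
  have hRc : (Gᵀ * pathMatrix (n + 1) * G).map Complex.ofReal = Gcᵀ * T * Gc := by
    rw [map_ofReal_mul, map_ofReal_mul, Matrix.transpose_map]
  have hcol : Gc *ᵥ Pi.single (σ 0) 1 = Pi.single 0 1 := by
    ext i
    rw [Matrix.mulVec_single_one, Matrix.col_apply, hGsub, Matrix.submatrix_apply,
      Equiv.symm_apply_apply]
    refine Fin.cases ?_ (fun i => ?_) i
    · simp [bordered_zero_zero]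
    · simp [bordered_succ_zero]
  have hcol' : Gcᵀ *ᵥ Pi.single 0 1 = Pi.single (σ 0) 1 := by
    rw [← hcol, Matrix.mulVec_mulVec, hGG', Matrix.one_mulVec]
  have hdrive : Drives Z (Gᵀ * pathMatrix (n + 1) * G) (σ 0) z := by
    refine ⟨hZ, ?_, ?_, ?_, ?_⟩
    · rw [Matrix.IsSymm, Matrix.transpose_mul, Matrix.transpose_mul, Matrix.transpose_transpose,
        (pathMatrix_symm _).eq, Matrix.mul_assoc]
    · rw [hRc, hZG]
      have h1 : Gcᵀ * D * Gc * (Gcᵀ * T * Gc) * (Gcᵀ * D * Gc)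
          = Gcᵀ * (D * ((Gc * Gcᵀ) * T * (Gc * Gcᵀ)) * D) * Gc := by
        simp only [Matrix.mul_assoc]
      rw [h1, hGG, Matrix.one_mul, Matrix.mul_one, ← Matrix.add_mul, ← Matrix.mul_add,
        pathMatrix_add hz0, Matrix.mul_zero, Matrix.zero_mul]
    · intro j
      have h1 : Z *ᵥ Pi.single (σ 0) 1 = z • Pi.single (σ 0) 1 := by
        rw [hZG, ← Matrix.mulVec_mulVec, ← Matrix.mulVec_mulVec, hcol, hD,
          Matrix.diagonal_mulVec_single, mul_one, Fin.val_zero, alternating_zero, ← hcol',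
          ← Matrix.mulVec_smul]
        congr 1
        ext i; simp [Pi.single_apply]
      have h2 := congrFun h1 j
      rw [Matrix.mulVec_single_one, Matrix.col_apply, hZ.1.apply] at h2
      rw [h2]
      simp [Pi.single_apply]
    · intro μ v hv hvl
      have hu : T *ᵥ (D *ᵥ (Gc *ᵥ v)) = μ • (Gc *ᵥ v) := by
        rw [← Matrix.mulVec_smul, ← hv, hRc, hZG]
        simp only [Matrix.mulVec_mulVec]
        have h1 : Gc * (Gcᵀ * T * Gc * (Gcᵀ * D * Gc))
            = (Gc * Gcᵀ) * T * (Gc * Gcᵀ) * D * Gc := by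
          simp only [Matrix.mul_assoc]
        rw [h1, hGG, Matrix.one_mul, Matrix.mul_one, Matrix.mul_assoc]
      have hu0 : (Gc *ᵥ v) 0 = 0 := by
        have h1 : (Gc *ᵥ v) 0 = Pi.single 0 1 ⬝ᵥ (Gc *ᵥ v) := by simp
        rw [h1, Matrix.dotProduct_mulVec, ← Matrix.mulVec_transpose, hcol']
        simpa using hvl
      have h0 := eq_zero_of_pathMatrix hz0 hu hu0
      rw [← Matrix.one_mulVec v, ← hGG', ← Matrix.mulVec_mulVec, h0, Matrix.mulVec_zero]
  exact hdrive.canBeGenerated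

theorem canBeGenerated_iff {n : ℕ} {Z : Matrix (Fin (n + 1)) (Fin (n + 1)) ℂ}
    (hZ : IsGraphMatrix Z) : CanBeGenerated Z ↔ HasAlternatingForm Z :=
  ⟨fun h => h.hasAlternatingForm hZ, fun h => h.canBeGenerated hZ⟩

/-! ### Block diagonalization -/

/-- `M = Qᵀ diag(d) Q` with a real orthogonal matrix `Q`. -/
def IsRealDiagonalizable {ι : Type*} [Fintype ι] [DecidableEq ι] (M : Matrix ι ι ℂ) (d : ι → ℂ) :
    Prop :=
  ∃ Q : Matrix ι ι ℝ, Q * Qᵀ = 1 ∧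
    M = (Q.map Complex.ofReal)ᵀ * Matrix.diagonal d * Q.map Complex.ofReal

theorem IsRealDiagonalizable.comp_equiv {ι κ : Type*} [Fintype ι] [DecidableEq ι] [Fintype κ]
    [DecidableEq κ] {M : Matrix ι ι ℂ} {d : ι → ℂ} (h : IsRealDiagonalizable M d) (e : κ ≃ ι) :
    IsRealDiagonalizable (M.submatrix e e) (d ∘ e) := by
  obtain ⟨Q, hQ, rfl⟩ := h
  refine ⟨Q.submatrix e e, ?_, ?_⟩
  · rw [Matrix.transpose_submatrix, Matrix.submatrix_mul_equiv, hQ, Matrix.submatrix_one_equiv]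
  · rw [← Matrix.submatrix_map, Matrix.transpose_submatrix, ← Matrix.submatrix_diagonal_equiv,
      Matrix.submatrix_mul_equiv, Matrix.submatrix_mul_equiv]

/-- The eigenvectors are `(1, ±s)/√2` with `s = ±1`. -/
theorem isRealDiagonalizable_two (a b : ℂ) {s : ℝ} (hs : s * s = 1) :
    IsRealDiagonalizable !![(a + b) / 2, s * (a - b) / 2; s * (a - b) / 2, (a + b) / 2]
      ![a, b] := by
  have h2 : (√2)⁻¹ * (√2)⁻¹ = (1 / 2 : ℝ) := by
    rw [← mul_inv, Real.mul_self_sqrt (by norm_num)]; norm_num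
  have h2c : (((√2 : ℝ) : ℂ))⁻¹ * (((√2 : ℝ) : ℂ))⁻¹ = 1 / 2 := by
    have := congrArg Complex.ofReal h2
    push_cast at this
    exact this
  have hsc : (s : ℂ) * s = 1 := by exact_mod_cast hs
  refine ⟨(√2)⁻¹ • !![1, s; 1, -s], ?_, ?_⟩
  · ext i j
    fin_cases i <;> fin_cases j <;> simp [Matrix.mul_apply, Fin.sum_univ_two]
    · linear_combination (1 + s * s) * h2 + (1 / 2) * hs
    · linear_combination (1 - s * s) * h2 - (1 / 2) * hs
    · linear_combination (1 - s * s) * h2 - (1 / 2) * hs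
    · linear_combination (1 + s * s) * h2 + (1 / 2) * hs
  · ext i j
    fin_cases i <;> fin_cases j <;>
      simp [Matrix.mul_apply, Fin.sum_univ_two, Matrix.diagonal_apply]
    · linear_combination -(a + b) * h2c
    · linear_combination -(s * (a - b)) * h2c
    · linear_combination -(s * (a - b)) * h2c
    · linear_combination -((s : ℂ) * s * (a + b)) * h2c - (a + b) / 2 * hsc

/-- Both blocks have the eigenvectors `(1, ±1)`, with eigenvalues `z` and `-1/z` in one order or the
other. -/
theorem isRealDiagonalizable_block {z : ℂ} (hz : z ≠ 0) {B : Matrix (Fin 2) (Fin 2) ℂ}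
    (hB : B = blockPlus z ∨ B = blockMinus z) (k : ℕ) :
    IsRealDiagonalizable B fun a => alternating z (a + k) := by
  have h1 : alternating z (k + 1) = -1 / alternating z k := by
    rw [eq_div_iff (alternating_ne_zero hz k), mul_comm, alternating_mul_succ hz]
  have hd : (fun a : Fin 2 => alternating z (a + k))
      = ![alternating z k, -1 / alternating z k] := by
    ext a; fin_cases a
    · simp
    · simp [add_comm 1 k, h1]
  have hz2 : (2 : ℂ) * z ≠ 0 := by simp [hz]
  have key : ∃ s : ℝ, s * s = 1 ∧
      B = !![(alternating z k + -1 / alternating z k) / 2,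
          s * (alternating z k - -1 / alternating z k) / 2;
        s * (alternating z k - -1 / alternating z k) / 2,
          (alternating z k + -1 / alternating z k) / 2] := by
    have hcase : alternating z k = z ∨ alternating z k = -1 / z := by
      rw [alternating]; split_ifs <;> simp
    have e1 : (z ^ 2 - 1) / (2 * z) = (z + -1 / z) / 2 := by field_simp; ring
    have e2 : (z ^ 2 + 1) / (2 * z) = (z - -1 / z) / 2 := by field_simp; ring
    have e3 : -1 / (-1 / z) = z := by field_simp
    rcases hB with rfl | rfl <;> rcases hcase with hc | hc <;> rw [hc]
    · refine ⟨1, by norm_num, ?_⟩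
      rw [blockPlus, e1, e2, Complex.ofReal_one, one_mul]
    · refine ⟨-1, by norm_num, ?_⟩
      rw [blockPlus, e1, e2, e3]
      push_cast; congr 1; ring_nf
    · refine ⟨-1, by norm_num, ?_⟩
      rw [blockMinus, e1, e2]
      push_cast; congr 1; ring_nf
    · refine ⟨1, by norm_num, ?_⟩
      rw [blockMinus, e1, e2, e3, Complex.ofReal_one, one_mul]
      congr 1; ring_nf
  obtain ⟨s, hs, hBs⟩ := key
  rw [hd, hBs]
  exact isRealDiagonalizable_two _ _ hs

theorem isRealDiagonalizable_diagBlocks {m : ℕ} {z : ℂ} (hz : z ≠ 0)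
    {B : Fin m → Matrix (Fin 2) (Fin 2) ℂ} (hB : ∀ j, B j = blockPlus z ∨ B j = blockMinus z)
    (k : ℕ) : IsRealDiagonalizable (diagBlocks B) fun i => alternating z (i + k) := by
  choose H hH1 hH2 using fun j => isRealDiagonalizable_block hz (hB j) k
  set e : Fin 2 × Fin m ≃ Fin (m * 2) := (Equiv.prodComm _ _).trans finProdFinEquiv with he
  have h1 : IsRealDiagonalizable (Matrix.blockDiagonal B)
      (fun p : Fin 2 × Fin m => alternating z (p.1 + k)) := by
    refine ⟨Matrix.blockDiagonal H, ?_, ?_⟩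
    · rw [Matrix.blockDiagonal_transpose, ← Matrix.blockDiagonal_mul]
      simp only [hH1]
      exact Matrix.blockDiagonal_one
    · have hd : Matrix.diagonal (fun p : Fin 2 × Fin m => alternating z (p.1 + k))
          = Matrix.blockDiagonal fun _ : Fin m =>
            Matrix.diagonal fun a : Fin 2 => alternating z (a + k) := by
        rw [Matrix.blockDiagonal_diagonal]
      rw [hd, Matrix.blockDiagonal_map _ _ Complex.ofReal_zero, Matrix.blockDiagonal_transpose,
        ← Matrix.blockDiagonal_mul, ← Matrix.blockDiagonal_mul]
      congr 1
      ext1 j; exact hH2 j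
  have h2 := h1.comp_equiv e.symm
  have h3 : (fun p : Fin 2 × Fin m => alternating z (p.1 + k)) ∘ e.symm
      = fun i : Fin (m * 2) => alternating z (i + k) := by
    ext i
    obtain ⟨⟨a, j⟩, rfl⟩ := e.surjective i
    have hv : ((e (a, j) : Fin (m * 2)) : ℕ) = a + 2 * j := by
      simp [he]
    have hper : ∀ t : ℕ, alternating z (a + 2 * t + k) = alternating z (a + k) := by
      intro t
      simp [alternating, Nat.even_add]
    rw [Function.comp_apply, Equiv.symm_apply_apply, hv, hper]
  rw [h3] at h2
  exact h2

theorem IsRealDiagonalizable.bordered {n : ℕ} {M : Matrix (Fin n) (Fin n) ℂ} {d : Fin n → ℂ}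
    (h : IsRealDiagonalizable M d) (a : ℂ) :
    IsRealDiagonalizable (bordered a M) (Fin.cons a d : Fin (n + 1) → ℂ) := by
  obtain ⟨Q, hQ, rfl⟩ := h
  refine ⟨realBordered Q, realBordered_mul_transpose hQ, ?_⟩
  rw [map_realBordered, bordered_transpose, ← bordered_diagonal, bordered_mul, bordered_mul,
    one_mul, mul_one]

theorem assembled_conj {n : ℕ} (σ : Equiv.Perm (Fin (n + 1))) (Q Q' : Matrix (Fin n) (Fin n) ℝ)
    (z : ℂ) (M : Matrix (Fin n) (Fin n) ℂ) :
    assembled σ Q z ((Q'.map Complex.ofReal)ᵀ * M * Q'.map Complex.ofReal)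
      = assembled σ (Q' * Q) z M := by
  rw [assembled, assembled, map_ofReal_mul, Matrix.transpose_mul]
  simp only [Matrix.mul_assoc]

/-- The blocks of the normal form may be taken from any family of matrices with the right real
diagonalization. -/
theorem canBeGenerated_iff_exists_assembled {n : ℕ} {Z : Matrix (Fin (n + 1)) (Fin (n + 1)) ℂ}
    (hZ : IsGraphMatrix Z) {ι : Type*} [Nonempty ι] {S : ℂ → ι → Prop}
    {M : ℂ → ι → Matrix (Fin n) (Fin n) ℂ} (hS : ∀ z, ∃ i, S z i)
    (hM : ∀ z i, z ≠ 0 → S z i → IsRealDiagonalizable (M z i) fun k => alternating z (k + 1)) :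
    CanBeGenerated Z ↔
      ∃ (σ : Equiv.Perm (Fin (n + 1))) (Q : Matrix (Fin n) (Fin n) ℝ) (z : ℂ) (i : ι),
        Q ∈ Matrix.orthogonalGroup (Fin n) ℝ ∧ 0 < z.im ∧ S z i ∧ Z = assembled σ Q z (M z i) := by
  rw [canBeGenerated_iff hZ]
  constructor
  · rintro ⟨σ, Q, z, hQ, hz, hZe⟩
    have hz0 : z ≠ 0 := by rintro rfl; simp at hz
    obtain ⟨i, hi⟩ := hS z
    obtain ⟨Q', hQ', hMe⟩ := hM z i hz0 hi
    have hO : Q' ∈ Matrix.orthogonalGroup (Fin n) ℝ := (Matrix.mem_orthogonalGroup_iff _ _).2 hQ'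
    refine ⟨σ, Q'ᵀ * Q, z, i, mul_mem (Unitary.star_mem hO) hQ, hz, hi, ?_⟩
    rw [hMe, assembled_conj, ← Matrix.mul_assoc, hQ', Matrix.one_mul, hZe]
  · rintro ⟨σ, Q, z, i, hQ, hz, hi, hZe⟩
    have hz0 : z ≠ 0 := by rintro rfl; simp at hz
    obtain ⟨Q', hQ', hMe⟩ := hM z i hz0 hi
    have hO : Q' ∈ Matrix.orthogonalGroup (Fin n) ℝ := (Matrix.mem_orthogonalGroup_iff _ _).2 hQ'
    refine ⟨σ, Q' * Q, z, mul_mem hO hQ, hz, ?_⟩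
    rw [hZe, hMe, assembled_conj]

end LinQuantum

end

theorem theorem2 :
    -- an odd number `N = 2m + 1` of modes
    (∀ (m : ℕ) (Z : Matrix (Fin (m * 2 + 1)) (Fin (m * 2 + 1)) ℂ), LinQuantum.IsGraphMatrix Z →
      (LinQuantum.CanBeGenerated Z ↔
        ∃ (σ : Equiv.Perm (Fin (m * 2 + 1))) (Q : Matrix (Fin (m * 2)) (Fin (m * 2)) ℝ) (z : ℂ)
          (B : Fin m → Matrix (Fin 2) (Fin 2) ℂ),
          Q ∈ Matrix.orthogonalGroup (Fin (m * 2)) ℝ ∧ 0 < z.im ∧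
          (∀ j, B j = LinQuantum.blockPlus z ∨ B j = LinQuantum.blockMinus z) ∧
          Z = LinQuantum.assembled σ Q z (LinQuantum.diagBlocks B))) ∧
    -- an even number `N = 2m + 2` of modes
    (∀ (m : ℕ) (Z : Matrix (Fin (m * 2 + 1 + 1)) (Fin (m * 2 + 1 + 1)) ℂ),
      LinQuantum.IsGraphMatrix Z →
      (LinQuantum.CanBeGenerated Z ↔
        ∃ (σ : Equiv.Perm (Fin (m * 2 + 1 + 1)))
          (Q : Matrix (Fin (m * 2 + 1)) (Fin (m * 2 + 1)) ℝ) (z : ℂ)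
          (B : Fin m → Matrix (Fin 2) (Fin 2) ℂ),
          Q ∈ Matrix.orthogonalGroup (Fin (m * 2 + 1)) ℝ ∧ 0 < z.im ∧
          (∀ j, B j = LinQuantum.blockPlus z ∨ B j = LinQuantum.blockMinus z) ∧
          Z = LinQuantum.assembled σ Q z
            (LinQuantum.bordered (-1 / z) (LinQuantum.diagBlocks B)))) := by
  refine ⟨fun m Z hZ => ?_, fun m Z hZ => ?_⟩
  · exact LinQuantum.canBeGenerated_iff_exists_assembled hZ
      (S := fun z B => ∀ j, B j = LinQuantum.blockPlus z ∨ B j = LinQuantum.blockMinus z)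
      (M := fun _ B => LinQuantum.diagBlocks B) (fun z => ⟨fun _ => _, fun _ => Or.inl rfl⟩)
      fun z B hz hB => LinQuantum.isRealDiagonalizable_diagBlocks hz hB 1
  · refine LinQuantum.canBeGenerated_iff_exists_assembled hZ
      (S := fun z B => ∀ j, B j = LinQuantum.blockPlus z ∨ B j = LinQuantum.blockMinus z)
      (M := fun z B => LinQuantum.bordered (-1 / z) (LinQuantum.diagBlocks B))
      (fun z => ⟨fun _ => _, fun _ => Or.inl rfl⟩) fun z B hz hB => ?_
    convert (LinQuantum.isRealDiagonalizable_diagBlocks hz hB 0).bordered (-1 / z) using 1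
    ext i
    refine Fin.cases ?_ (fun i => ?_) i
    · simp [LinQuantum.alternating]
    · simp [LinQuantum.alternating_add_two]
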